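/- Let $n\ge 1$, $s\in(0,1)$, $n>2s$, and let $\Omega\subset\mathbb R^n$ be a bounded domain with smooth boundary. Let $0<q<1$, $\alpha>1$, $\beta>1$ with $2<\alpha+\beta<2_s^*-1$, where $2_s^*=\frac{2n}{n-2s}$, and put $q^*=\frac{\alpha+\beta}{\alpha+\beta-1+q}$. Let $f,g\in L^{q^*}(\Omega)$ with $f,g>0$ a.e. in $\Omega$, and let $b\in L^\infty(\Omega)$ (possibly sign-changing) with $b^+=\max\{b,0\}\not\equiv 0$. Let $Q=\mathbb R^{2n}\setminus(\Omega^c\times\Omega^c)$ and let $X_0$ be the space of measurable $u:\mathbb R^n\to\mathbb R$ with $u|_\Omega\in L^2(\Omega)$, $\frac{u(x)-u(y)}{|x-y|^{(n+2s)/2}}\in L^2(Q)$ and $u=0$ a.e. in $\mathbb R^n\setminus\Omega$. For $u,\varphi\in X_0$ put $$\langle u,\varphi\rangle=\int_Q\frac{(u(x)-u(y))(\varphi(x)-\varphi(y))}{|x-y|^{n+2s}}\,dx\,dy ,\qquad \|u\|^2=\langle u,u\rangle ,$$ and on $Y=X_0\times X_0$ put $\|(u,w)\|^2=\|u\|^2+\|w\|^2$.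 Let $$S=\inf_{u\in X_0\setminus\{0\}}\frac{\int_{\mathbb R^{2n}}|u(x)-u(y)|^2|x-y|^{-(n+2s)}\,dx\,dy}{\left(\int_{\mathbb R^n}|u|^{\alpha+\beta}dx\right)^{2/(\alpha+\beta)}}.$$ For $\lambda,\mu\in\mathbb R$, a positive weak solution of the system $$(P_{\lambda,\mu})\quad\begin{cases}(-\Delta)^su=\lambda f u^{-q}+\frac{\alpha}{\alpha+\beta}\,b\,u^{\alpha-1}w^{\beta}&\text{in }\Omega,\\ (-\Delta)^sw=\mu g w^{-q}+\frac{\beta}{\alpha+\beta}\,b\,u^{\alpha}w^{\beta-1}&\text{in }\Omega,\\ u,w>0\ \text{in }\Omega,\quad u=w=0\ \text{in }\mathbb R^n\setminus\Omega\end{cases}$$ is a pair $(u,w)\in Y$ with $u,w>0$ a.e. in $\Omega$ such that for all $(\varphi,\psi)\in Y$ the functions $fu^{-q}\varphi$, $gw^{-q}\psi$, $bu^{\alpha-1}w^\beta\varphi$, $bu^\alpha w^{\beta-1}\psi$ are integrable on $\Omega$ and $$\langle u,\varphi\rangle+\langle w,\psi\rangle=\lambda\int_\Omega fu^{-q}\varphi+\mu\int_\Omega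 gw^{-q}\psi+\frac{\alpha}{\alpha+\beta}\int_\Omega bu^{\alpha-1}w^{\beta}\varphi+\frac{\beta}{\alpha+\beta}\int_\Omega bu^{\alpha}w^{\beta-1}\psi .$$ Let $$J_{\lambda,\mu}(u,w)=\frac12\|(u,w)\|^2-\frac1{1-q}\int_\Omega\left(\lambda f u_+^{1-q}+\mu g w_+^{1-q}\right)dx-\frac1{\alpha+\beta}\int_\Omega b\,u_+^\alpha w_+^\beta\,dx,$$ where $t_+=\max\{t,0\}$. For $(u,w)\in Y$ let $\phi_{u,w}(t)=J_{\lambda,\mu}(tu,tw)$ for $t>0$, and let $$\mathcal N_{\lambda,\mu}=\{(u,w)\in Y:\phi_{u,w}'(1)=0\},\qquad \mathcal N^{\pm}_{\lambda,\mu}=\{(u,w)\in\mathcal N_{\lambda,\mu}:\pm\phi_{u,w}''(1)>0\}.$$ Finally let $\Gamma$ be the set of $(\lambda,\mu)\in\mathbb R^2\setminus\{(0,0)\}$ with $$0<(|\lambda|\,\|f\|_{L^{q^*}(\Omega)})^{\frac2{1+q}}+(|\mu|\,\|g\|_{L^{q^*}(\Omega)})^{\frac2{1+q}}<C(n,\alpha,\beta,q,S),$$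 $$C(n,\alpha,\beta,q,S)=\left(\frac{1+q}{\alpha+\beta-1+q}\right)^{\frac2{\alpha+\beta-2}}\left(\frac{\alpha+\beta-2}{\alpha+\beta-1+q}\right)^{\frac2{1+q}}\left(\frac1{\|b\|_{L^\infty(\Omega)}}\right)^{\frac2{\alpha+\beta-2}}S^{\frac{2(\alpha+\beta-1+q)}{(1+q)(\alpha+\beta-2)}} .$$ **Theorem.** If $\lambda>0$, $\mu>0$ and $(\lambda,\mu)\in\Gamma$, then $(P_{\lambda,\mu})$ has at least two positive weak solutions, one $(u,w)\in\mathcal N^+_{\lambda,\mu}$ and another $(U,W)\in\mathcal N^-_{\lambda,\mu}$, and $\|(U,W)\|>\|(u,w)\|$. -/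

import Mathlib

open MeasureTheory Set
open scoped ENNReal ContDiff

noncomputable section

namespace FracSystem

/-- `ℝⁿ` with its Euclidean norm and Lebesgue measure. -/
abbrev E (n : ℕ) : Type := EuclideanSpace ℝ (Fin n)

/-- A bounded domain (open, connected, nonempty) of `ℝⁿ` with smooth boundary: near each boundary
point it is the sublevel set `{ρ < 0}` of a smooth function without critical points. -/
structure IsSmoothBoundedDomain {n : ℕ} (Ω : Set (E n)) : Prop where
  isOpen : IsOpen Ω
  isConnected : IsConnected Ω
  isBounded : Bornology.IsBounded Ω
  smooth_boundary : ∀ x ∈ frontier Ω, ∃ (U : Set (E n)) (ρ : E n → ℝ),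
    IsOpen U ∧ x ∈ U ∧ ContDiffOn ℝ ∞ ρ U ∧ (∀ y ∈ U, fderiv ℝ ρ y ≠ 0) ∧
      Ω ∩ U = {y ∈ U | ρ y < 0}

/-- The fractional critical Sobolev exponent `2n / (n - 2s)`. -/
def critExp (n : ℕ) (s : ℝ) : ℝ := 2 * n / (n - 2 * s)

/-- `Q = ℝ²ⁿ ∖ (Ωᶜ × Ωᶜ)`. -/
def Q {n : ℕ} (Ω : Set (E n)) : Set (E n × E n) := (Ωᶜ ×ˢ Ωᶜ)ᶜ

/-- The space `X₀` (its elements are functions, to be identified when equal a.e.). -/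
def X₀ {n : ℕ} (s : ℝ) (Ω : Set (E n)) : Set (E n → ℝ) :=
  {u | AEMeasurable u volume ∧ MemLp u 2 (volume.restrict Ω) ∧
    MemLp (fun z : E n × E n => (u z.1 - u z.2) / ‖z.1 - z.2‖ ^ (((n : ℝ) + 2 * s) / 2)) 2
      (volume.restrict (Q Ω)) ∧
    ∀ᵐ x ∂(volume : Measure (E n)), x ∉ Ω → u x = 0}

/-- The inner product of `X₀`,
`∫_Q (u(x) - u(y)) (φ(x) - φ(y)) / |x - y|^(n + 2s) dx dy`. -/
def form {n : ℕ} (s : ℝ) (Ω : Set (E n)) (u φ : E n → ℝ) : ℝ :=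
  ∫ z in Q Ω, (u z.1 - u z.2) * (φ z.1 - φ z.2) / ‖z.1 - z.2‖ ^ ((n : ℝ) + 2 * s)

/-- The norm of `X₀`. -/
def normX₀ {n : ℕ} (s : ℝ) (Ω : Set (E n)) (u : E n → ℝ) : ℝ := √(form s Ω u u)

/-- The space `Y = X₀ × X₀`. -/
def Y {n : ℕ} (s : ℝ) (Ω : Set (E n)) : Set ((E n → ℝ) × (E n → ℝ)) := X₀ s Ω ×ˢ X₀ s Ω

/-- The norm of `Y`. -/
def normY {n : ℕ} (s : ℝ) (Ω : Set (E n)) (z : (E n → ℝ) × (E n → ℝ)) : ℝ :=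
  √(normX₀ s Ω z.1 ^ 2 + normX₀ s Ω z.2 ^ 2)

/-- The best constant `S` of the embedding `X₀ ⊂ L^p`: the infimum over nonzero `u ∈ X₀` of
`∫_{ℝ²ⁿ} |u(x) - u(y)|² / |x - y|^(n + 2s) dx dy / (∫_{ℝⁿ} |u|^p dx)^(2/p)`. -/
def sobolevConst {n : ℕ} (s : ℝ) (Ω : Set (E n)) (p : ℝ) : ℝ :=
  sInf {r : ℝ | ∃ u ∈ X₀ s Ω, ¬ (u =ᵐ[volume] 0) ∧
    r = (∫ z : E n × E n, |u z.1 - u z.2| ^ 2 / ‖z.1 - z.2‖ ^ ((n : ℝ) + 2 * s)) /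
      (∫ x, |u x| ^ p) ^ (2 / p)}

/-- The norm of `L^p(Ω)`. -/
def normLp {n : ℕ} (Ω : Set (E n)) (p : ℝ≥0∞) (f : E n → ℝ) : ℝ :=
  (eLpNorm f p (volume.restrict Ω)).toReal

/-- The exponent `q* = (α + β) / (α + β - 1 + q)`. -/
def qStar (α β q : ℝ) : ℝ := (α + β) / (α + β - 1 + q)

/-- The constant `C(n, α, β, q, S)`; the arguments `S` and `B` are the Sobolev constant and
`‖b‖_∞`. -/
def thresholdC (α β q S B : ℝ) : ℝ :=
  ((1 + q) / (α + β - 1 + q)) ^ (2 / (α + β - 2)) *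
    ((α + β - 2) / (α + β - 1 + q)) ^ (2 / (1 + q)) *
    (1 / B) ^ (2 / (α + β - 2)) *
    S ^ (2 * (α + β - 1 + q) / ((1 + q) * (α + β - 2)))

/-- `Λ = (|λ| ‖f‖_{q*})^(2/(1+q)) + (|μ| ‖g‖_{q*})^(2/(1+q))`. -/
def bigLambda {n : ℕ} (Ω : Set (E n)) (α β q : ℝ) (f g : E n → ℝ) (lam mu : ℝ) : ℝ :=
  (|lam| * normLp Ω (ENNReal.ofReal (qStar α β q)) f) ^ (2 / (1 + q)) +
    (|mu| * normLp Ω (ENNReal.ofReal (qStar α β q)) g) ^ (2 / (1 + q))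

/-- The parameter region `Γ`. -/
def regionΓ {n : ℕ} (s : ℝ) (Ω : Set (E n)) (α β q : ℝ) (f g b : E n → ℝ) : Set (ℝ × ℝ) :=
  {l | l ≠ (0, 0) ∧ 0 < bigLambda Ω α β q f g l.1 l.2 ∧
    bigLambda Ω α β q f g l.1 l.2 <
      thresholdC α β q (sobolevConst s Ω (α + β)) (normLp Ω ∞ b)}

/-- `(u, w)` is a positive weak solution of the system
`(-Δ)ˢ u = λ f u^(-q) + α/(α+β) b u^(α-1) w^β`, `(-Δ)ˢ w = μ g w^(-q) + β/(α+β) b u^α w^(β-1)`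
in `Ω`, `u, w > 0` in `Ω`, `u = w = 0` outside `Ω`. The integrals on the right are required to
converge for every test pair. -/
structure IsPositiveWeakSolution {n : ℕ} (s : ℝ) (Ω : Set (E n)) (α β q : ℝ)
    (f g b : E n → ℝ) (lam mu : ℝ) (z : (E n → ℝ) × (E n → ℝ)) : Prop where
  mem : z ∈ Y s Ω
  pos_fst : ∀ᵐ x ∂(volume.restrict Ω), 0 < z.1 x
  pos_snd : ∀ᵐ x ∂(volume.restrict Ω), 0 < z.2 x
  integrable : ∀ t ∈ Y s Ω,
    IntegrableOn (fun x => f x * (z.1 x ^ (-q) * t.1 x)) Ω ∧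
    IntegrableOn (fun x => g x * (z.2 x ^ (-q) * t.2 x)) Ω ∧
    IntegrableOn (fun x => b x * (z.1 x ^ (α - 1) * z.2 x ^ β * t.1 x)) Ω ∧
    IntegrableOn (fun x => b x * (z.1 x ^ α * z.2 x ^ (β - 1) * t.2 x)) Ω
  weak : ∀ t ∈ Y s Ω,
    form s Ω z.1 t.1 + form s Ω z.2 t.2 =
      lam * (∫ x in Ω, f x * (z.1 x ^ (-q) * t.1 x)) +
      mu * (∫ x in Ω, g x * (z.2 x ^ (-q) * t.2 x)) +
      α / (α + β) * (∫ x in Ω, b x * (z.1 x ^ (α - 1) * z.2 x ^ β * t.1 x)) +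
      β / (α + β) * (∫ x in Ω, b x * (z.1 x ^ α * z.2 x ^ (β - 1) * t.2 x))

/-- The energy functional `J_{λ,μ}`. -/
def energy {n : ℕ} (s : ℝ) (Ω : Set (E n)) (α β q : ℝ) (f g b : E n → ℝ) (lam mu : ℝ)
    (z : (E n → ℝ) × (E n → ℝ)) : ℝ :=
  1 / 2 * normY s Ω z ^ 2
    - 1 / (1 - q) *
      (∫ x in Ω, (lam * f x * max (z.1 x) 0 ^ (1 - q) + mu * g x * max (z.2 x) 0 ^ (1 - q)))
    - 1 / (α + β) * ∫ x in Ω, b x * (max (z.1 x) 0 ^ α * max (z.2 x) 0 ^ β)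

/-- The fibering map `t ↦ J_{λ,μ}(t u, t w)`. -/
def fiber {n : ℕ} (s : ℝ) (Ω : Set (E n)) (α β q : ℝ) (f g b : E n → ℝ) (lam mu : ℝ)
    (z : (E n → ℝ) × (E n → ℝ)) (t : ℝ) : ℝ :=
  energy s Ω α β q f g b lam mu (t • z)

/-- The Nehari manifold. -/
def nehari {n : ℕ} (s : ℝ) (Ω : Set (E n)) (α β q : ℝ) (f g b : E n → ℝ) (lam mu : ℝ) :
    Set ((E n → ℝ) × (E n → ℝ)) :=
  {z | z ∈ Y s Ω ∧ deriv (fiber s Ω α β q f g b lam mu z) 1 = 0}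

/-- The component `N⁺` of the Nehari manifold. -/
def nehariPlus {n : ℕ} (s : ℝ) (Ω : Set (E n)) (α β q : ℝ) (f g b : E n → ℝ) (lam mu : ℝ) :
    Set ((E n → ℝ) × (E n → ℝ)) :=
  {z | z ∈ nehari s Ω α β q f g b lam mu ∧
    0 < deriv (deriv (fiber s Ω α β q f g b lam mu z)) 1}

/-- The component `N⁻` of the Nehari manifold. -/
def nehariMinus {n : ℕ} (s : ℝ) (Ω : Set (E n)) (α β q : ℝ) (f g b : E n → ℝ) (lam mu : ℝ) :
    Set ((E n → ℝ) × (E n → ℝ)) :=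
  {z | z ∈ nehari s Ω α β q f g b lam mu ∧
    deriv (deriv (fiber s Ω α β q f g b lam mu z)) 1 < 0}

end FracSystem

end

open MeasureTheory Set
open scoped ENNReal ContDiff

noncomputable section

namespace FracSystem

/-! ### The scalar fibering map -/

/-- `t ↦ J(t z)` in terms of the three homogeneous terms of the energy. -/
def scalarFiber (q p A F B t : ℝ) : ℝ := t ^ 2 * A / 2 - t ^ (1 - q) * F / (1 - q) - t ^ p * B / p

/-- `t` times the derivative of the fibering map. -/
def scalarDefect (q p A F B t : ℝ) : ℝ := t ^ 2 * A - t ^ (1 - q) * F - t ^ p * B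

/-- Along the ray the singular term is small above the energy level `ρ`, and the superlinear term is
small below it. -/
def RaySeparated (q p ρ A F B : ℝ) : Prop :=
  ∀ t : ℝ, 0 < t → (ρ ≤ t ^ 2 * A → (p - 1 + q) * (t ^ (1 - q) * F) < (p - 2) * (t ^ 2 * A)) ∧
    (0 < A → t ^ 2 * A ≤ ρ → (p - 1 + q) * (t ^ p * B) < (1 + q) * (t ^ 2 * A))

/-- The bound on F/A is cF · A^(−(1+q)/2), decreasing in A, so strict smallness at A = ρ persists
above ρ. -/
theorem singular_lt {q p ρ cF A F : ℝ} (hq0 : 0 < q) (hp : 2 < p)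
    (hρ : 0 < ρ) (hcF : (p - 1 + q) * (cF * ρ ^ ((1 - q) / 2)) < (p - 2) * ρ)
    (hF : F ≤ cF * A ^ ((1 - q) / 2)) (h : ρ ≤ A) : (p - 1 + q) * F < (p - 2) * A := by
  have hA : 0 < A := hρ.trans_le h
  have e : ∀ x : ℝ, 0 < x → x ^ ((1 - q) / 2) * x ^ ((1 + q) / 2) = x := fun x hx => by
    rw [← Real.rpow_add hx, show (1 - q) / 2 + (1 + q) / 2 = 1 by ring, Real.rpow_one]
  have h1 : (p - 1 + q) * cF < (p - 2) * ρ ^ ((1 + q) / 2) := by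
    have := e ρ hρ
    have h2 : ρ ^ ((1 - q) / 2) * ((p - 1 + q) * cF) <
        ρ ^ ((1 - q) / 2) * ((p - 2) * ρ ^ ((1 + q) / 2)) := by nlinarith
    exact lt_of_mul_lt_mul_left h2 (by positivity)
  have h2 : ρ ^ ((1 + q) / 2) ≤ A ^ ((1 + q) / 2) := by gcongr
  have h3 : (p - 1 + q) * cF < (p - 2) * A ^ ((1 + q) / 2) :=
    h1.trans_le (by gcongr)
  calc (p - 1 + q) * F ≤ (p - 1 + q) * (cF * A ^ ((1 - q) / 2)) := by
        gcongr; linarith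
    _ = A ^ ((1 - q) / 2) * ((p - 1 + q) * cF) := by ring
    _ < A ^ ((1 - q) / 2) * ((p - 2) * A ^ ((1 + q) / 2)) := by gcongr
    _ = (p - 2) * (A ^ ((1 - q) / 2) * A ^ ((1 + q) / 2)) := by ring
    _ = (p - 2) * A := by rw [e A hA]

/-- The bound on B/A is cB · A^((p−2)/2), increasing in A since p > 2, so smallness at A = ρ
persists below ρ. -/
theorem superlinear_lt {q p ρ cB A B : ℝ} (hq0 : 0 < q) (hp : 2 < p)
    (hcB0 : 0 ≤ cB) (hcB : (p - 1 + q) * (cB * ρ ^ (p / 2)) < (1 + q) * ρ)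
    (hB : B ≤ cB * A ^ (p / 2)) (hA : 0 < A) (h : A ≤ ρ) : (p - 1 + q) * B < (1 + q) * A := by
  have hρ : 0 < ρ := hA.trans_le h
  have e : ∀ x : ℝ, 0 < x → x ^ (p / 2) = x * x ^ ((p - 2) / 2) := fun x hx => by
    rw [← Real.rpow_one_add' hx.le (by linarith)]; congr 1; ring
  rw [e ρ hρ] at hcB
  rw [e A hA] at hB
  have h1 : (p - 1 + q) * cB * ρ ^ ((p - 2) / 2) < (1 + q) := by
    have h2 : ρ * ((p - 1 + q) * cB * ρ ^ ((p - 2) / 2)) < ρ * (1 + q) := by nlinarith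
    exact lt_of_mul_lt_mul_left h2 hρ.le
  have h2 : A ^ ((p - 2) / 2) ≤ ρ ^ ((p - 2) / 2) := by gcongr
  have h3 : (p - 1 + q) * cB * A ^ ((p - 2) / 2) < (1 + q) :=
    lt_of_le_of_lt (by gcongr; nlinarith) h1
  calc (p - 1 + q) * B ≤ (p - 1 + q) * (cB * (A * A ^ ((p - 2) / 2))) := by
        gcongr; linarith
    _ = A * ((p - 1 + q) * cB * A ^ ((p - 2) / 2)) := by ring
    _ < A * (1 + q) := by gcongr
    _ = _ := by ring

/-- Both bounds are homogeneous: replacing (A, F, B) by (t²A, t^(1−q)F, t^p B) preserves them with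
the same constants, so one level ρ serves the entire ray. -/
theorem raySeparated_of_bounds {q p ρ cF cB A F B : ℝ} (hq0 : 0 < q) (hp : 2 < p)
    (hρ : 0 < ρ) (hcF : (p - 1 + q) * (cF * ρ ^ ((1 - q) / 2)) < (p - 2) * ρ)
    (hcB0 : 0 ≤ cB) (hcB : (p - 1 + q) * (cB * ρ ^ (p / 2)) < (1 + q) * ρ) (hA : 0 ≤ A)
    (hF : F ≤ cF * A ^ ((1 - q) / 2)) (hB : B ≤ cB * A ^ (p / 2)) :
    RaySeparated q p ρ A F B := by
  intro t ht
  have e : ∀ r : ℝ, (t ^ 2 * A) ^ (r / 2) = t ^ r * A ^ (r / 2) := fun r => by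
    rw [Real.mul_rpow (by positivity) hA, ← Real.rpow_natCast t 2, ← Real.rpow_mul ht.le]
    congr 2; push_cast; ring
  refine ⟨fun h => singular_lt (cF := cF) hq0 hp hρ hcF ?_ h, fun hA h =>
    superlinear_lt (cB := cB) hq0 hp hcB0 hcB ?_ (by positivity) h⟩
  · rw [e]
    calc t ^ (1 - q) * F ≤ t ^ (1 - q) * (cF * A ^ ((1 - q) / 2)) := by gcongr
      _ = _ := by ring
  · rw [e]
    calc t ^ p * B ≤ t ^ p * (cB * A ^ (p / 2)) := by gcongr
      _ = _ := by ring

/-- The condition `Λ < C` produces an energy level separating the two parts of the Nehari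
manifold. -/
theorem exists_separating_level {α β q S b Λ : ℝ} (hq0 : 0 < q)
    (hp : 2 < α + β) (hS : 0 < S) (hb : 0 < b) (hΛ : 0 < Λ) (h : Λ < thresholdC α β q S b) :
    ∃ ρ : ℝ, 0 < ρ ∧
      (α + β - 1 + q) * (S ^ (-((1 - q) / 2)) * Λ ^ ((1 + q) / 2) * ρ ^ ((1 - q) / 2))
        < (α + β - 2) * ρ ∧
      (α + β - 1 + q) * (b * S ^ (-((α + β) / 2)) * ρ ^ ((α + β) / 2)) < (1 + q) * ρ := by
  unfold thresholdC at h
  set p := α + β with hpdef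
  have hp2 : 0 < p - 2 := by linarith
  have hk : 0 < p - 1 + q := by linarith
  have hq : 0 < 1 + q := by linarith
  -- Solved for ρ, the two required inequalities read A₁ < ρ and ρ < A₂, and A₁ < A₂ is Λ < C
  -- rearranged.
  set A₁ := ((p - 1 + q) / (p - 2)) ^ (2 / (1 + q)) * S ^ (-((1 - q) / (1 + q))) * Λ with hA₁
  set A₂ := ((1 + q) / (p - 1 + q)) ^ (2 / (p - 2)) * (1 / b) ^ (2 / (p - 2)) * S ^ (p / (p - 2))
    with hA₂
  have h12 : A₁ < A₂ := by
    have hc : 0 < ((p - 1 + q) / (p - 2)) ^ (2 / (1 + q)) * S ^ (-((1 - q) / (1 + q))) := by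
      positivity
    calc A₁ < _ := mul_lt_mul_of_pos_left h hc
      _ = ((1 + q) / (p - 1 + q)) ^ (2 / (p - 2)) * (1 / b) ^ (2 / (p - 2)) *
          (((p - 1 + q) / (p - 2)) ^ (2 / (1 + q)) * ((p - 2) / (p - 1 + q)) ^ (2 / (1 + q))) *
          (S ^ (-((1 - q) / (1 + q))) * S ^ (2 * (p - 1 + q) / ((1 + q) * (p - 2)))) := by ring
      _ = A₂ := by
        have e : (p - 1 + q) / (p - 2) * ((p - 2) / (p - 1 + q)) = 1 := by field_simp
        rw [← Real.mul_rpow (x := (p - 1 + q) / (p - 2)) (by positivity) (by positivity),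
          ← Real.rpow_add hS, e, Real.one_rpow, mul_one, hA₂]
        congr 2
        field_simp
        ring
  have hA₁0 : 0 < A₁ := by positivity
  obtain ⟨ρ, h1, h2⟩ := exists_between h12
  have hρ : 0 < ρ := hA₁0.trans h1
  refine ⟨ρ, hρ, ?_, ?_⟩
  · have e : ρ = ρ ^ ((1 - q) / 2) * ρ ^ ((1 + q) / 2) := by
      rw [← Real.rpow_add hρ, show (1 - q) / 2 + (1 + q) / 2 = 1 by ring, Real.rpow_one]
    have h3 : A₁ ^ ((1 + q) / 2) < ρ ^ ((1 + q) / 2) := by gcongr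
    have h4 : A₁ ^ ((1 + q) / 2) =
        (p - 1 + q) / (p - 2) * (S ^ (-((1 - q) / 2)) * Λ ^ ((1 + q) / 2)) := by
      rw [hA₁, Real.mul_rpow (by positivity) hΛ.le, Real.mul_rpow (by positivity) (by positivity),
        ← Real.rpow_mul (by positivity), ← Real.rpow_mul hS.le,
        show 2 / (1 + q) * ((1 + q) / 2) = 1 by field_simp, Real.rpow_one,
        show -((1 - q) / (1 + q)) * ((1 + q) / 2) = -((1 - q) / 2) by field_simp, mul_assoc]
    have h5 : (p - 1 + q) * (S ^ (-((1 - q) / 2)) * Λ ^ ((1 + q) / 2)) <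
        (p - 2) * ρ ^ ((1 + q) / 2) := by
      rw [h4, div_mul_eq_mul_div, div_lt_iff₀ hp2] at h3
      linarith
    conv_rhs => rw [e]
    have : 0 < ρ ^ ((1 - q) / 2) := by positivity
    nlinarith
  · have e : ρ ^ (p / 2) = ρ * ρ ^ ((p - 2) / 2) := by
      rw [← Real.rpow_one_add' hρ.le (by linarith)]; congr 1; ring
    have h3 : ρ ^ ((p - 2) / 2) < A₂ ^ ((p - 2) / 2) := by gcongr
    have h4 : A₂ ^ ((p - 2) / 2) = (1 + q) / (p - 1 + q) * (1 / b) * S ^ (p / 2) := by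
      rw [hA₂, Real.mul_rpow (by positivity) (by positivity),
        Real.mul_rpow (by positivity) (by positivity),
        ← Real.rpow_mul (by positivity), ← Real.rpow_mul (by positivity), ← Real.rpow_mul hS.le,
        show 2 / (p - 2) * ((p - 2) / 2) = 1 by field_simp, Real.rpow_one, Real.rpow_one,
        show p / (p - 2) * ((p - 2) / 2) = p / 2 by field_simp]
    rw [h4] at h3
    have hc : 0 < (p - 1 + q) * (b * S ^ (-(p / 2))) * ρ := by positivity
    calc (p - 1 + q) * (b * S ^ (-(p / 2)) * ρ ^ (p / 2))
        = (p - 1 + q) * (b * S ^ (-(p / 2))) * ρ * ρ ^ ((p - 2) / 2) := by rw [e]; ring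
      _ < (p - 1 + q) * (b * S ^ (-(p / 2))) * ρ *
          ((1 + q) / (p - 1 + q) * (1 / b) * S ^ (p / 2)) := mul_lt_mul_of_pos_left h3 hc
      _ = (1 + q) * ρ * (S ^ (-(p / 2)) * S ^ (p / 2)) := by field_simp
      _ = (1 + q) * ρ := by rw [← Real.rpow_add hS]; simp

/-! ### Sign of the fibering derivative along a ray. -/

theorem scalarDefect_eq {q p A F B t : ℝ} (hq0 : 0 < q) (ht : 0 < t) :
    scalarDefect q p A F B t = t ^ (1 - q) * (t ^ (1 + q) * A - F -
      (t ^ (1 + q)) ^ ((p - 1 + q) / (1 + q)) * B) := by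
  have hq : (1 + q) ≠ 0 := by positivity
  have e1 : t ^ (1 - q) * t ^ (1 + q) = t ^ 2 := by
    rw [← Real.rpow_add ht, ← Real.rpow_natCast t 2]; congr 1; push_cast; ring
  have e2 : t ^ (1 - q) * (t ^ (1 + q)) ^ ((p - 1 + q) / (1 + q)) = t ^ p := by
    rw [← Real.rpow_mul ht.le, ← Real.rpow_add ht]; congr 1; field_simp; ring
  unfold scalarDefect
  rw [← e1, ← e2]; ring

/-- At the level itself both halves of `RaySeparated` apply, and they add up because (p − 2) + (1 +
q) = p − 1 + q. Consequently the Nehari manifold does not meet the sphere of level ρ. -/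
theorem scalarDefect_pos_of_level {q p ρ A F B t : ℝ} (hp : 2 < p) (hq0 : 0 < q)
    (hsep : RaySeparated q p ρ A F B) (hρ : 0 < ρ) (ht : 0 < t) (h : t ^ 2 * A = ρ) :
    0 < scalarDefect q p A F B t := by
  have hA : 0 < A := by
    by_contra hA
    nlinarith [sq_nonneg t]
  obtain ⟨h1, h2⟩ := hsep t ht
  have h1 := h1 h.ge
  have h2 := h2 hA h.le
  unfold scalarDefect
  have h3 : (p - 1 + q) * (t ^ (1 - q) * F) + (p - 1 + q) * (t ^ p * B)
      < (p - 1 + q) * (t ^ 2 * A) := by linarith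
  have h4 : 0 < (p - 1 + q) * (t ^ 2 * A - t ^ (1 - q) * F - t ^ p * B) := by linarith
  exact pos_of_mul_pos_right h4 (by linarith)

/-- In the variable τ = t^(1+q), and after removing the factor t^(1−q), the defect is affine minus a
power of exponent at least 1. Concavity replaces an analysis of the critical points of the fibering
map. -/
theorem concaveOn_rescaled_defect {q p A F B : ℝ} (hq0 : 0 < q) (hp : 2 < p) (hB : 0 ≤ B) :
    ConcaveOn ℝ (Ici 0) (fun τ : ℝ => τ * A - F - τ ^ ((p - 1 + q) / (1 + q)) * B) := by
  have hk : 1 ≤ (p - 1 + q) / (1 + q) := by rw [le_div_iff₀ (by positivity)]; linarith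
  have h1 := (convexOn_rpow hk).smul hB
  have h2 : ConcaveOn ℝ (Ici (0 : ℝ)) (fun τ : ℝ => τ * A - F) := by
    refine ⟨convex_Ici 0, fun x _ y _ a b _ _ hab => ?_⟩
    simp only [smul_eq_mul]
    have : b = 1 - a := by linarith
    subst this
    linarith
  have := h2.sub h1
  refine this.congr fun x _ => ?_
  simp only [Pi.sub_apply, smul_eq_mul]
  ring

/-- Eliminating F through A = F + B in the singular half of `RaySeparated` gives this. It says that
the second fibering derivative A + qF − (p−1)B is negative, and it makes B positive when A > 0. -/
theorem superlinear_pos_of_nehari {q p ρ A F B : ℝ}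
    (hsep : RaySeparated q p ρ A F B) (hN : A = F + B) (hA : ρ ≤ A) :
    (1 + q) * A < (p - 1 + q) * B := by
  have := (hsep 1 one_pos).1 (by simpa using hA)
  simp only [Real.one_rpow, one_pow, one_mul] at this
  subst hN
  nlinarith

/-- On the upper part of the Nehari manifold the fibering derivative is positive on the ray between
the level `ρ` and the point, and negative beyond the point. -/
theorem scalarDefect_sign {q p ρ A F B t : ℝ} (hp : 2 < p) (hq0 : 0 < q)
    (hsep : RaySeparated q p ρ A F B) (hρ : 0 < ρ) (hN : A = F + B) (hA : ρ ≤ A)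
    (ht : 0 < t) (htA : ρ ≤ t ^ 2 * A) :
    (t < 1 → 0 < scalarDefect q p A F B t) ∧ (1 < t → scalarDefect q p A F B t < 0) := by
  have hA0 : 0 < A := hρ.trans_le hA
  have hB : 0 < B := by
    have := superlinear_pos_of_nehari hsep hN hA
    by_contra h
    nlinarith
  -- The parameter at which the ray crosses the level ρ.
  set t₀ := √(ρ / A) with ht₀
  have ht₀0 : 0 < t₀ := by positivity
  have ht₀A : t₀ ^ 2 * A = ρ := by rw [ht₀, Real.sq_sqrt (by positivity)]; field_simp
  have hd := scalarDefect_pos_of_level hp hq0 hsep hρ ht₀0 ht₀A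
  have hle : t₀ ≤ t := by
    refine le_of_sq_le_sq ?_ ht.le
    have : t₀ ^ 2 * A ≤ t ^ 2 * A := by rw [ht₀A]; exact htA
    exact le_of_mul_le_mul_right this hA0
  have ht₀1 : t₀ < 1 := by
    have h1 : t₀ ≤ 1 := by rw [ht₀]; exact Real.sqrt_le_one.mpr (by rw [div_le_one hA0]; exact hA)
    refine lt_of_le_of_ne h1 fun h => ?_
    rw [h] at hd
    simp [scalarDefect] at hd
    linarith
  rw [scalarDefect_eq hq0 ht₀0] at hd
  have hd := pos_of_mul_pos_right hd (by positivity)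
  have hc := concaveOn_rescaled_defect (A := A) (F := F) hq0 hp hB.le
  have hc2 := hc.2
  -- ψ is concave with ψ(τ₀) > 0 = ψ(1). For τ₀ ≤ τ < 1, τ is a convex combination of τ₀ and 1, so
  -- ψ(τ) > 0. For τ > 1, the point 1 is a convex combination of τ₀ and τ, which forces ψ(τ) < 0.
  set ψ : ℝ → ℝ := fun τ : ℝ => τ * A - F - τ ^ ((p - 1 + q) / (1 + q)) * B with hψ
  have hψ1 : ψ 1 = 0 := by simp [hψ]; linarith
  have hτ₀ : t₀ ^ (1 + q) < 1 := Real.rpow_lt_one ht₀0.le ht₀1 (by linarith)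
  change 0 < ψ (t₀ ^ (1 + q)) at hd
  rw [scalarDefect_eq hq0 ht]
  change (t < 1 → 0 < t ^ (1 - q) * ψ (t ^ (1 + q))) ∧ (1 < t → t ^ (1 - q) * ψ (t ^ (1 + q)) < 0)
  have hττ : t₀ ^ (1 + q) ≤ t ^ (1 + q) := by gcongr
  have hτ00 : 0 < t₀ ^ (1 + q) := by positivity
  have htt : 0 < t ^ (1 - q) := by positivity
  generalize t₀ ^ (1 + q) = τ₀ at *
  refine ⟨fun h => mul_pos htt ?_, fun h => mul_neg_of_pos_of_neg htt ?_⟩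
  · have hτ1 : t ^ (1 + q) < 1 := Real.rpow_lt_one ht.le h (by linarith)
    generalize t ^ (1 + q) = τ at *
    have h1 : 0 < 1 - τ₀ := by linarith
    have := @hc2 τ₀ hτ00.le 1 (by simp) ((1 - τ) / (1 - τ₀))
      ((τ - τ₀) / (1 - τ₀)) (div_nonneg (by linarith) h1.le) (div_nonneg (by linarith) h1.le)
      (by field_simp; ring)
    simp only [smul_eq_mul] at this
    rw [show (1 - τ) / (1 - τ₀) * τ₀ + (τ - τ₀) / (1 - τ₀) * 1 = τ by field_simp; ring, hψ1] at this
    have h2 : 0 < (1 - τ) / (1 - τ₀) * ψ τ₀ := mul_pos (div_pos (by linarith) h1) hd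
    linarith
  · have hτ1 : 1 < t ^ (1 + q) := Real.one_lt_rpow h (by linarith)
    generalize t ^ (1 + q) = τ at *
    have h1 : 0 < τ - τ₀ := by linarith
    have := @hc2 τ₀ hτ00.le τ (by simp; linarith) ((τ - 1) / (τ - τ₀))
      ((1 - τ₀) / (τ - τ₀)) (div_nonneg (by linarith) h1.le) (div_nonneg (by linarith) h1.le)
      (by field_simp; ring)
    simp only [smul_eq_mul] at this
    rw [show (τ - 1) / (τ - τ₀) * τ₀ + (1 - τ₀) / (τ - τ₀) * τ = 1 by field_simp; ring, hψ1] at this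
    have h2 : 0 < (τ - 1) / (τ - τ₀) * ψ τ₀ := mul_pos (div_pos (by linarith) h1) hd
    have h3 : 0 < (1 - τ₀) / (τ - τ₀) := div_pos (by linarith) h1
    by_contra h4
    push Not at h4
    have := mul_nonneg h3.le h4
    linarith

/-! ### Derivatives of the fibering map and its maximum above the level. -/

theorem hasDerivAt_scalarFiber {q p A F B t : ℝ} (hq1 : q < 1) (hp : 2 < p) (ht : 0 < t) :
    HasDerivAt (scalarFiber q p A F B) (t * A - t ^ (-q) * F - t ^ (p - 1) * B) t := by
  unfold scalarFiber
  have h1 := ((hasDerivAt_pow 2 t).mul_const A).div_const 2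
  have h2 := (((Real.hasDerivAt_rpow_const (p := 1 - q) (Or.inl ht.ne')).mul_const F).div_const
    (1 - q))
  have h3 := (((Real.hasDerivAt_rpow_const (p := p) (Or.inl ht.ne')).mul_const B).div_const p)
  refine ((h1.sub h2).sub h3).congr_deriv ?_
  rw [show 1 - q - 1 = -q by ring]
  have : 1 - q ≠ 0 := by linarith
  have : p ≠ 0 := by linarith
  push_cast
  field_simp

theorem scalarFiber_deriv_eq {q p A F B t : ℝ} (ht : 0 < t) :
    t * A - t ^ (-q) * F - t ^ (p - 1) * B = t⁻¹ * scalarDefect q p A F B t := by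
  unfold scalarDefect
  rw [Real.rpow_sub_one ht.ne', show 1 - q = -q + 1 by ring, Real.rpow_add_one ht.ne']
  field_simp

theorem hasDerivAt_scalarFiber_deriv {q p A F B : ℝ} :
    HasDerivAt (fun t => t * A - t ^ (-q) * F - t ^ (p - 1) * B) (A + q * F - (p - 1) * B) 1 := by
  have h1 := (hasDerivAt_id (1 : ℝ)).mul_const A
  have h2 := ((Real.hasDerivAt_rpow_const (x := 1) (p := -q) (Or.inl one_ne_zero)).mul_const F)
  have h3 := ((Real.hasDerivAt_rpow_const (x := 1) (p := p - 1) (Or.inl one_ne_zero)).mul_const B)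
  refine ((h1.sub h2).sub h3).congr_deriv ?_
  simp

/-- On the upper part of the Nehari manifold the point maximizes the energy along its ray above the
level `ρ`. -/
theorem scalarFiber_le {q p ρ A F B t : ℝ} (hp : 2 < p) (hq0 : 0 < q) (hq1 : q < 1)
    (hsep : RaySeparated q p ρ A F B) (hρ : 0 < ρ) (hN : A = F + B) (hA : ρ ≤ A)
    (ht : 0 < t) (htA : ρ ≤ t ^ 2 * A) :
    scalarFiber q p A F B t ≤ scalarFiber q p A F B 1 := by
  have hA0 : 0 < A := hρ.trans_le hA
  have hder : ∀ x : ℝ, 0 < x → deriv (scalarFiber q p A F B) x = x⁻¹ * scalarDefect q p A F B x :=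
    fun x hx => by rw [(hasDerivAt_scalarFiber hq1 hp hx).deriv, scalarFiber_deriv_eq hx]
  rcases le_total t 1 with h | h
  · have : MonotoneOn (scalarFiber q p A F B) (Icc t 1) := by
      refine monotoneOn_of_deriv_nonneg (convex_Icc t 1)
        (fun x hx => (hasDerivAt_scalarFiber hq1 hp
          (ht.trans_le hx.1)).continuousAt.continuousWithinAt)
        (fun x hx => ?_) (fun x hx => ?_)
      all_goals rw [interior_Icc] at hx
      · exact (hasDerivAt_scalarFiber hq1 hp
          (ht.trans hx.1)).differentiableAt.differentiableWithinAt
      · have hx0 := ht.trans hx.1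
        rw [hder x hx0]
        refine mul_nonneg (by positivity)
          ((scalarDefect_sign hp hq0 hsep hρ hN hA hx0 ?_).1 hx.2).le
        refine htA.trans ?_
        have := hx.1.le
        gcongr
    exact this ⟨le_rfl, h⟩ ⟨h, le_rfl⟩ h
  · have : AntitoneOn (scalarFiber q p A F B) (Icc 1 t) := by
      refine antitoneOn_of_deriv_nonpos (convex_Icc 1 t)
        (fun x hx => (hasDerivAt_scalarFiber hq1 hp
          (one_pos.trans_le hx.1)).continuousAt.continuousWithinAt)
        (fun x hx => ?_) (fun x hx => ?_)
      all_goals rw [interior_Icc] at hx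
      · exact (hasDerivAt_scalarFiber hq1 hp
          (one_pos.trans hx.1)).differentiableAt.differentiableWithinAt
      · have hx0 := one_pos.trans hx.1
        rw [hder x hx0]
        refine mul_nonpos_of_nonneg_of_nonpos (by positivity)
          ((scalarDefect_sign hp hq0 hsep hρ hN hA hx0 ?_).2 hx.1).le
        have : 1 ≤ x ^ 2 := one_le_pow₀ hx.1.le
        nlinarith
    exact this ⟨le_rfl, h⟩ ⟨h, le_rfl⟩ h

theorem continuousOn_scalarDefect {q p A F B : ℝ} :
    ContinuousOn (scalarDefect q p A F B) (Ioi 0) := by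
  unfold scalarDefect
  intro x hx
  have hx : x ≠ 0 := (ne_of_gt hx)
  refine ContinuousAt.continuousWithinAt ?_
  have h1 := Real.continuousAt_rpow_const x (1 - q) (Or.inl hx)
  have h2 := Real.continuousAt_rpow_const x p (Or.inl hx)
  fun_prop

/-- A ray on which the superlinear term is positive meets the upper part of the Nehari manifold. -/
theorem exists_scalarDefect_eq_zero {q p ρ A F B : ℝ} (hp : 2 < p) (hq0 : 0 < q)
    (hsep : RaySeparated q p ρ A F B) (hρ : 0 < ρ) (hA : 0 < A) (hF : 0 ≤ F) (hB : 0 < B) :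
    ∃ t : ℝ, 0 < t ∧ ρ < t ^ 2 * A ∧ scalarDefect q p A F B t = 0 := by
  set t₀ := √(ρ / A) with ht₀
  have ht₀0 : 0 < t₀ := by positivity
  have ht₀A : t₀ ^ 2 * A = ρ := by rw [ht₀, Real.sq_sqrt (by positivity)]; field_simp
  have hd := scalarDefect_pos_of_level hp hq0 hsep hρ ht₀0 ht₀A
  -- Once T^(p−2) ≥ A/B the superlinear term alone cancels the quadratic one. The defect is positive
  -- at t₀ and nonpositive at T.
  obtain ⟨T, hT, hTd⟩ : ∃ T : ℝ, t₀ ≤ T ∧ scalarDefect q p A F B T ≤ 0 := by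
    have h1 : Filter.Tendsto (fun t : ℝ => t ^ (p - 2)) Filter.atTop Filter.atTop :=
      tendsto_rpow_atTop (by linarith)
    obtain ⟨T, hT1, hT2⟩ := ((h1.eventually_ge_atTop (A / B)).and
      (Filter.eventually_ge_atTop t₀)).exists
    have hT0 := ht₀0.trans_le hT2
    refine ⟨T, hT2, ?_⟩
    unfold scalarDefect
    have e : T ^ p = T ^ 2 * T ^ (p - 2) := by
      rw [← Real.rpow_natCast T 2, ← Real.rpow_add hT0]; congr 1; push_cast; ring
    rw [div_le_iff₀ hB] at hT1
    have h2 : T ^ 2 * A ≤ T ^ 2 * (T ^ (p - 2) * B) := by gcongr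
    have h3 : 0 ≤ T ^ (1 - q) * F := by positivity
    rw [e]
    nlinarith
  obtain ⟨t, ht, h0⟩ := intermediate_value_Icc' hT
    (continuousOn_scalarDefect.mono (s := Ioi 0) (fun x hx => ht₀0.trans_le hx.1) :
      ContinuousOn (scalarDefect q p A F B) (Icc t₀ T)) ⟨hTd, hd.le⟩
  have htt : t₀ < t := lt_of_le_of_ne ht.1 fun h => by rw [← h] at h0; linarith
  refine ⟨t, ht₀0.trans htt, ?_, h0⟩
  rw [← ht₀A]
  gcongr

/-! ### The space `X₀` -/

section Space

variable {n : ℕ} {s : ℝ} {Ω : Set (E n)} {u v w φ : E n → ℝ}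

/-- The weighted difference quotient of `u`. -/
def gagl (s : ℝ) (u : E n → ℝ) (z : E n × E n) : ℝ :=
  (u z.1 - u z.2) / ‖z.1 - z.2‖ ^ (((n : ℝ) + 2 * s) / 2)

theorem gagl_add (u v : E n → ℝ) : gagl s (u + v) = gagl s u + gagl s v := by
  ext z; simp only [gagl, Pi.add_apply]; ring

theorem gagl_smul (c : ℝ) (u : E n → ℝ) : gagl s (c • u) = c • gagl s u := by
  ext z; simp only [gagl, Pi.smul_apply, smul_eq_mul]; ring

theorem gagl_mul_gagl (hs : 0 < s) (u φ : E n → ℝ) (z : E n × E n) :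
    gagl s u z * gagl s φ z =
      (u z.1 - u z.2) * (φ z.1 - φ z.2) / ‖z.1 - z.2‖ ^ ((n : ℝ) + 2 * s) := by
  have h : ‖z.1 - z.2‖ ^ ((n : ℝ) + 2 * s) =
      ‖z.1 - z.2‖ ^ (((n : ℝ) + 2 * s) / 2) * ‖z.1 - z.2‖ ^ (((n : ℝ) + 2 * s) / 2) := by
    rw [← Real.rpow_add_of_nonneg (norm_nonneg _) (by positivity) (by positivity), add_halves]
  rw [h, gagl, gagl, div_mul_div_comm]

theorem measurableSet_Q (hΩ : MeasurableSet Ω) : MeasurableSet (Q Ω) :=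
  (hΩ.compl.prod hΩ.compl).compl

/-- Off Q both points lie outside Ω. Integrals over Q are therefore integrals over the whole product
space, where Fubini and translation arguments are available. -/
theorem gagl_ae_eq_zero (h : ∀ᵐ x ∂(volume : Measure (E n)), x ∉ Ω → u x = 0) :
    ∀ᵐ z ∂(volume : Measure (E n × E n)), z ∉ Q Ω → gagl s u z = 0 := by
  have h1 : ∀ᵐ z ∂(volume : Measure (E n × E n)), z.1 ∉ Ω → u z.1 = 0 :=
    Measure.quasiMeasurePreserving_fst.ae h
  have h2 : ∀ᵐ z ∂(volume : Measure (E n × E n)), z.2 ∉ Ω → u z.2 = 0 :=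
    Measure.quasiMeasurePreserving_snd.ae h
  filter_upwards [h1, h2] with z hz1 hz2 hz
  simp only [Q, mem_compl_iff, not_not, mem_prod] at hz
  simp [gagl, hz1 hz.1, hz2 hz.2]

theorem aestronglyMeasurable_gagl (hu : AEMeasurable u volume) :
    AEStronglyMeasurable (gagl s u) volume := by
  have h1 : AEMeasurable (fun z : E n × E n => u z.1) volume :=
    hu.comp_quasiMeasurePreserving Measure.quasiMeasurePreserving_fst
  have h2 : AEMeasurable (fun z : E n × E n => u z.2) volume :=
    hu.comp_quasiMeasurePreserving Measure.quasiMeasurePreserving_snd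
  have h3 : Measurable (fun z : E n × E n => ‖z.1 - z.2‖ ^ (((n : ℝ) + 2 * s) / 2)) := by
    fun_prop
  exact ((h1.sub h2).div h3.aemeasurable).aestronglyMeasurable

theorem memLp_gagl_iff (hΩ : MeasurableSet Ω)
    (h : ∀ᵐ x ∂(volume : Measure (E n)), x ∉ Ω → u x = 0) :
    MemLp (gagl s u) 2 (volume.restrict (Q Ω)) ↔ MemLp (gagl s u) 2 volume := by
  rw [← memLp_indicator_iff_restrict (measurableSet_Q hΩ)]
  refine memLp_congr_ae ?_
  filter_upwards [gagl_ae_eq_zero (s := s) h] with z hz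
  by_cases hzQ : z ∈ Q Ω
  · simp [hzQ]
  · simp [hzQ, hz hzQ]

theorem mem_X₀_iff (hΩ : MeasurableSet Ω) :
    u ∈ X₀ s Ω ↔ AEMeasurable u volume ∧ MemLp u 2 (volume.restrict Ω) ∧
      MemLp (gagl s u) 2 volume ∧ ∀ᵐ x ∂(volume : Measure (E n)), x ∉ Ω → u x = 0 := by
  constructor
  · rintro ⟨h1, h2, h3, h4⟩
    exact ⟨h1, h2, (memLp_gagl_iff hΩ h4).1 h3, h4⟩
  · rintro ⟨h1, h2, h3, h4⟩
    exact ⟨h1, h2, (memLp_gagl_iff hΩ h4).2 h3, h4⟩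

theorem memLp_gagl (hΩ : MeasurableSet Ω) (hu : u ∈ X₀ s Ω) : MemLp (gagl s u) 2 volume :=
  ((mem_X₀_iff hΩ).1 hu).2.2.1

theorem form_eq_integral (hs : 0 < s) (hu : u ∈ X₀ s Ω) (φ : E n → ℝ) :
    form s Ω u φ = ∫ z, gagl s u z * gagl s φ z := by
  unfold form
  simp_rw [← gagl_mul_gagl hs]
  refine setIntegral_eq_integral_of_ae_compl_eq_zero ?_
  filter_upwards [gagl_ae_eq_zero (s := s) hu.2.2.2] with z hz hzQ
  simp [hz hzQ]

theorem integrable_gagl_mul (hΩ : MeasurableSet Ω) (hu : u ∈ X₀ s Ω) (hφ : φ ∈ X₀ s Ω) :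
    Integrable (fun z => gagl s u z * gagl s φ z) :=
  (memLp_gagl hΩ hu).integrable_mul (memLp_gagl hΩ hφ)

theorem add_mem_X₀ (hΩ : MeasurableSet Ω) (hu : u ∈ X₀ s Ω) (hv : v ∈ X₀ s Ω) :
    u + v ∈ X₀ s Ω := by
  rw [mem_X₀_iff hΩ] at *
  obtain ⟨h1, h2, h3, h4⟩ := hu
  obtain ⟨k1, k2, k3, k4⟩ := hv
  refine ⟨h1.add k1, h2.add k2, by rw [gagl_add]; exact h3.add k3, ?_⟩
  filter_upwards [h4, k4] with x hx kx hxΩ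
  simp [hx hxΩ, kx hxΩ]

theorem smul_mem_X₀ (hΩ : MeasurableSet Ω) (c : ℝ) (hu : u ∈ X₀ s Ω) : c • u ∈ X₀ s Ω := by
  rw [mem_X₀_iff hΩ] at *
  obtain ⟨h1, h2, h3, h4⟩ := hu
  refine ⟨h1.const_smul c, h2.const_smul c, by rw [gagl_smul]; exact h3.const_smul c, ?_⟩
  filter_upwards [h4] with x hx hxΩ
  simp [hx hxΩ]

theorem sub_mem_X₀ (hΩ : MeasurableSet Ω) (hu : u ∈ X₀ s Ω) (hv : v ∈ X₀ s Ω) :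
    u - v ∈ X₀ s Ω := by
  have := add_mem_X₀ hΩ hu (smul_mem_X₀ hΩ (-1) hv)
  simpa [sub_eq_add_neg] using this

theorem zero_mem_X₀ : (0 : E n → ℝ) ∈ X₀ s Ω := by
  refine ⟨aemeasurable_const, MemLp.zero, ?_, by simp⟩
  simp

/-- `X₀` is stable under contractions fixing the origin. -/
theorem comp_mem_X₀ (hΩ : MeasurableSet Ω) (hu : u ∈ X₀ s Ω) {c : ℝ → ℝ} (hc : LipschitzWith 1 c)
    (hc0 : c 0 = 0) : (fun x => c (u x)) ∈ X₀ s Ω := by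
  rw [mem_X₀_iff hΩ] at *
  obtain ⟨h1, h2, h3, h4⟩ := hu
  have hd : ∀ a b : ℝ, |c a - c b| ≤ |a - b| := fun a b => by
    simpa [Real.dist_eq] using hc.dist_le_mul a b
  have hm := hc.continuous.measurable.comp_aemeasurable h1
  refine ⟨hm, h2.of_le hm.aestronglyMeasurable.restrict (ae_of_all _ fun x => ?_),
    h3.of_le (aestronglyMeasurable_gagl hm) (ae_of_all _ fun z => ?_), ?_⟩
  · simpa [hc0] using hd (u x) 0
  · simp only [gagl, norm_div, Real.norm_eq_abs]
    exact div_le_div_of_nonneg_right (hd _ _) (abs_nonneg _)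
  · filter_upwards [h4] with x hx hxΩ
    rw [hx hxΩ, hc0]

theorem lipschitzWith_posPart : LipschitzWith 1 (fun t : ℝ => max t 0) :=
  LipschitzWith.id.max_const 0

theorem posPart_mem_X₀ (hΩ : MeasurableSet Ω) (hu : u ∈ X₀ s Ω) :
    (fun x => max (u x) 0) ∈ X₀ s Ω :=
  comp_mem_X₀ hΩ hu lipschitzWith_posPart (by simp)

theorem abs_mem_X₀ (hΩ : MeasurableSet Ω) (hu : u ∈ X₀ s Ω) : (fun x => |u x|) ∈ X₀ s Ω :=
  comp_mem_X₀ hΩ hu (c := fun t => |t|) lipschitzWith_one_norm (by simp)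

/-! ### The bilinear form and its behaviour under truncation. -/

theorem form_comm (u φ : E n → ℝ) : form s Ω u φ = form s Ω φ u := by
  unfold form; simp_rw [mul_comm]

theorem form_add_left (hs : 0 < s) (hΩ : MeasurableSet Ω) (hu : u ∈ X₀ s Ω) (hv : v ∈ X₀ s Ω)
    (hφ : φ ∈ X₀ s Ω) : form s Ω (u + v) φ = form s Ω u φ + form s Ω v φ := by
  rw [form_eq_integral hs (add_mem_X₀ hΩ hu hv), form_eq_integral hs hu, form_eq_integral hs hv,
    ← integral_add (integrable_gagl_mul hΩ hu hφ) (integrable_gagl_mul hΩ hv hφ)]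
  simp [gagl_add, add_mul]

theorem form_smul_left (hs : 0 < s) (c : ℝ) (u φ : E n → ℝ) :
    form s Ω (c • u) φ = c * form s Ω u φ := by
  unfold form
  simp_rw [← gagl_mul_gagl hs]
  rw [← integral_const_mul]
  simp [gagl_smul, mul_assoc]

theorem form_sub_left (hs : 0 < s) (hΩ : MeasurableSet Ω) (hu : u ∈ X₀ s Ω) (hv : v ∈ X₀ s Ω)
    (hφ : φ ∈ X₀ s Ω) : form s Ω (u - v) φ = form s Ω u φ - form s Ω v φ := by
  have h1 : u - v = u + (-1 : ℝ) • v := by ext; simp [sub_eq_add_neg]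
  rw [h1, form_add_left hs hΩ hu (smul_mem_X₀ hΩ _ hv) hφ, form_smul_left hs]
  ring

theorem form_add_right (hs : 0 < s) (hΩ : MeasurableSet Ω) (hu : u ∈ X₀ s Ω) (hv : v ∈ X₀ s Ω)
    (hφ : φ ∈ X₀ s Ω) : form s Ω φ (u + v) = form s Ω φ u + form s Ω φ v := by
  rw [form_comm, form_add_left hs hΩ hu hv hφ, form_comm u, form_comm v]

theorem form_sub_right (hs : 0 < s) (hΩ : MeasurableSet Ω) (hu : u ∈ X₀ s Ω) (hv : v ∈ X₀ s Ω)
    (hφ : φ ∈ X₀ s Ω) : form s Ω φ (u - v) = form s Ω φ u - form s Ω φ v := by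
  rw [form_comm, form_sub_left hs hΩ hu hv hφ, form_comm u, form_comm v]

theorem form_smul_right (hs : 0 < s) (c : ℝ) (u φ : E n → ℝ) :
    form s Ω φ (c • u) = c * form s Ω φ u := by
  rw [form_comm, form_smul_left hs, form_comm]

theorem form_self_nonneg (hs : 0 < s) (u : E n → ℝ) : 0 ≤ form s Ω u u := by
  unfold form
  simp_rw [← gagl_mul_gagl hs]
  exact integral_nonneg fun z => mul_self_nonneg _

theorem form_add_smul_self (hs : 0 < s) (hΩ : MeasurableSet Ω) (hu : u ∈ X₀ s Ω)
    (hφ : φ ∈ X₀ s Ω) (ε : ℝ) : form s Ω (u + ε • φ) (u + ε • φ) =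
      form s Ω u u + 2 * ε * form s Ω u φ + ε ^ 2 * form s Ω φ φ := by
  have h := smul_mem_X₀ hΩ ε hφ
  rw [form_add_left hs hΩ hu h (add_mem_X₀ hΩ hu h), form_add_right hs hΩ hu h hu,
    form_add_right hs hΩ hu h h, form_smul_left hs, form_smul_right hs, form_smul_left hs,
    form_smul_right hs, form_comm φ u]
  ring

theorem form_self_mono (hs : 0 < s) (hΩ : MeasurableSet Ω) (hu : u ∈ X₀ s Ω) (hv : v ∈ X₀ s Ω)
    (h : ∀ x y, |v x - v y| ≤ |u x - u y|) : form s Ω v v ≤ form s Ω u u := by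
  rw [form_eq_integral hs hv, form_eq_integral hs hu]
  refine integral_mono (integrable_gagl_mul hΩ hv hv) (integrable_gagl_mul hΩ hu hu) fun z => ?_
  simp only [gagl_mul_gagl hs]
  have := sq_le_sq.2 (h z.1 z.2)
  exact div_le_div_of_nonneg_right (by nlinarith) (by positivity)

theorem form_posPart_le (hs : 0 < s) (hΩ : MeasurableSet Ω) (hu : u ∈ X₀ s Ω) :
    form s Ω (fun x => max (u x) 0) (fun x => max (u x) 0) ≤ form s Ω u u :=
  form_self_mono hs hΩ hu (posPart_mem_X₀ hΩ hu) fun x y => by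
    simpa [Real.dist_eq] using lipschitzWith_posPart.dist_le_mul (u x) (u y)

/-- Pointwise, (a − b)(a⁺ − b⁺) ≥ (a⁺ − b⁺)². -/
theorem form_posPart_le_form (hs : 0 < s) (hΩ : MeasurableSet Ω) (hu : u ∈ X₀ s Ω) :
    form s Ω (fun x => max (u x) 0) (fun x => max (u x) 0) ≤
      form s Ω u (fun x => max (u x) 0) := by
  have hv := posPart_mem_X₀ hΩ hu
  rw [form_eq_integral hs hv, form_eq_integral hs hu]
  refine integral_mono (integrable_gagl_mul hΩ hv hv) (integrable_gagl_mul hΩ hu hv) fun z => ?_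
  simp only [gagl_mul_gagl hs]
  gcongr ?_ / _
  generalize u z.1 = a
  generalize u z.2 = b
  rcases le_total a 0 with ha | ha <;> rcases le_total b 0 with hb | hb <;>
    simp only [ha, hb, max_eq_left, max_eq_right] <;> nlinarith

/-- The bound behind the approximation of test functions by multiples of the solution. -/
theorem form_excess_le (hs : 0 < s) (hΩ : MeasurableSet Ω) (hu : u ∈ X₀ s Ω) (hφ : φ ∈ X₀ s Ω)
    {k : ℝ} (hk : 0 < k) :
    form s Ω u (fun x => max (φ x - k * u x) 0) ≤ form s Ω φ φ / (4 * k) := by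
  have hd : φ - k • u ∈ X₀ s Ω := sub_mem_X₀ hΩ hφ (smul_mem_X₀ hΩ k hu)
  have hv := posPart_mem_X₀ hΩ hd
  have h1 := form_posPart_le_form hs hΩ hd
  simp only [Pi.sub_apply, Pi.smul_apply, smul_eq_mul] at hv h1
  set v : E n → ℝ := fun x => max (φ x - k * u x) 0
  rw [form_sub_left hs hΩ hφ (smul_mem_X₀ hΩ k hu) hv, form_smul_left hs] at h1
  -- With v = (φ − ku)⁺, the preceding inequality is k⟨u, v⟩ ≤ ⟨φ, v⟩ − ⟨v, v⟩, and ‖φ − 2v‖² ≥ 0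
  -- bounds the right side by ‖φ‖²/4.
  have h2 := form_self_nonneg hs (Ω := Ω) (φ + (-2 : ℝ) • v)
  rw [form_add_smul_self hs hΩ hφ hv] at h2
  rw [le_div_iff₀ (by positivity)]
  nlinarith

theorem normX₀_sq (hs : 0 < s) (u : E n → ℝ) : normX₀ s Ω u ^ 2 = form s Ω u u :=
  Real.sq_sqrt (form_self_nonneg hs u)

theorem normY_sq (hs : 0 < s) (z : (E n → ℝ) × (E n → ℝ)) :
    normY s Ω z ^ 2 = form s Ω z.1 z.1 + form s Ω z.2 z.2 := by
  unfold normY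
  rw [Real.sq_sqrt (by positivity), normX₀_sq hs, normX₀_sq hs]

/-- A positive Sobolev constant gives the embedding of `X₀` into `L^p`. -/
theorem sobolev (hs : 0 < s) {p : ℝ} (hp : 0 < p)
    (hS : 0 < sobolevConst s Ω p) (hu : u ∈ X₀ s Ω) :
    Integrable (fun x => |u x| ^ p) ∧
      sobolevConst s Ω p * (∫ x, |u x| ^ p) ^ (2 / p) ≤ form s Ω u u := by
  by_cases h0 : u =ᵐ[volume] 0
  · have h1 : (fun x => |u x| ^ p) =ᵐ[volume] 0 := by
      filter_upwards [h0] with x hx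
      simp [hx, hp.ne']
    refine ⟨(integrable_congr h1).2 (integrable_zero _ _ _), ?_⟩
    rw [integral_congr_ae h1]
    simp only [Pi.zero_apply, integral_zero]
    rw [Real.zero_rpow (by positivity), mul_zero]
    exact form_self_nonneg hs u
  have e : (∫ z : E n × E n, |u z.1 - u z.2| ^ 2 / ‖z.1 - z.2‖ ^ ((n : ℝ) + 2 * s)) =
      form s Ω u u := by
    rw [form_eq_integral hs hu]
    simp_rw [gagl_mul_gagl hs, sq_abs, sq]
  have hle : sobolevConst s Ω p ≤ form s Ω u u / (∫ x, |u x| ^ p) ^ (2 / p) := by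
    refine csInf_le ⟨0, ?_⟩ ⟨u, hu, h0, by rw [e]⟩
    rintro r ⟨v, -, -, rfl⟩
    exact div_nonneg (integral_nonneg fun z => by positivity)
      (Real.rpow_nonneg (integral_nonneg fun x => by positivity) _)
  -- A non-integrable |u|^p would have integral 0 by convention, hence Sobolev quotient 0 (division
  -- by zero), contradicting S > 0. So S > 0 yields integrability as well as the inequality.
  have hI : ∫ x, |u x| ^ p ≠ 0 := fun h => by
    rw [h, Real.zero_rpow (by positivity), div_zero] at hle
    linarith
  refine ⟨by_contra fun h => hI (integral_undef h), ?_⟩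
  have hI0 : 0 < ∫ x, |u x| ^ p := lt_of_le_of_ne (integral_nonneg fun x => by positivity) hI.symm
  rwa [le_div_iff₀ (by positivity)] at hle

end Space

/-! ### Lipschitz functions in `X₀` -/

section Lipschitz

variable {n : ℕ} {s : ℝ} {Ω : Set (E n)} {u v w φ : E n → ℝ}

/-- In polar coordinates the integrand is bounded by K² y^(1−2s) near 0, integrable because s < 1,
and by M y^(−1−2s) at infinity, integrable because s > 0. -/
theorem integrable_truncated_kernel (hn : 0 < n) (hs : 0 < s) (hs1 : s < 1) (K : ℝ) {M : ℝ}
    (hM : 0 ≤ M) :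
    Integrable (fun h : E n => min (K ^ 2 * ‖h‖ ^ 2) M / ‖h‖ ^ ((n : ℝ) + 2 * s)) volume := by
  have : Nontrivial (E n) := by
    have : Nonempty (Fin n) := ⟨⟨0, hn⟩⟩
    infer_instance
  rw [integrable_fun_norm_addHaar (volume : Measure (E n))
    (f := fun y : ℝ => min (K ^ 2 * y ^ 2) M / y ^ ((n : ℝ) + 2 * s))]
  have hdim : Module.finrank ℝ (E n) = n := by simp
  rw [hdim, ← Ioc_union_Ioi_eq_Ioi (zero_le_one' ℝ), integrableOn_union]
  have hmeas : Measurable fun y : ℝ =>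
      y ^ (n - 1) • (min (K ^ 2 * y ^ 2) M / y ^ ((n : ℝ) + 2 * s)) := by
    fun_prop
  have hnorm : ∀ y : ℝ, 0 < y → ‖y ^ (n - 1) • (min (K ^ 2 * y ^ 2) M / y ^ ((n : ℝ) + 2 * s))‖ =
      y ^ ((n : ℝ) - 1) * (min (K ^ 2 * y ^ 2) M / y ^ ((n : ℝ) + 2 * s)) := fun y hy => by
    have h0 : 0 ≤ min (K ^ 2 * y ^ 2) M := le_min (by positivity) hM
    rw [smul_eq_mul, Real.norm_of_nonneg (by positivity), ← Real.rpow_natCast, Nat.cast_sub hn,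
      Nat.cast_one]
  constructor
  · have h1 : IntegrableOn (fun y : ℝ => K ^ 2 * y ^ (1 - 2 * s)) (Ioc 0 1) := by
      refine Integrable.const_mul ?_ _
      have := intervalIntegral.intervalIntegrable_rpow' (a := 0) (b := 1) (r := 1 - 2 * s)
        (by linarith)
      rwa [intervalIntegrable_iff_integrableOn_Ioc_of_le zero_le_one] at this
    refine h1.mono' hmeas.aestronglyMeasurable.restrict ?_
    refine (ae_restrict_iff' measurableSet_Ioc).2 (ae_of_all _ fun y hy => ?_)
    have hy0 := hy.1
    rw [hnorm y hy0]
    calc y ^ ((n : ℝ) - 1) * (min (K ^ 2 * y ^ 2) M / y ^ ((n : ℝ) + 2 * s))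
        ≤ y ^ ((n : ℝ) - 1) * (K ^ 2 * y ^ (2 : ℝ) / y ^ ((n : ℝ) + 2 * s)) := by
          rw [Real.rpow_two]
          gcongr
          exact min_le_left _ _
      _ = K ^ 2 * (y ^ ((n : ℝ) - 1) * (y ^ (2 : ℝ) / y ^ ((n : ℝ) + 2 * s))) := by
          ring
      _ = K ^ 2 * y ^ (1 - 2 * s) := by
          rw [← Real.rpow_sub hy0, ← Real.rpow_add hy0]; congr 2; ring
  · have h1 : IntegrableOn (fun y : ℝ => M * y ^ (-1 - 2 * s)) (Ioi 1) :=
      (integrableOn_Ioi_rpow_of_lt (by linarith) one_pos).const_mul _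
    refine h1.mono' hmeas.aestronglyMeasurable.restrict ?_
    refine (ae_restrict_iff' measurableSet_Ioi).2 (ae_of_all _ fun y hy => ?_)
    have hy0 : 0 < y := one_pos.trans hy
    rw [hnorm y hy0]
    calc y ^ ((n : ℝ) - 1) * (min (K ^ 2 * y ^ 2) M / y ^ ((n : ℝ) + 2 * s))
        ≤ y ^ ((n : ℝ) - 1) * (M / y ^ ((n : ℝ) + 2 * s)) := by
          gcongr
          exact min_le_right _ _
      _ = M * (y ^ ((n : ℝ) - 1) / y ^ ((n : ℝ) + 2 * s)) := by
          ring
      _ = M * y ^ (-1 - 2 * s) := by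
          rw [← Real.rpow_sub hy0]; congr 2; ring

/-- The squared difference is at most min(K²|x−y|², (2M)²) and vanishes unless x or y lies in Ω. The
squared quotient is thus dominated by 1_Ω(x)k(x−y) + 1_Ω(y)k(x−y) with k the truncated kernel, each
term being a convolution integrand of two integrable functions, up to swapping the variables. -/
theorem mem_X₀_of_lipschitz (hn : 0 < n) (hs : 0 < s) (hs1 : s < 1) (hΩ : MeasurableSet Ω)
    (hΩb : Bornology.IsBounded Ω) {K : NNReal} (hv : LipschitzWith K v) {M : ℝ}
    (hM : ∀ x, |v x| ≤ M) (h0 : ∀ x, x ∉ Ω → v x = 0) : v ∈ X₀ s Ω := by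
  have hvm : Measurable v := hv.continuous.measurable
  have hM0 : 0 ≤ M := (abs_nonneg _).trans (hM 0)
  have : IsFiniteMeasure (volume.restrict Ω) := ⟨by simpa using hΩb.measure_lt_top⟩
  refine (mem_X₀_iff hΩ).2 ⟨hvm.aemeasurable,
    MemLp.of_bound hvm.aestronglyMeasurable M (ae_of_all _ hM), ?_, ae_of_all _ h0⟩
  rw [memLp_two_iff_integrable_sq (aestronglyMeasurable_gagl hvm.aemeasurable)]
  set k : E n → ℝ := fun h => min ((K : ℝ) ^ 2 * ‖h‖ ^ 2) ((2 * M) ^ 2) / ‖h‖ ^ ((n : ℝ) + 2 * s)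
    with hk
  have hkint : Integrable k := integrable_truncated_kernel hn hs hs1 K (by positivity)
  have hk0 : ∀ h, 0 ≤ k h := fun h => by
    simp only [hk]; exact div_nonneg (le_min (by positivity) (by positivity)) (by positivity)
  have hΩint : Integrable (Ω.indicator fun _ => (1 : ℝ)) (volume : Measure (E n)) :=
    (integrable_indicator_iff hΩ).2 (integrable_const _)
  have h1 := Integrable.convolution_integrand (ContinuousLinearMap.mul ℝ ℝ) hΩint hkint
  have h2 := h1.swap
  refine (h1.add h2).mono' ((aestronglyMeasurable_gagl hvm.aemeasurable).pow 2)
    (ae_of_all _ fun z => ?_)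
  simp only [Pi.add_apply, Function.comp, Prod.fst_swap, Prod.snd_swap,
    ContinuousLinearMap.mul_apply']
  have hsq : gagl s v z ^ 2 = (v z.1 - v z.2) ^ 2 / ‖z.1 - z.2‖ ^ ((n : ℝ) + 2 * s) := by
    rw [sq, gagl_mul_gagl hs, sq]
  have hle : gagl s v z ^ 2 ≤ k (z.1 - z.2) := by
    rw [hsq]
    refine div_le_div_of_nonneg_right (le_min ?_ ?_) (by positivity)
    · rw [← mul_pow, sq_le_sq]
      have := hv.dist_le_mul z.1 z.2
      rw [Real.dist_eq, dist_eq_norm] at this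
      exact this.trans (le_abs_self _)
    · rw [sq_le_sq]
      refine le_trans ?_ (le_abs_self _)
      have := abs_sub (v z.1) (v z.2)
      linarith [hM z.1, hM z.2]
  have hksymm : k (z.2 - z.1) = k (z.1 - z.2) := by simp only [hk, norm_sub_rev]
  rw [Real.norm_of_nonneg (sq_nonneg _), hksymm]
  have hkz := hk0 (z.1 - z.2)
  by_cases hz1 : z.1 ∈ Ω <;> by_cases hz2 : z.2 ∈ Ω <;> simp only [hz1, hz2, indicator_of_mem,
    indicator_of_notMem, not_false_eq_true, one_mul, zero_mul, add_zero, zero_add]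
  · linarith
  · exact hle
  · exact hle
  · simp [hsq, h0 _ hz1, h0 _ hz2]

/-- The distance to the complement, truncated at 1, is such a function. It is the direction used to
prove that minimizers are strictly positive. -/
theorem exists_pos_mem_X₀ (hn : 0 < n) (hs : 0 < s) (hs1 : s < 1) (hΩ : IsOpen Ω)
    (hΩb : Bornology.IsBounded Ω) : ∃ v ∈ X₀ s Ω, (∀ x, 0 ≤ v x) ∧ ∀ x ∈ Ω, 0 < v x := by
  have : Nontrivial (E n) := by
    have : Nonempty (Fin n) := ⟨⟨0, hn⟩⟩
    infer_instance
  have hne : Ωᶜ.Nonempty := by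
    rw [nonempty_compl]
    rintro rfl
    exact NormedSpace.unbounded_univ ℝ (E n) hΩb
  refine ⟨fun x => min (Metric.infDist x Ωᶜ) 1, ?_, fun x => le_min Metric.infDist_nonneg zero_le_one,
    fun x hx => lt_min ?_ one_pos⟩
  · refine mem_X₀_of_lipschitz hn hs hs1 hΩ.measurableSet hΩb (M := 1)
      ((Metric.lipschitz_infDist_pt Ωᶜ).min_const 1) (fun x => ?_) fun x hx => ?_
    · rw [abs_of_nonneg (le_min Metric.infDist_nonneg zero_le_one)]
      exact min_le_right _ _
    · simp [Metric.infDist_zero_of_mem (show x ∈ Ωᶜ from hx)]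
  · exact (hΩ.isClosed_compl.notMem_iff_infDist_pos hne).1 (by simpa using hx)

/-- If `b` is positive somewhere, some nonnegative element of `X₀` sees it. -/
theorem exists_mem_X₀_integral_pos (hn : 0 < n) (hs : 0 < s) (hs1 : s < 1) (hΩ : IsOpen Ω)
    (hΩb : Bornology.IsBounded Ω) {b : E n → ℝ} (hb : MemLp b ∞ (volume.restrict Ω))
    (hbpos : ¬ ((fun x => max (b x) 0) =ᵐ[volume.restrict Ω] 0)) {p : ℝ} (hp : 0 < p) :
    ∃ v ∈ X₀ s Ω, (∀ x, 0 ≤ v x) ∧ 0 < ∫ x in Ω, b x * v x ^ p := by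
  have : IsFiniteMeasure (volume.restrict Ω) := ⟨by simpa using hΩb.measure_lt_top⟩
  have hbint : Integrable b (volume.restrict Ω) := hb.integrable le_top
  obtain ⟨b', hb'm, hbb'⟩ := hb.1
  have hb'm := hb'm.measurable
  set P : Set (E n) := Ω ∩ {x | 0 < b' x} with hP
  have hPm : MeasurableSet P := hΩ.measurableSet.inter (measurableSet_lt measurable_const hb'm)
  have hP0 : volume P ≠ 0 := fun h => hbpos (by
    have h1 : ∀ᵐ x ∂(volume.restrict Ω), x ∉ P := by
      refine ae_restrict_of_ae ?_
      exact measure_eq_zero_iff_ae_notMem.1 h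
    filter_upwards [h1, hbb', ae_restrict_mem hΩ.measurableSet] with x hx hbx hxΩ
    have : ¬ 0 < b' x := fun h => hx ⟨hxΩ, h⟩
    rw [← hbx] at this
    simpa using this)
  -- Inner regularity gives a compact K of positive measure inside the set where a measurable
  -- representative of `b` is positive. Lipschitz cutoffs decreasing to the indicator of K then make
  -- the integral approach ∫_K b > 0.
  obtain ⟨K, hKP, hK, hK0⟩ := hPm.exists_lt_isCompact (μ := volume) (r := 0)
    (pos_iff_ne_zero.2 hP0)
  have hKne : K.Nonempty := nonempty_of_measure_ne_zero hK0.ne'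
  obtain ⟨δ, hδ, hδK⟩ := hK.exists_cthickening_subset_open hΩ (hKP.trans inter_subset_left)
  have hfar : ∀ x, x ∉ Ω → δ ≤ Metric.infDist x K := fun x hx => by
    by_contra h
    push Not at h
    refine hx (hδK ?_)
    rw [Metric.mem_cthickening_iff,
      ENNReal.le_ofReal_iff_toReal_le (Metric.infEDist_ne_top hKne) hδ.le]
    exact h.le
  let v : ℕ → E n → ℝ := fun k x => max (1 - k * Metric.infDist x K) 0
  have hv0 : ∀ k x, 0 ≤ v k x := fun k x => le_max_right _ _
  have hv1 : ∀ k x, v k x ≤ 1 := fun k x => max_le (by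
    have : 0 ≤ k * Metric.infDist x K := mul_nonneg (Nat.cast_nonneg _) Metric.infDist_nonneg
    linarith) zero_le_one
  have hvlip : ∀ k : ℕ, LipschitzWith (k : NNReal) (v k) := fun k => by
    refine LipschitzWith.max_const (LipschitzWith.of_dist_le_mul fun x y => ?_) 0
    have := (Metric.lipschitz_infDist_pt K).dist_le_mul x y
    rw [Real.dist_eq] at this ⊢
    rw [show 1 - k * Metric.infDist x K - (1 - k * Metric.infDist y K) =
      -(k * (Metric.infDist x K - Metric.infDist y K)) by ring, abs_neg, abs_mul, Nat.abs_cast]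
    simp only [NNReal.coe_natCast]
    gcongr
    simpa using this
  have hlim : Filter.Tendsto (fun k => ∫ x in Ω, b x * v k x ^ p) Filter.atTop
      (nhds (∫ x in Ω, b x * K.indicator (fun _ => (1 : ℝ)) x)) := by
    refine tendsto_integral_of_dominated_convergence (fun x => |b x|) (fun k => ?_) hbint.abs
      (fun k => ae_of_all _ fun x => ?_) (ae_of_all _ fun x => ?_)
    · exact hbint.1.mul ((hvlip k).continuous.measurable.pow_const p).aestronglyMeasurable
    · rw [norm_mul, Real.norm_eq_abs, Real.norm_of_nonneg (Real.rpow_nonneg (hv0 k x) p)]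
      exact mul_le_of_le_one_right (abs_nonneg _) (Real.rpow_le_one (hv0 k x) (hv1 k x) hp.le)
    · refine Filter.Tendsto.const_mul _ ?_
      by_cases hx : x ∈ K
      · simp [v, hx, Metric.infDist_zero_of_mem hx]
      · have hd : 0 < Metric.infDist x K := (hK.isClosed.notMem_iff_infDist_pos hKne).1 hx
        refine tendsto_const_nhds.congr' ?_
        filter_upwards [Filter.eventually_ge_atTop ⌈(Metric.infDist x K)⁻¹⌉₊] with k hk
        have hk : (Metric.infDist x K)⁻¹ ≤ k := Nat.ceil_le.1 hk
        rw [inv_le_iff_one_le_mul₀ hd] at hk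
        simp only [v, hx, not_false_eq_true, indicator_of_notMem]
        rw [max_eq_right (by linarith), Real.zero_rpow hp.ne']
  have hpos : 0 < ∫ x in Ω, b x * K.indicator (fun _ => (1 : ℝ)) x := by
    have e : (fun x => b x * K.indicator (fun _ => (1 : ℝ)) x) = K.indicator b := by
      ext x; by_cases hx : x ∈ K <;> simp [hx]
    have hKΩ : K ⊆ Ω := hKP.trans inter_subset_left
    rw [e, setIntegral_indicator hK.measurableSet, inter_eq_right.2 hKΩ]
    have hbb'K : b =ᵐ[volume.restrict K] b' := ae_restrict_of_ae_restrict_of_subset hKΩ hbb'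
    rw [integral_congr_ae hbb'K]
    have hi : IntegrableOn b' K := (hbint.congr hbb').mono_measure (Measure.restrict_mono hKΩ le_rfl)
    rw [setIntegral_pos_iff_support_of_nonneg_ae _ hi]
    · have : Function.support b' ∩ K = K := inter_eq_right.2 fun x hx => ((hKP hx).2).ne'
      rwa [this]
    · exact (ae_restrict_iff' hK.measurableSet).2 (ae_of_all _ fun x hx => (hKP hx).2.le)
  -- The requirement k ≥ δ⁻¹ makes the cutoff vanish at distance δ from K, hence outside Ω.
  obtain ⟨k, hk, hkδ⟩ := ((hlim.eventually (lt_mem_nhds hpos)).and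
    (Filter.eventually_ge_atTop ⌈δ⁻¹⌉₊)).exists
  refine ⟨v k, mem_X₀_of_lipschitz hn hs hs1 hΩ.measurableSet hΩb (hvlip k) (M := 1)
    (fun x => by rw [abs_of_nonneg (hv0 k x)]; exact hv1 k x) (fun x hx => ?_), hv0 k, hk⟩
  have hk : δ⁻¹ ≤ k := Nat.ceil_le.1 hkδ
  rw [inv_le_iff_one_le_mul₀ hδ] at hk
  have : k * δ ≤ k * Metric.infDist x K := by gcongr; exact hfar x hx
  exact max_eq_right (by linarith)

end Lipschitz

/-! ### Averages over balls and the higher integrability of `X₀` -/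

section Averages

variable {n : ℕ} {s : ℝ} {Ω : Set (E n)} {u v w φ : E n → ℝ}

/-- The volume of the unit ball. -/
def ballVol (n : ℕ) : ℝ := volume.real (Metric.ball (0 : E n) 1)

theorem ballVol_pos : 0 < ballVol n :=
  ENNReal.toReal_pos (Metric.measure_ball_pos volume _ one_pos).ne' measure_ball_lt_top.ne

theorem volume_real_ball (x : E n) {r : ℝ} (hr : 0 < r) :
    volume.real (Metric.ball x r) = ballVol n * r ^ (n : ℝ) := by
  rw [measureReal_def, Measure.addHaar_ball_of_pos _ _ hr, ENNReal.toReal_mul,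
    ENNReal.toReal_ofReal (by positivity), finrank_euclideanSpace_fin, Real.rpow_natCast, mul_comm]
  rfl

/-- The local energy density of `u`. -/
def density (s : ℝ) (u : E n → ℝ) (x : E n) : ℝ := ∫ y, gagl s u (x, y) ^ 2

theorem integrable_gagl_sq (hΩ : MeasurableSet Ω) (hu : u ∈ X₀ s Ω) :
    Integrable (fun z => gagl s u z ^ 2) ((volume : Measure (E n)).prod volume) := by
  have := integrable_gagl_mul hΩ hu hu
  simp_rw [← sq] at this
  exact this

theorem integrable_density (hΩ : MeasurableSet Ω) (hu : u ∈ X₀ s Ω) :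
    Integrable (density s u) := (integrable_gagl_sq hΩ hu).integral_prod_left

theorem density_nonneg (x : E n) : 0 ≤ density s u x := integral_nonneg fun _ => sq_nonneg _

theorem integral_density (hs : 0 < s) (hΩ : MeasurableSet Ω) (hu : u ∈ X₀ s Ω) :
    ∫ x, density s u x = form s Ω u u := by
  rw [form_eq_integral hs hu]
  simp_rw [← sq]
  exact (integral_prod _ (integrable_gagl_sq hΩ hu)).symm

theorem memLp_two (hΩ : MeasurableSet Ω) (hu : u ∈ X₀ s Ω) : MemLp u 2 volume := by
  have h := (memLp_indicator_iff_restrict hΩ).2 hu.2.1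
  refine (memLp_congr_ae ?_).1 h
  filter_upwards [hu.2.2.2] with x hx
  by_cases hxΩ : x ∈ Ω
  · simp [hxΩ]
  · simp [hxΩ, hx hxΩ]

theorem isFiniteMeasure_ball (x : E n) (r : ℝ) :
    IsFiniteMeasure ((volume : Measure (E n)).restrict (Metric.ball x r)) :=
  ⟨by simpa using measure_ball_lt_top⟩

/-- Jensen's inequality bounds the left side by the mean of (u(x) − u(y))². On the ball |x − y| ≤ r,
so inserting r^(n+2s)/|x−y|^(n+2s) only enlarges it, and division by the volume leaves r^(2s). The
exceptional null set does not depend on r, which allows r to be chosen as a function of x. -/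
theorem sub_ballMean_sq_le (hs : 0 < s) (hΩ : MeasurableSet Ω) (hu : u ∈ X₀ s Ω) :
    ∀ᵐ x ∂(volume : Measure (E n)), ∀ r : ℝ, 0 < r →
      (u x - ⨍ y in Metric.ball x r, u y) ^ 2 ≤ r ^ (2 * s) / ballVol n * density s u x := by
  filter_upwards [(integrable_gagl_sq hΩ hu).prod_right_ae] with x hx r hr
  have := isFiniteMeasure_ball x r
  have hu2 : MemLp u 2 (volume.restrict (Metric.ball x r)) := (memLp_two hΩ hu).restrict _
  have hui : IntegrableOn u (Metric.ball x r) := hu2.integrable one_le_two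
  have hB : volume (Metric.ball x r) ≠ 0 := (Metric.measure_ball_pos volume _ hr).ne'
  have hB' : volume (Metric.ball x r) ≠ ⊤ := measure_ball_lt_top.ne
  have hd2 : MemLp (fun y => u x - u y) 2 (volume.restrict (Metric.ball x r)) :=
    (memLp_const (u x)).sub hu2
  have hsub : u x - ⨍ y in Metric.ball x r, u y = ⨍ y in Metric.ball x r, (u x - u y) := by
    rw [setAverage_eq, setAverage_eq, integral_sub (integrable_const _) hui, smul_sub,
      setIntegral_const, smul_smul, inv_mul_cancel₀, one_smul]
    exact ENNReal.toReal_ne_zero.2 ⟨hB, hB'⟩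
  rw [hsub]
  have hJ := (even_two.convexOn_pow (𝕜 := ℝ)).map_set_average_le (μ := volume)
    (t := Metric.ball x r) (f := fun y => u x - u y) (by fun_prop) isClosed_univ hB hB' (by simp)
    (hd2.integrable one_le_two) hd2.integrable_sq
  refine hJ.trans ?_
  rw [setAverage_eq, volume_real_ball x hr, smul_eq_mul]
  have hpt : ∀ y ∈ Metric.ball x r, (u x - u y) ^ 2 ≤
      r ^ ((n : ℝ) + 2 * s) * gagl s u (x, y) ^ 2 := fun y hy => by
    rw [sq (gagl s u (x, y)), gagl_mul_gagl hs]
    simp only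
    have hns : 0 < (n : ℝ) + 2 * s := by positivity
    rcases eq_or_ne x y with rfl | hxy
    · simp
    have h1 : 0 < ‖x - y‖ := norm_pos_iff.2 (sub_ne_zero.2 hxy)
    have h2 : ‖x - y‖ ^ ((n : ℝ) + 2 * s) ≤ r ^ ((n : ℝ) + 2 * s) := by
      have : ‖x - y‖ ≤ r := by rw [← dist_eq_norm, dist_comm]; exact (Metric.mem_ball.1 hy).le
      gcongr
    rw [← sq, ← mul_div_assoc, le_div_iff₀ (by positivity), mul_comm]
    gcongr
  have hint : ∫ y in Metric.ball x r, (u x - u y) ^ 2 ≤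
      r ^ ((n : ℝ) + 2 * s) * density s u x := by
    calc ∫ y in Metric.ball x r, (u x - u y) ^ 2
        ≤ ∫ y in Metric.ball x r, r ^ ((n : ℝ) + 2 * s) * gagl s u (x, y) ^ 2 :=
          setIntegral_mono_on hd2.integrable_sq (hx.integrableOn.const_mul _)
            measurableSet_ball hpt
      _ = r ^ ((n : ℝ) + 2 * s) * ∫ y in Metric.ball x r, gagl s u (x, y) ^ 2 :=
          integral_const_mul _ _
      _ ≤ r ^ ((n : ℝ) + 2 * s) * density s u x := by
          gcongr
          exact setIntegral_le_integral hx (ae_of_all _ fun y => sq_nonneg _)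
  have hω := ballVol_pos (n := n)
  calc (ballVol n * r ^ (n : ℝ))⁻¹ * ∫ y in Metric.ball x r, (u x - u y) ^ 2
      ≤ (ballVol n * r ^ (n : ℝ))⁻¹ * (r ^ ((n : ℝ) + 2 * s) * density s u x) := by gcongr
    _ = r ^ (2 * s) / ballVol n * density s u x := by
      rw [Real.rpow_add hr]; field_simp

theorem abs_ballMean_rpow_le {p : ℝ} (hp : 1 ≤ p) (hum : AEStronglyMeasurable u volume)
    (hup : Integrable (fun x => |u x| ^ p)) (x : E n) {r : ℝ} (hr : 0 < r) :
    |⨍ y in Metric.ball x r, u y| ^ p ≤ (∫ y, |u y| ^ p) / (ballVol n * r ^ (n : ℝ)) := by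
  have := isFiniteMeasure_ball x r
  have hB : volume (Metric.ball x r) ≠ 0 := (Metric.measure_ball_pos volume _ hr).ne'
  have hB' : volume (Metric.ball x r) ≠ ⊤ := measure_ball_lt_top.ne
  have hω := ballVol_pos (n := n)
  have hui : IntegrableOn (fun y => |u y|) (Metric.ball x r) := by
    refine ((integrable_const (1 : ℝ)).add hup.integrableOn).mono' hum.norm.restrict
      (ae_of_all _ fun y => ?_)
    simp only [Pi.add_apply, Real.norm_eq_abs, abs_abs]
    rcases le_total |u y| 1 with h | h
    · have := Real.rpow_nonneg (abs_nonneg (u y)) p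
      linarith
    · linarith [Real.self_le_rpow_of_one_le h hp]
  have h1 : |⨍ y in Metric.ball x r, u y| ≤ ⨍ y in Metric.ball x r, |u y| := by
    rw [setAverage_eq, setAverage_eq, smul_eq_mul, smul_eq_mul, abs_mul,
      abs_of_nonneg (inv_nonneg.2 measureReal_nonneg)]
    gcongr
    exact abs_integral_le_integral_abs
  have hJ := (convexOn_rpow hp).map_set_average_le (μ := volume)
    (t := Metric.ball x r) (f := fun y => |u y|)
    (fun x _ => (Real.continuousAt_rpow_const x p (Or.inr (by linarith))).continuousWithinAt)
    isClosed_Ici hB hB' (ae_of_all _ fun y => mem_Ici.2 (abs_nonneg _)) hui hup.integrableOn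
  calc |⨍ y in Metric.ball x r, u y| ^ p ≤ (⨍ y in Metric.ball x r, |u y|) ^ p := by gcongr
    _ ≤ _ := hJ
    _ ≤ _ := by
      rw [setAverage_eq, volume_real_ball x hr, smul_eq_mul, inv_mul_eq_div]
      gcongr
      · exact ae_of_all _ fun y => by simp only [Pi.zero_apply]; positivity
      · exact Measure.restrict_le_self

/-- Bounded sets of `X₀` in `L^p` are bounded in `L^σ` with `σ = 2 + 2sp/n`. -/
theorem higher_integrability (hn : 0 < n) (hs : 0 < s) (hΩ : MeasurableSet Ω) (hu : u ∈ X₀ s Ω)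
    {p : ℝ} (hp : 1 ≤ p) (hup : Integrable (fun x => |u x| ^ p)) {J : ℝ} (hJ : 0 < J)
    (huJ : ∫ x, |u x| ^ p ≤ J) :
    Integrable (fun x => |u x| ^ (2 + 2 * s * p / n)) ∧
      ∫ x, |u x| ^ (2 + 2 * s * p / n) ≤
        4 / ballVol n * (2 ^ p * J / ballVol n) ^ (2 * s / n) * form s Ω u u := by
  have hω := ballVol_pos (n := n)
  have hn' : (0 : ℝ) < n := by exact_mod_cast hn
  set c : ℝ := 4 / ballVol n * (2 ^ p * J / ballVol n) ^ (2 * s / n) with hc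
  have hσ : 0 < 2 + 2 * s * p / n := by positivity
  have key : ∀ᵐ x ∂(volume : Measure (E n)),
      |u x| ^ (2 + 2 * s * p / n) ≤ c * density s u x := by
    filter_upwards [sub_ballMean_sq_le hs hΩ hu] with x hx
    have hD := density_nonneg (s := s) (u := u) x
    rcases (abs_nonneg (u x)).eq_or_lt with h0 | h0
    · rw [← h0, Real.zero_rpow hσ.ne']
      positivity
    set a := |u x| with ha
    -- With r^n = R the mean m over the ball is at most a/2 in absolute value, so a/2 ≤ |u(x) − m|.
    -- The preceding oscillation bound then controls a² by r^(2s) times the density, and r^(2s) is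
    -- proportional to a^(−2sp/n); this is where the exponent 2 + 2sp/n comes from.
    set R : ℝ := 2 ^ p * J / ballVol n / a ^ p with hR
    have hR0 : 0 < R := by positivity
    set r : ℝ := R ^ (1 / (n : ℝ)) with hr
    have hr0 : 0 < r := by positivity
    have hrn : r ^ (n : ℝ) = R := by
      rw [hr, ← Real.rpow_mul hR0.le, one_div_mul_cancel hn'.ne', Real.rpow_one]
    have h1 := hx r hr0
    have h2 := abs_ballMean_rpow_le hp hu.1.aestronglyMeasurable hup x hr0
    set m := ⨍ y in Metric.ball x r, u y with hm
    have h3 : |m| ^ p ≤ (a / 2) ^ p := by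
      refine h2.trans ?_
      rw [hrn, hR, Real.div_rpow h0.le zero_le_two, div_le_div_iff₀ (by positivity) (by positivity)]
      calc (∫ y, |u y| ^ p) * 2 ^ p ≤ J * 2 ^ p := by gcongr
        _ = a ^ p * (ballVol n * (2 ^ p * J / ballVol n / a ^ p)) := by field_simp
    have h4 : |m| ≤ a / 2 :=
      (Real.rpow_le_rpow_iff (abs_nonneg _) (by positivity) (by linarith)).1 h3
    have h5 : a / 2 ≤ |u x - m| := by
      have := abs_sub_abs_le_abs_sub (u x) m
      linarith
    have h6 : (a / 2) ^ 2 ≤ r ^ (2 * s) / ballVol n * density s u x := by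
      refine le_trans ?_ h1
      rw [← sq_abs (u x - m)]
      gcongr
    have h7 : r ^ (2 * s) * a ^ (2 * s * p / n) = (2 ^ p * J / ballVol n) ^ (2 * s / n) := by
      rw [hr, ← Real.rpow_mul hR0.le, show 1 / (n : ℝ) * (2 * s) = 2 * s / n by ring, hR,
        Real.div_rpow (by positivity) (by positivity), ← Real.rpow_mul h0.le,
        show p * (2 * s / n) = 2 * s * p / n by ring]
      field_simp
    calc a ^ (2 + 2 * s * p / n) = 4 * (a / 2) ^ 2 * a ^ (2 * s * p / n) := by
          rw [Real.rpow_add h0, Real.rpow_two]; ring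
      _ ≤ 4 * (r ^ (2 * s) / ballVol n * density s u x) * a ^ (2 * s * p / n) := by gcongr
      _ = 4 / ballVol n * (r ^ (2 * s) * a ^ (2 * s * p / n)) * density s u x := by ring
      _ = c * density s u x := by rw [h7, hc]
  have hmeas : AEStronglyMeasurable (fun x => |u x| ^ (2 + 2 * s * p / n)) volume :=
    (hu.1.norm.pow_const _).aestronglyMeasurable
  have hdi := (integrable_density hΩ hu).const_mul c
  have hint : Integrable (fun x => |u x| ^ (2 + 2 * s * p / n)) := by
    refine hdi.mono' hmeas ?_
    filter_upwards [key] with x hx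
    rwa [Real.norm_of_nonneg (by positivity)]
  refine ⟨hint, ?_⟩
  rw [← integral_density hs hΩ hu, ← integral_const_mul]
  exact integral_mono_ae hint hdi key

/-- This splits the L² norm into an energy part that is small with r and ball averages, which for
fixed r converge pointwise along weakly convergent sequences. Compactness in L² follows from this
split. -/
theorem integral_sq_le_ballMean (hs : 0 < s) (hΩ : MeasurableSet Ω) (hu : u ∈ X₀ s Ω) {r : ℝ}
    (hr : 0 < r)
    (hm : IntegrableOn (fun x => (⨍ y in Metric.ball x r, u y) ^ 2) Ω) :
    ∫ x, u x ^ 2 ≤ 2 * (r ^ (2 * s) / ballVol n * form s Ω u u) +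
      2 * ∫ x in Ω, (⨍ y in Metric.ball x r, u y) ^ 2 := by
  have hω := ballVol_pos (n := n)
  have e : ∫ x, u x ^ 2 = ∫ x in Ω, u x ^ 2 := by
    refine (setIntegral_eq_integral_of_ae_compl_eq_zero ?_).symm
    filter_upwards [hu.2.2.2] with x hx hxΩ
    rw [hx hxΩ]; norm_num
  have hdi := (integrable_density hΩ hu).const_mul (r ^ (2 * s) / ballVol n)
  rw [e, ← integral_density hs hΩ hu, ← integral_const_mul]
  calc ∫ x in Ω, u x ^ 2
      ≤ ∫ x in Ω, (2 * (r ^ (2 * s) / ballVol n * density s u x) +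
        2 * (⨍ y in Metric.ball x r, u y) ^ 2) := by
        refine integral_mono_ae hu.2.1.integrable_sq
          ((hdi.integrableOn.const_mul 2).add (hm.const_mul 2)) ?_
        filter_upwards [ae_restrict_of_ae (sub_ballMean_sq_le hs hΩ hu)] with x hx
        have := hx r hr
        nlinarith [sq_nonneg (u x - 2 * ⨍ y in Metric.ball x r, u y)]
    _ = 2 * (∫ x in Ω, r ^ (2 * s) / ballVol n * density s u x) +
        2 * ∫ x in Ω, (⨍ y in Metric.ball x r, u y) ^ 2 := by
        rw [integral_add (hdi.integrableOn.const_mul 2) (hm.const_mul 2), integral_const_mul 2,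
          integral_const_mul 2]
    _ ≤ _ := by
        gcongr
        · exact ae_of_all _ fun x => by
            have := density_nonneg (s := s) (u := u) x
            simp only [Pi.zero_apply]; positivity
        · exact Measure.restrict_le_self

end Averages

/-! ### Compactness -/

section Compactness

open Filter Topology

variable {n : ℕ} {s : ℝ} {Ω : Set (E n)} {u v w φ : E n → ℝ}

/-- Sequential weak compactness of bounded sets in `L²`, tested against functions. -/
theorem exists_subseq_weak {U : ℕ → E n → ℝ} (hU : ∀ k, MemLp (U k) 2 volume) {M : ℝ}
    (hM : ∀ k, ∫ x, U k x ^ 2 ≤ M) :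
    ∃ ns : ℕ → ℕ, StrictMono ns ∧ ∀ g : E n → ℝ, MemLp g 2 volume →
      ∃ l : ℝ, Tendsto (fun k => ∫ x, U (ns k) x * g x) atTop (𝓝 l) := by
  have : Fact ((2 : ℝ≥0∞) ≠ ⊤) := ⟨by simp⟩
  let H := Lp ℝ 2 (volume : Measure (E n))
  have : SecondCountableTopology H := Lp.SecondCountableTopology
  let T : ℕ → WeakDual ℝ H := fun k =>
    WeakDual.toStrongDual.symm (InnerProductSpace.toDual ℝ H ((hU k).toLp (U k)))
  have hinner : ∀ (k : ℕ) (g : E n → ℝ) (hg : MemLp g 2 volume),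
      inner ℝ ((hU k).toLp (U k)) (hg.toLp g) = ∫ x, U k x * g x := fun k g hg => by
    rw [L2.inner_def]
    refine integral_congr_ae ?_
    filter_upwards [(hU k).coeFn_toLp, hg.coeFn_toLp] with x h1 h2
    rw [h1, h2]
    simp [mul_comm]
  have hT : ∀ k, T k ∈ WeakDual.toStrongDual ⁻¹' Metric.closedBall (0 : StrongDual ℝ H) √M := by
    intro k
    simp only [T, mem_preimage, LinearEquiv.apply_symm_apply, mem_closedBall_zero_iff,
      LinearIsometryEquiv.norm_map]
    refine Real.le_sqrt_of_sq_le ?_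
    rw [← real_inner_self_eq_norm_sq, hinner]
    simp_rw [← sq]
    exact hM k
  obtain ⟨τ, -, ns, hns, hlim⟩ := WeakDual.isSeqCompact_closedBall ℝ H 0 √M hT
  refine ⟨ns, hns, fun g hg => ⟨τ (hg.toLp g), ?_⟩⟩
  have := ((WeakDual.eval_continuous (𝕜 := ℝ) (hg.toLp g)).tendsto τ).comp hlim
  refine this.congr fun k => ?_
  rw [← hinner]
  rfl

theorem memLp_indicator_ball (x : E n) (r : ℝ) :
    MemLp ((Metric.ball x r).indicator fun _ => (1 : ℝ)) 2 volume :=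
  memLp_indicator_const _ measurableSet_ball _ (Or.inr measure_ball_lt_top.ne)

theorem ballMean_eq {r : ℝ} (hr : 0 < r) (u : E n → ℝ) (x : E n) :
    ⨍ y in Metric.ball x r, u y = (ballVol n * r ^ (n : ℝ))⁻¹ *
      ∫ y, u y * (Metric.ball x r).indicator (fun _ => (1 : ℝ)) y := by
  rw [setAverage_eq, volume_real_ball x hr, smul_eq_mul, ← integral_indicator measurableSet_ball]
  congr 2
  ext y
  by_cases hy : y ∈ Metric.ball x r <;> simp [hy]

theorem aestronglyMeasurable_ballMean {r : ℝ} (hr : 0 < r) (hu : AEStronglyMeasurable u volume) :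
    AEStronglyMeasurable (fun x => ⨍ y in Metric.ball x r, u y) volume := by
  simp_rw [ballMean_eq hr]
  refine AEStronglyMeasurable.const_mul ?_ _
  refine AEStronglyMeasurable.integral_prod_right'
    (f := fun z : E n × E n => u z.2 * (Metric.ball z.1 r).indicator (fun _ => (1 : ℝ)) z.2) ?_
  refine hu.comp_snd.mul ?_
  have e : (fun z : E n × E n => (Metric.ball z.1 r).indicator (fun _ => (1 : ℝ)) z.2) =
      {z : E n × E n | dist z.2 z.1 < r}.indicator fun _ => 1 := by
    ext z
    by_cases h : dist z.2 z.1 < r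
    · rw [indicator_of_mem (Metric.mem_ball.2 h), indicator_of_mem (by exact h)]
    · rw [indicator_of_notMem (fun h' => h (Metric.mem_ball.1 h')), indicator_of_notMem (by exact h)]
  rw [e]
  exact (measurable_const.indicator (measurableSet_lt (by fun_prop) (by fun_prop)))
    |>.aestronglyMeasurable

theorem ballMean_sq_le (hu : MemLp u 2 volume) {M : ℝ} (hM : ∫ x, u x ^ 2 ≤ M) (x : E n) {r : ℝ}
    (hr : 0 < r) : (⨍ y in Metric.ball x r, u y) ^ 2 ≤ M / (ballVol n * r ^ (n : ℝ)) := by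
  have hω := ballVol_pos (n := n)
  have h := abs_ballMean_rpow_le (p := 2) one_le_two hu.1 (u := u)
    (by simpa using hu.integrable_sq) x hr
  simp only [Real.rpow_two, sq_abs] at h
  exact h.trans (by gcongr)

theorem form_sub_self_le (hs : 0 < s) (hΩ : MeasurableSet Ω) (hu : u ∈ X₀ s Ω) (hv : v ∈ X₀ s Ω) :
    form s Ω (u - v) (u - v) ≤ 2 * form s Ω u u + 2 * form s Ω v v := by
  have h1 := form_add_smul_self hs hΩ hu hv (-1)
  have h2 := form_add_smul_self hs hΩ hu hv 1
  have h3 := form_self_nonneg hs (Ω := Ω) (u + (1 : ℝ) • v)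
  have e : u - v = u + (-1 : ℝ) • v := by ext; simp [sub_eq_add_neg]
  rw [e]
  linarith

theorem eLpNorm_two_eq (hu : MemLp u 2 volume) :
    eLpNorm u 2 volume = ENNReal.ofReal (√(∫ x, u x ^ 2)) := by
  rw [hu.eLpNorm_eq_integral_rpow_norm (by simp) (by simp)]
  simp [Real.sqrt_eq_rpow]

/-- A sequence bounded in `X₀` and in `L²` has a subsequence that is Cauchy in `L²`. -/
theorem exists_subseq_cauchy (hs : 0 < s) (hΩ : MeasurableSet Ω)
    (hΩb : Bornology.IsBounded Ω) {U : ℕ → E n → ℝ} (hU : ∀ k, U k ∈ X₀ s Ω) {M : ℝ}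
    (hM : ∀ k, ∫ x, U k x ^ 2 ≤ M) (hF : ∀ k, form s Ω (U k) (U k) ≤ M) :
    ∃ ns : ℕ → ℕ, StrictMono ns ∧ ∀ ε : ℝ, 0 < ε → ∃ N, ∀ k l, N ≤ k → N ≤ l →
      ∫ x, (U (ns k) x - U (ns l) x) ^ 2 < ε := by
  have hfin : IsFiniteMeasure (volume.restrict Ω) := ⟨by simpa using hΩb.measure_lt_top⟩
  have hω := ballVol_pos (n := n)
  have hU2 : ∀ k, MemLp (U k) 2 volume := fun k => memLp_two hΩ (hU k)
  have hM0 : 0 ≤ M := (integral_nonneg fun x => sq_nonneg _).trans (hM 0)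
  obtain ⟨ns, hns, hweak⟩ := exists_subseq_weak hU2 hM
  refine ⟨ns, hns, fun ε hε => ?_⟩
  -- Differences of members of the sequence have energy at most 4M, so this r makes the energy part
  -- less than ε/2.
  obtain ⟨r, hr, hrε⟩ : ∃ r : ℝ, 0 < r ∧ 2 * (r ^ (2 * s) / ballVol n * (4 * M)) < ε / 2 := by
    have h1 : Tendsto (fun r : ℝ => 2 * (r ^ (2 * s) / ballVol n * (4 * M))) (𝓝[>] 0) (𝓝 0) := by
      have : ContinuousAt (fun r : ℝ => 2 * (r ^ (2 * s) / ballVol n * (4 * M))) 0 := by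
        have := Real.continuousAt_rpow_const 0 (2 * s) (Or.inr (by positivity))
        fun_prop
      have := this.tendsto
      rw [Real.zero_rpow (by positivity)] at this
      simp only [zero_div, zero_mul, mul_zero] at this
      exact this.mono_left nhdsWithin_le_nhds
    obtain ⟨r, h2, h3⟩ := ((h1.eventually (gt_mem_nhds (half_pos hε))).and
      self_mem_nhdsWithin).exists
    exact ⟨r, h3, h2⟩
  -- A ball average is a pairing with the indicator of the ball, so weak convergence gives
  -- convergence at every x. The averages are uniformly bounded and Ω has finite measure, hence they
  -- converge in L²(Ω).
  let m : ℕ → E n → ℝ := fun k x => ⨍ y in Metric.ball x r, U (ns k) y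
  have hmlim : ∀ x, ∃ l, Tendsto (fun k => m k x) atTop (𝓝 l) := fun x => by
    obtain ⟨l, hl⟩ := hweak _ (memLp_indicator_ball x r)
    refine ⟨(ballVol n * r ^ (n : ℝ))⁻¹ * l, ?_⟩
    simp only [m, ballMean_eq hr]
    exact hl.const_mul _
  choose m₀ hm₀ using hmlim
  have hmm : ∀ k, AEStronglyMeasurable (m k) volume := fun k =>
    aestronglyMeasurable_ballMean hr (hU2 _).1
  have hm₀m : AEStronglyMeasurable m₀ volume :=
    aestronglyMeasurable_of_tendsto_ae atTop hmm (ae_of_all _ hm₀)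
  set c := M / (ballVol n * r ^ (n : ℝ)) with hc
  have hmb : ∀ k x, m k x ^ 2 ≤ c := fun k x => ballMean_sq_le (hU2 _) (hM _) x hr
  have hm₀b : ∀ x, m₀ x ^ 2 ≤ c := fun x =>
    le_of_tendsto ((hm₀ x).pow 2) (Eventually.of_forall fun k => hmb k x)
  have hdb : ∀ k x, (m k x - m₀ x) ^ 2 ≤ 4 * c := fun k x => by
    nlinarith [hmb k x, hm₀b x, sq_nonneg (m k x + m₀ x)]
  have hdm : ∀ k, AEStronglyMeasurable (fun x => (m k x - m₀ x) ^ 2) (volume.restrict Ω) :=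
    fun k => (((hmm k).sub hm₀m).pow 2).restrict
  have hdi : ∀ k, IntegrableOn (fun x => (m k x - m₀ x) ^ 2) Ω := fun k =>
    (integrable_const (4 * c)).mono' (hdm k) (ae_of_all _ fun x => by
      rw [Real.norm_of_nonneg (sq_nonneg _)]; exact hdb k x)
  have hlim : Tendsto (fun k => ∫ x in Ω, (m k x - m₀ x) ^ 2) atTop (𝓝 0) := by
    have := tendsto_integral_of_dominated_convergence (μ := volume.restrict Ω)
      (F := fun k x => (m k x - m₀ x) ^ 2) (f := fun _ => (0 : ℝ)) (fun _ => 4 * c) hdm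
      (integrable_const _) (fun k => ae_of_all _ fun x => by
        rw [Real.norm_of_nonneg (sq_nonneg _)]; exact hdb k x)
      (ae_of_all _ fun x => by
        have := ((hm₀ x).sub_const (m₀ x)).pow 2
        simpa using this)
    simpa using this
  -- The averages enter with the factors 2 · (2 + 2), so ε/16 for each gives ε/2.
  obtain ⟨N, hN⟩ := eventually_atTop.1 (hlim.eventually (gt_mem_nhds (show 0 < ε / 16 by positivity)))
  refine ⟨N, fun k l hk hl => ?_⟩
  have hX : U (ns k) - U (ns l) ∈ X₀ s Ω := sub_mem_X₀ hΩ (hU _) (hU _)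
  have hmean : ∀ x, ⨍ y in Metric.ball x r, (U (ns k) - U (ns l)) y = m k x - m l x := fun x => by
    have := isFiniteMeasure_ball x r
    simp only [m, setAverage_eq, Pi.sub_apply]
    rw [integral_sub ((hU2 _).restrict _ |>.integrable one_le_two)
      ((hU2 _).restrict _ |>.integrable one_le_two), smul_sub]
  have hle : ∀ x, (m k x - m l x) ^ 2 ≤ 2 * (m k x - m₀ x) ^ 2 + 2 * (m l x - m₀ x) ^ 2 :=
    fun x => by nlinarith [sq_nonneg (m k x - m₀ x + (m l x - m₀ x))]
  have hii := ((hdi k).const_mul 2).add ((hdi l).const_mul 2)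
  have hi : IntegrableOn (fun x => (m k x - m l x) ^ 2) Ω :=
    hii.mono' (((hmm k).sub (hmm l)).pow 2).restrict (ae_of_all _ fun x => by
      rw [Real.norm_of_nonneg (sq_nonneg _)]; exact hle x)
  have h1 := integral_sq_le_ballMean hs hΩ hX hr (by simpa only [hmean] using hi)
  simp only [hmean] at h1
  simp only [Pi.sub_apply] at h1
  have h2 : ∫ x in Ω, (m k x - m l x) ^ 2 ≤
      2 * (∫ x in Ω, (m k x - m₀ x) ^ 2) + 2 * ∫ x in Ω, (m l x - m₀ x) ^ 2 := by
    rw [← integral_const_mul, ← integral_const_mul,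
      ← integral_add ((hdi k).const_mul 2) ((hdi l).const_mul 2)]
    exact integral_mono hi hii hle
  have h3 : 2 * (r ^ (2 * s) / ballVol n * form s Ω (U (ns k) - U (ns l)) (U (ns k) - U (ns l)))
      ≤ 2 * (r ^ (2 * s) / ballVol n * (4 * M)) := by
    gcongr
    have := form_sub_self_le hs hΩ (hU (ns k)) (hU (ns l))
    linarith [hF (ns k), hF (ns l)]
  have h4 := hN k hk
  have h5 := hN l hl
  linarith

/-- Completeness: an `L²`-Cauchy sequence in `X₀` with convergent energies has a subsequence that
converges almost everywhere and in `L²` to an element of `X₀` of no larger energy. -/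
theorem exists_limit (hs : 0 < s) (hΩ : MeasurableSet Ω)
    {U : ℕ → E n → ℝ} (hU : ∀ k, U k ∈ X₀ s Ω) {a : ℝ}
    (ha : Tendsto (fun k => form s Ω (U k) (U k)) atTop (𝓝 a))
    (hC : ∀ ε : ℝ, 0 < ε → ∃ N, ∀ k l, N ≤ k → N ≤ l → ∫ x, (U k x - U l x) ^ 2 < ε) :
    ∃ ns : ℕ → ℕ, StrictMono ns ∧ ∃ u ∈ X₀ s Ω, form s Ω u u ≤ a ∧
      Tendsto (fun k => ∫ x, (U (ns k) x - u x) ^ 2) atTop (𝓝 0) ∧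
      ∀ᵐ x ∂(volume : Measure (E n)), Tendsto (fun k => U (ns k) x) atTop (𝓝 (u x)) := by
  have hU2 : ∀ k, MemLp (U k) 2 volume := fun k => memLp_two hΩ (hU k)
  have : Fact ((1 : ℝ≥0∞) ≤ 2) := ⟨one_le_two⟩
  let V : ℕ → Lp ℝ 2 (volume : Measure (E n)) := fun k => (hU2 k).toLp (U k)
  have hV : CauchySeq V := by
    refine Metric.cauchySeq_iff.2 fun ε hε => ?_
    obtain ⟨N, hN⟩ := hC (ε ^ 2) (by positivity)
    refine ⟨N, fun k hk l hl => ?_⟩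
    rw [dist_eq_norm, ← MemLp.toLp_sub, Lp.norm_toLp, eLpNorm_two_eq ((hU2 k).sub (hU2 l)),
      ENNReal.toReal_ofReal (Real.sqrt_nonneg _), Real.sqrt_lt' hε]
    exact hN k l hk hl
  obtain ⟨W, hW⟩ := cauchySeq_tendsto_of_complete hV
  obtain ⟨w, hW2, hnorm⟩ : ∃ w : E n → ℝ, MemLp w 2 volume ∧
      Tendsto (fun k => eLpNorm (U k - w) 2 volume) atTop (𝓝 0) := by
    refine ⟨W, Lp.memLp W, ?_⟩
    have := (Lp.tendsto_Lp_iff_tendsto_eLpNorm' V W).1 hW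
    refine this.congr fun k => eLpNorm_congr_ae ?_
    filter_upwards [(hU2 k).coeFn_toLp] with x hx
    simp [V, hx]
  obtain ⟨ns, hns, hae⟩ := (tendstoInMeasure_of_tendsto_eLpNorm (by simp) (fun k => (hU2 k).1)
    hW2.1 hnorm).exists_seq_tendsto_ae
  have hWX : AEMeasurable w volume := hW2.1.aemeasurable
  have hW0 : ∀ᵐ x ∂(volume : Measure (E n)), x ∉ Ω → w x = 0 := by
    have h0 : ∀ᵐ x ∂(volume : Measure (E n)), ∀ k, x ∉ Ω → U k x = 0 :=
      ae_all_iff.2 fun k => (hU k).2.2.2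
    filter_upwards [hae, h0] with x hx h0 hxΩ
    refine tendsto_nhds_unique hx ?_
    simp [h0 _ hxΩ]
  have hgae : ∀ᵐ z ∂(volume : Measure (E n × E n)),
      Tendsto (fun k => gagl s (U (ns k)) z) atTop (𝓝 (gagl s w z)) := by
    have h1 : ∀ᵐ z ∂(volume : Measure (E n × E n)),
      Tendsto (fun k => U (ns k) z.1) atTop (𝓝 (w z.1)) :=
      Measure.quasiMeasurePreserving_fst.ae hae
    have h2 : ∀ᵐ z ∂(volume : Measure (E n × E n)),
      Tendsto (fun k => U (ns k) z.2) atTop (𝓝 (w z.2)) :=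
      Measure.quasiMeasurePreserving_snd.ae hae
    filter_upwards [h1, h2] with z hz1 hz2
    exact (hz1.sub hz2).div_const _
  have hgm : ∀ k, AEMeasurable (fun z => ENNReal.ofReal (gagl s (U (ns k)) z ^ 2)) volume :=
    fun k => ((aestronglyMeasurable_gagl (hU _).1).aemeasurable.pow_const 2).ennreal_ofReal
  have ha0 : 0 ≤ a := ge_of_tendsto' ha fun k => form_self_nonneg hs _
  -- Almost everywhere convergence of the functions passes to their difference quotients, and
  -- Fatou's lemma gives both finite energy of the limit and the bound by `a`.
  have hfatou : ∫⁻ z, ENNReal.ofReal (gagl s w z ^ 2) ≤ ENNReal.ofReal a := by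
    have e : ∀ᵐ z ∂(volume : Measure (E n × E n)), ENNReal.ofReal (gagl s w z ^ 2) =
        liminf (fun k => ENNReal.ofReal (gagl s (U (ns k)) z ^ 2)) atTop := by
      filter_upwards [hgae] with z hz
      exact (((ENNReal.continuous_ofReal.tendsto _).comp (hz.pow 2)).liminf_eq).symm
    rw [lintegral_congr_ae e]
    refine (lintegral_liminf_le' hgm).trans ?_
    have e2 : ∀ k, ∫⁻ z, ENNReal.ofReal (gagl s (U (ns k)) z ^ 2) =
        ENNReal.ofReal (form s Ω (U (ns k)) (U (ns k))) := fun k => by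
      have hi := integrable_gagl_sq hΩ (hU (ns k))
      rw [form_eq_integral hs (hU _)]
      simp_rw [← sq]
      exact (ofReal_integral_eq_lintegral_ofReal hi (ae_of_all _ fun z => sq_nonneg _)).symm
    simp_rw [e2]
    exact (((ENNReal.continuous_ofReal.tendsto _).comp
      (ha.comp hns.tendsto_atTop)).liminf_eq).le
  have hgW : AEStronglyMeasurable (gagl s w) volume := aestronglyMeasurable_gagl hWX
  have hgi : Integrable (fun z => gagl s w z ^ 2) volume := by
    refine ⟨hgW.pow 2, ?_⟩
    rw [hasFiniteIntegral_iff_ofReal (ae_of_all _ fun z => sq_nonneg _)]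
    exact hfatou.trans_lt ENNReal.ofReal_lt_top
  have hWmem : w ∈ X₀ s Ω := (mem_X₀_iff hΩ).2
    ⟨hWX, hW2.restrict Ω, (memLp_two_iff_integrable_sq hgW).2 hgi, hW0⟩
  refine ⟨ns, hns, w, hWmem, ?_, ?_, hae⟩
  · rw [form_eq_integral hs hWmem]
    simp_rw [← sq]
    rw [integral_eq_lintegral_of_nonneg_ae (ae_of_all _ fun z => sq_nonneg _) hgi.1]
    exact ENNReal.toReal_le_of_le_ofReal ha0 hfatou
  · have h1 : Tendsto (fun k => (eLpNorm (U k - w) 2 volume).toReal ^ 2) atTop (𝓝 0) := by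
      have := ((ENNReal.tendsto_toReal ENNReal.zero_ne_top).comp hnorm).pow 2
      simpa using this
    have h2 : Tendsto (fun k => ∫ x, (U k x - w x) ^ 2) atTop (𝓝 0) := by
      refine h1.congr fun k => ?_
      rw [eLpNorm_two_eq ((hU2 k).sub hW2), ENNReal.toReal_ofReal (Real.sqrt_nonneg _),
        Real.sq_sqrt (integral_nonneg fun x => sq_nonneg _)]
      rfl
    exact h2.comp hns.tendsto_atTop

/-- If t^(σ−p) ≥ 1/δ the first term suffices. Otherwise t^(p−2), a positive or zero power of
t^(σ−p), is at most the stated constant and the second term suffices. -/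
theorem rpow_le_interpolate {p σ δ t : ℝ} (hp : 2 ≤ p) (hσ : p < σ) (hδ : 0 < δ) (ht : 0 ≤ t) :
    t ^ p ≤ δ * t ^ σ + (1 / δ) ^ ((p - 2) / (σ - p)) * t ^ 2 := by
  rcases ht.eq_or_lt with rfl | ht
  · rw [Real.zero_rpow (by linarith), Real.zero_rpow (by linarith)]; simp
  have hσp : 0 < σ - p := by linarith
  rcases le_total (1 / δ) (t ^ (σ - p)) with h | h
  · have h1 : t ^ p ≤ δ * t ^ σ := by
      have e : t ^ σ = t ^ (σ - p) * t ^ p := by rw [← Real.rpow_add ht]; congr 1; ring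
      rw [div_le_iff₀ hδ] at h
      rw [e]
      have : 0 < t ^ p := by positivity
      nlinarith
    have : 0 ≤ (1 / δ) ^ ((p - 2) / (σ - p)) * t ^ 2 := by positivity
    linarith
  · have h1 : t ^ (p - 2) ≤ (1 / δ) ^ ((p - 2) / (σ - p)) := by
      have := Real.rpow_le_rpow (by positivity) h
        (show 0 ≤ (p - 2) / (σ - p) from div_nonneg (by linarith) hσp.le)
      rwa [← Real.rpow_mul ht.le, mul_div_cancel₀ _ hσp.ne'] at this
    have e : t ^ p = t ^ (p - 2) * t ^ 2 := by
      rw [← Real.rpow_natCast t 2, ← Real.rpow_add ht]; congr 1; push_cast; ring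
    have h2 : t ^ p ≤ (1 / δ) ^ ((p - 2) / (σ - p)) * t ^ 2 := by rw [e]; gcongr
    have : 0 ≤ δ * t ^ σ := by positivity
    linarith

/-- Since p > 2, t² ≤ 1 + |t|^p, and Ω has finite measure. -/
theorem integral_sq_le_of_form_le (hs : 0 < s)
    (hΩb : Bornology.IsBounded Ω) {p : ℝ} (hp : 2 < p) (hS : 0 < sobolevConst s Ω p) (M : ℝ) :
    ∃ C : ℝ, ∀ u ∈ X₀ s Ω, form s Ω u u ≤ M → ∫ x, u x ^ 2 ≤ C := by
  have hfin : IsFiniteMeasure (volume.restrict Ω) := ⟨by simpa using hΩb.measure_lt_top⟩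
  set S := sobolevConst s Ω p
  refine ⟨volume.real Ω + (M / S) ^ (p / 2), fun u hu hM => ?_⟩
  obtain ⟨hi, hSu⟩ := sobolev hs (by linarith) hS hu
  have hI0 : 0 ≤ ∫ x, |u x| ^ p := integral_nonneg fun x => by positivity
  have h1 : ∫ x, |u x| ^ p ≤ (M / S) ^ (p / 2) := by
    have h2 : (∫ x, |u x| ^ p) ^ (2 / p) ≤ M / S := by
      rw [le_div_iff₀ hS]; linarith
    have h3 := Real.rpow_le_rpow (by positivity) h2 (show 0 ≤ p / 2 by linarith)
    rwa [← Real.rpow_mul hI0, show 2 / p * (p / 2) = 1 by field_simp, Real.rpow_one] at h3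
  have e : ∫ x, u x ^ 2 = ∫ x in Ω, u x ^ 2 := by
    refine (setIntegral_eq_integral_of_ae_compl_eq_zero ?_).symm
    filter_upwards [hu.2.2.2] with x hx hxΩ
    rw [hx hxΩ]; norm_num
  rw [e]
  calc ∫ x in Ω, u x ^ 2 ≤ ∫ x in Ω, (1 + |u x| ^ p) := by
        refine integral_mono hu.2.1.integrable_sq ((integrable_const _).add hi.integrableOn)
          fun x => ?_
        have h0 : 0 ≤ |u x| ^ p := by positivity
        simp only
        rw [← sq_abs]
        rcases le_total |u x| 1 with h | h
        · nlinarith [abs_nonneg (u x)]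
        · have := Real.rpow_le_rpow_of_exponent_le h hp.le
          rw [Real.rpow_two] at this
          linarith
    _ = volume.real Ω + ∫ x in Ω, |u x| ^ p := by
        rw [integral_add (integrable_const _) hi.integrableOn]; simp
    _ ≤ volume.real Ω + ∫ x, |u x| ^ p := by
        gcongr
        · exact ae_of_all _ fun x => by simp only [Pi.zero_apply]; positivity
        · exact Measure.restrict_le_self
    _ ≤ _ := by gcongr

/-- Compactness of the embedding of `X₀` into `L^p` below the critical exponent. -/
theorem exists_subseq_tendsto (hn : 0 < n) (hs : 0 < s) (hΩ : MeasurableSet Ω)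
    (hΩb : Bornology.IsBounded Ω) {p : ℝ} (hp : 2 < p) (hpσ : p < 2 + 2 * s * p / n)
    (hS : 0 < sobolevConst s Ω p) {U : ℕ → E n → ℝ} (hU : ∀ k, U k ∈ X₀ s Ω) {M : ℝ}
    (hF : ∀ k, form s Ω (U k) (U k) ≤ M) :
    ∃ ns : ℕ → ℕ, StrictMono ns ∧ ∃ u ∈ X₀ s Ω, ∃ a : ℝ,
      Tendsto (fun k => form s Ω (U (ns k)) (U (ns k))) atTop (𝓝 a) ∧ form s Ω u u ≤ a ∧
      Tendsto (fun k => ∫ x, |U (ns k) x - u x| ^ p) atTop (𝓝 0) ∧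
      ∀ᵐ x ∂(volume : Measure (E n)), Tendsto (fun k => U (ns k) x) atTop (𝓝 (u x)) := by
  have hM0 : 0 ≤ M := (form_self_nonneg hs _).trans (hF 0)
  obtain ⟨a, -, ns₁, hns₁, ha⟩ := isCompact_Icc.tendsto_subseq
    (fun k => (⟨form_self_nonneg hs (U k), hF k⟩ : form s Ω (U k) (U k) ∈ Icc 0 M))
  obtain ⟨C, hC⟩ := integral_sq_le_of_form_le hs hΩb hp hS M
  obtain ⟨ns₂, hns₂, hcau⟩ := exists_subseq_cauchy hs hΩ hΩb (fun k => hU (ns₁ k)) (M := max M C)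
    (fun k => (hC _ (hU _) (hF _)).trans (le_max_right _ _)) (fun k => (hF _).trans (le_max_left _ _))
  obtain ⟨ns₃, hns₃, u, hu, hua, hL2, hae⟩ := exists_limit hs hΩ (fun k => hU (ns₁ (ns₂ k)))
    (ha.comp hns₂.tendsto_atTop) hcau
  refine ⟨ns₁ ∘ ns₂ ∘ ns₃, hns₁.comp (hns₂.comp hns₃), u, hu, a,
    ha.comp (hns₂.comp hns₃).tendsto_atTop, hua, ?_, hae⟩
  set V : ℕ → E n → ℝ := fun k => U ((ns₁ ∘ ns₂ ∘ ns₃) k) with hV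
  set S := sobolevConst s Ω p
  have haM : a ≤ M := le_of_tendsto' ha fun k => hF _
  have hdX : ∀ k, V k - u ∈ X₀ s Ω := fun k => sub_mem_X₀ hΩ (hU _) hu
  -- The extra 1 keeps the resulting L^p bound strictly positive, as `higher_integrability`
  -- requires, even when M = 0.
  have hdF : ∀ k, form s Ω (V k - u) (V k - u) ≤ 4 * M + 1 := fun k => by
    have := form_sub_self_le hs hΩ (hU ((ns₁ ∘ ns₂ ∘ ns₃) k)) hu
    have := hF ((ns₁ ∘ ns₂ ∘ ns₃) k)
    simp only [hV]
    linarith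
  have hσ : ∀ k, Integrable (fun x => |(V k - u) x| ^ (2 + 2 * s * p / n)) ∧
      ∫ x, |(V k - u) x| ^ (2 + 2 * s * p / n) ≤ 4 / ballVol n *
        (2 ^ p * (((4 * M + 1) / S) ^ (p / 2)) / ballVol n) ^ (2 * s / n) * (4 * M + 1) := fun k => by
    obtain ⟨hi, hSu⟩ := sobolev hs (by linarith) hS (hdX k)
    have hI0 : 0 ≤ ∫ x, |(V k - u) x| ^ p := integral_nonneg fun x => by positivity
    have h1 : ∫ x, |(V k - u) x| ^ p ≤ ((4 * M + 1) / S) ^ (p / 2) := by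
      have h2 : (∫ x, |(V k - u) x| ^ p) ^ (2 / p) ≤ (4 * M + 1) / S := by
        rw [le_div_iff₀ hS]; linarith [hdF k]
      have h3 := Real.rpow_le_rpow (by positivity) h2 (show 0 ≤ p / 2 by linarith)
      rwa [← Real.rpow_mul hI0, show 2 / p * (p / 2) = 1 by field_simp, Real.rpow_one] at h3
    obtain ⟨h4, h5⟩ := higher_integrability hn hs hΩ (hdX k) (by linarith) hi (by positivity) h1
    have hω := ballVol_pos (n := n)
    exact ⟨h4, h5.trans (by gcongr; exact hdF k)⟩
  set K := 4 / ballVol n *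
        (2 ^ p * (((4 * M + 1) / S) ^ (p / 2)) / ballVol n) ^ (2 * s / n) * (4 * M + 1)
  have hK0 : 0 ≤ K := by have hω := ballVol_pos (n := n); positivity
  refine Metric.tendsto_atTop.2 fun ε hε => ?_
  -- Interpolation between the uniform bound K in the exponent 2 + 2sp/n > p and convergence in L²:
  -- δ makes the first part less than ε/2, and k large makes the second at most ε/2.
  set δ := ε / (2 * (K + 1)) with hδ
  have hδ0 : 0 < δ := by positivity
  set D := (1 / δ) ^ ((p - 2) / (2 + 2 * s * p / n - p))
  have hD0 : 0 ≤ D := by positivity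
  obtain ⟨N, hN⟩ := eventually_atTop.1 (hL2.eventually
    (gt_mem_nhds (show 0 < ε / (2 * (D + 1)) by positivity)))
  refine ⟨N, fun k hk => ?_⟩
  have hi := (sobolev hs (by linarith) hS (hdX k)).1
  have h2i := (memLp_two hΩ (hdX k)).integrable_sq
  have hle : ∫ x, |(V k - u) x| ^ p ≤ δ * (∫ x, |(V k - u) x| ^ (2 + 2 * s * p / n)) +
      D * ∫ x, (V k - u) x ^ 2 := by
    rw [← integral_const_mul, ← integral_const_mul,
      ← integral_add ((hσ k).1.const_mul _) (h2i.const_mul _)]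
    refine integral_mono hi (((hσ k).1.const_mul _).add (h2i.const_mul _)) fun x => ?_
    have := rpow_le_interpolate hp.le hpσ hδ0 (abs_nonneg ((V k - u) x))
    rwa [sq_abs] at this
  have h1 : δ * (∫ x, |(V k - u) x| ^ (2 + 2 * s * p / n)) ≤ δ * K := by
    gcongr; exact (hσ k).2
  have h2 : δ * K < ε / 2 := by
    rw [hδ, div_mul_eq_mul_div, div_lt_div_iff₀ (by positivity) (by positivity)]
    nlinarith
  have h3 : ∫ x, (V k - u) x ^ 2 < ε / (2 * (D + 1)) := hN k hk
  have h4 : D * ∫ x, (V k - u) x ^ 2 ≤ ε / 2 := by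
    calc D * ∫ x, (V k - u) x ^ 2 ≤ D * (ε / (2 * (D + 1))) := by gcongr
      _ ≤ ε / 2 := by
        rw [mul_div_assoc', div_le_div_iff₀ (by positivity) (by positivity)]
        nlinarith
  rw [Real.dist_eq, sub_zero, abs_of_nonneg (integral_nonneg fun x => by positivity)]
  have h5 : ∫ x, |(V k - u) x| ^ p < ε := by linarith
  exact h5

end Compactness

/-! ### Integral inequalities -/

section Integrals

open Filter Topology

variable {X : Type*} [MeasurableSpace X] {μ : Measure X}

theorem memLp_abs_rpow {u : X → ℝ} {p r : ℝ} (hp : 0 < p) (hr : 0 < r)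
    (hu : AEStronglyMeasurable u μ) (hi : Integrable (fun x => |u x| ^ p) μ) :
    MemLp (fun x => |u x| ^ r) (ENNReal.ofReal (p / r)) μ := by
  have hpr : 0 < p / r := div_pos hp hr
  have hm : AEStronglyMeasurable (fun x => |u x| ^ r) μ :=
    (hu.norm.aemeasurable.pow_const r).aestronglyMeasurable
  rw [← integrable_norm_rpow_iff hm (by simpa using hpr) ENNReal.ofReal_ne_top]
  refine hi.congr (ae_of_all _ fun x => ?_)
  simp only
  rw [ENNReal.toReal_ofReal hpr.le, Real.norm_of_nonneg (by positivity),
    ← Real.rpow_mul (abs_nonneg _), mul_div_cancel₀ _ hr.ne']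

theorem integral_rpow_rpow_div {u : X → ℝ} {p r : ℝ} (hr : 0 < r) :
    ∫ x, (|u x| ^ r) ^ (p / r) ∂μ = ∫ x, |u x| ^ p ∂μ := by
  congr 1
  ext x
  rw [← Real.rpow_mul (abs_nonneg _), mul_div_cancel₀ _ hr.ne']

theorem integral_abs_rpow_eq {F : X → ℝ} {Q : ℝ} (hQ : 0 < Q) (hF : MemLp F (ENNReal.ofReal Q) μ) :
    (∫ x, |F x| ^ Q ∂μ) ^ (1 / Q) = (eLpNorm F (ENNReal.ofReal Q) μ).toReal := by
  rw [hF.eLpNorm_eq_integral_rpow_norm (by simpa using hQ) ENNReal.ofReal_ne_top,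
    ENNReal.toReal_ofReal hQ.le, ENNReal.toReal_ofReal, one_div]
  · simp_rw [Real.norm_eq_abs]
  · exact Real.rpow_nonneg (integral_nonneg fun x => by positivity) _

theorem holder_weight {F u : X → ℝ} {p r Q : ℝ} (hp : 0 < p) (hr : 0 < r)
    (hQ : Real.HolderConjugate Q (p / r)) (hF : MemLp F (ENNReal.ofReal Q) μ)
    (hu : AEStronglyMeasurable u μ) (hi : Integrable (fun x => |u x| ^ p) μ) :
    Integrable (fun x => |F x| * |u x| ^ r) μ ∧ ∫ x, |F x| * |u x| ^ r ∂μ ≤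
      (eLpNorm F (ENNReal.ofReal Q) μ).toReal * (∫ x, |u x| ^ p ∂μ) ^ (r / p) := by
  have hur := memLp_abs_rpow hp hr hu hi
  have := hQ.ennrealOfReal
  refine ⟨hF.abs.integrable_mul hur, ?_⟩
  have h := integral_mul_le_Lp_mul_Lq_of_nonneg hQ (ae_of_all μ fun x => abs_nonneg (F x))
    (ae_of_all μ fun x => by simp only [Pi.zero_apply]; positivity) hF.abs hur
  rw [integral_rpow_rpow_div hr, integral_abs_rpow_eq hQ.pos hF, one_div_div] at h
  exact h

theorem holder_two {u w : X → ℝ} {α β : ℝ} (hα : 0 < α) (hβ : 0 < β)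
    (hu : AEStronglyMeasurable u μ) (hui : Integrable (fun x => |u x| ^ (α + β)) μ)
    (hw : AEStronglyMeasurable w μ) (hwi : Integrable (fun x => |w x| ^ (α + β)) μ) :
    Integrable (fun x => |u x| ^ α * |w x| ^ β) μ ∧ ∫ x, |u x| ^ α * |w x| ^ β ∂μ ≤
      (∫ x, |u x| ^ (α + β) ∂μ) ^ (α / (α + β)) * (∫ x, |w x| ^ (α + β) ∂μ) ^ (β / (α + β)) := by
  have hp : 0 < α + β := by positivity
  have hc : Real.HolderConjugate ((α + β) / α) ((α + β) / β) := by
    rw [Real.holderConjugate_iff]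
    refine ⟨by rw [lt_div_iff₀ hα]; linarith, ?_⟩
    field_simp
  have hur := memLp_abs_rpow hp hα hu hui
  have hwr := memLp_abs_rpow hp hβ hw hwi
  have := hc.ennrealOfReal
  refine ⟨hur.integrable_mul hwr, ?_⟩
  have h := integral_mul_le_Lp_mul_Lq_of_nonneg hc
    (ae_of_all μ fun x => by simp only [Pi.zero_apply]; positivity)
    (ae_of_all μ fun x => by simp only [Pi.zero_apply]; positivity) hur hwr
  rwa [integral_rpow_rpow_div hα, integral_rpow_rpow_div hβ, one_div_div, one_div_div] at h

theorem ae_abs_le_of_memLp_top {b : X → ℝ} (hb : MemLp b ⊤ μ) :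
    ∀ᵐ x ∂μ, |b x| ≤ (eLpNorm b ⊤ μ).toReal := by
  rw [eLpNorm_exponent_top]
  have hfin : eLpNormEssSup b μ ≠ ⊤ := by rw [← eLpNorm_exponent_top]; exact hb.2.ne
  filter_upwards [ae_le_eLpNormEssSup (f := b) (μ := μ)] with x hx
  have := ENNReal.toReal_mono hfin hx
  simpa using this

/-- Dominated convergence with a dominating function that is only close to an integrable one. -/
theorem tendsto_integral_of_le_add {G : ℕ → X → ℝ} {g h : X → ℝ} {d : ℕ → X → ℝ}
    (hG : ∀ k, Integrable (G k) μ) (hg : Integrable g μ) (hh : Integrable h μ)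
    (hh0 : ∀ x, 0 ≤ h x) (hd : ∀ k, Integrable (d k) μ)
    (hd0 : Tendsto (fun k => ∫ x, d k x ∂μ) atTop (𝓝 0))
    (hle : ∀ k, ∀ᵐ x ∂μ, |G k x - g x| ≤ h x + d k x) (hdn : ∀ k x, 0 ≤ d k x)
    (hlim : ∀ᵐ x ∂μ, Tendsto (fun k => G k x) atTop (𝓝 (g x))) :
    Tendsto (fun k => ∫ x, G k x ∂μ) atTop (𝓝 (∫ x, g x ∂μ)) := by
  have habs : ∀ k, Integrable (fun x => |G k x - g x|) μ := fun k => ((hG k).sub hg).abs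
  -- The part min(|G k − g|, h) has the fixed dominating function h; the remainder is at most d k,
  -- whose integral tends to 0.
  have hmin : ∀ k, Integrable (fun x => min |G k x - g x| (h x)) μ := fun k => (habs k).inf hh
  have h1 : Tendsto (fun k => ∫ x, min |G k x - g x| (h x) ∂μ) atTop (𝓝 0) := by
    have := tendsto_integral_of_dominated_convergence (μ := μ)
      (F := fun k x => min |G k x - g x| (h x)) (f := fun _ => (0 : ℝ)) h
      (fun k => (hmin k).1) hh (fun k => ae_of_all _ fun x => by
        rw [Real.norm_of_nonneg (le_min (abs_nonneg _) (hh0 x))]; exact min_le_right _ _) ?_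
    · simpa using this
    · filter_upwards [hlim] with x hx
      have h2 : Tendsto (fun k => |G k x - g x|) atTop (𝓝 0) := by
        simpa using (hx.sub_const (g x)).abs
      have h3 := h2.min (tendsto_const_nhds (x := h x))
      rwa [min_eq_left (hh0 x)] at h3
  rw [tendsto_iff_dist_tendsto_zero]
  refine squeeze_zero (fun _ => dist_nonneg) (fun k => ?_) (by simpa using h1.add hd0)
  rw [Real.dist_eq, ← integral_sub (hG k) hg, ← integral_add (hmin k) (hd k)]
  refine (abs_integral_le_integral_abs).trans
    (integral_mono_ae (habs k) ((hmin k).add (hd k)) ?_)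
  filter_upwards [hle k] with x hx
  rcases le_total |G k x - g x| (h x) with h2 | h2
  · rw [min_eq_left h2]; linarith [hdn k x]
  · rw [min_eq_right h2]; exact hx

/-- A power with exponent at most 1 is subadditive. Applied with r = 1 − q it makes the singular
integral continuous under L^p convergence. -/
theorem abs_posPart_rpow_sub_le {r : ℝ} (hr0 : 0 < r) (hr1 : r ≤ 1) (a c : ℝ) :
    |max a 0 ^ r - max c 0 ^ r| ≤ |a - c| ^ r := by
  have key : ∀ a c : ℝ, max a 0 ^ r ≤ max c 0 ^ r + |a - c| ^ r := fun a c => by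
    have h1 : max a 0 ≤ max c 0 + |a - c| := by
      refine max_le ?_ (by positivity)
      linarith [le_max_left c 0, le_abs_self (a - c)]
    exact (Real.rpow_le_rpow (le_max_right _ _) h1 hr0.le).trans
      (Real.rpow_add_le_add_rpow (le_max_right _ _) (abs_nonneg _) hr0.le hr1)
  rw [abs_le]
  constructor
  · have := key c a
    rw [abs_sub_comm] at this
    linarith
  · linarith [key a c]

theorem posPart_le_abs (a : ℝ) : max a 0 ≤ |a| := max_le (le_abs_self a) (abs_nonneg a)

theorem rpow_mul_rpow_le_add {a c α β : ℝ} (ha : 0 ≤ a) (hc : 0 ≤ c) (hα : 0 < α) (hβ : 0 < β) :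
    a ^ α * c ^ β ≤ a ^ (α + β) + c ^ (α + β) := by
  rcases le_total a c with h | h
  · calc a ^ α * c ^ β ≤ c ^ α * c ^ β := by gcongr
      _ = c ^ (α + β) := (Real.rpow_add_of_nonneg hc hα.le hβ.le).symm
      _ ≤ _ := le_add_of_nonneg_left (by positivity)
  · calc a ^ α * c ^ β ≤ a ^ α * a ^ β := by gcongr
      _ = a ^ (α + β) := (Real.rpow_add_of_nonneg ha hα.le hβ.le).symm
      _ ≤ _ := le_add_of_nonneg_right (by positivity)

theorem add_rpow_le {a c p : ℝ} (ha : 0 ≤ a) (hc : 0 ≤ c) (hp : 0 ≤ p) :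
    (a + c) ^ p ≤ 2 ^ p * (a ^ p + c ^ p) := by
  rcases le_total a c with h | h
  · calc (a + c) ^ p ≤ (2 * c) ^ p := by gcongr; linarith
      _ = 2 ^ p * c ^ p := Real.mul_rpow zero_le_two hc
      _ ≤ _ := by gcongr; exact le_add_of_nonneg_left (by positivity)
  · calc (a + c) ^ p ≤ (2 * a) ^ p := by gcongr; linarith
      _ = 2 ^ p * a ^ p := Real.mul_rpow zero_le_two ha
      _ ≤ _ := by gcongr; exact le_add_of_nonneg_right (by positivity)

/-- Two-term Hölder inequality for the singular terms. -/
theorem two_term_holder {q x y a c : ℝ} (hq0 : 0 < q) (hq1 : q < 1) (hx : 0 ≤ x) (hy : 0 ≤ y)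
    (ha : 0 ≤ a) (hc : 0 ≤ c) :
    x * a ^ ((1 - q) / 2) + y * c ^ ((1 - q) / 2) ≤
      (x ^ (2 / (1 + q)) + y ^ (2 / (1 + q))) ^ ((1 + q) / 2) * (a + c) ^ ((1 - q) / 2) := by
  have hq : 0 < 1 - q := by linarith
  -- These conjugate exponents turn the two weights into Λ; they account for the exponent 2/(1+q) in
  -- its definition.
  have hcj : Real.HolderConjugate (2 / (1 + q)) (2 / (1 - q)) := by
    rw [Real.holderConjugate_iff]
    refine ⟨by rw [lt_div_iff₀ (by positivity)]; linarith, ?_⟩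
    field_simp; ring
  have h := Real.inner_le_Lp_mul_Lq_of_nonneg (Finset.univ : Finset (Fin 2))
    (f := ![x, y]) (g := ![a ^ ((1 - q) / 2), c ^ ((1 - q) / 2)]) hcj
    (by intro i _; fin_cases i <;> simpa)
    (by intro i _; fin_cases i <;> simp <;> positivity)
  simp only [Fin.sum_univ_two, Matrix.cons_val_zero, Matrix.cons_val_one, one_div_div] at h
  rw [← Real.rpow_mul ha, ← Real.rpow_mul hc,
    show (1 - q) / 2 * (2 / (1 - q)) = 1 by field_simp, Real.rpow_one, Real.rpow_one] at h
  exact h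

end Integrals

/-! ### The energy and its fibering maps -/

section Energy

open Filter Topology

variable {n : ℕ} {s : ℝ} {Ω : Set (E n)} {α β q : ℝ} {f g b : E n → ℝ} {lam mu : ℝ}
  {u v w φ ψ : E n → ℝ} {z : (E n → ℝ) × (E n → ℝ)}

/-- The standing assumptions on the system. -/
structure Setting {n : ℕ} (s : ℝ) (Ω : Set (E n)) (α β q : ℝ) (f g b : E n → ℝ)
    (lam mu : ℝ) : Prop where
  hn : 0 < n
  hs0 : 0 < s
  hs1 : s < 1
  hΩ : IsOpen Ω
  hΩb : Bornology.IsBounded Ω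
  hq0 : 0 < q
  hq1 : q < 1
  hα : 1 < α
  hβ : 1 < β
  hp : 2 < α + β
  hσ : α + β < 2 + 2 * s * (α + β) / n
  hf : MemLp f (ENNReal.ofReal (qStar α β q)) (volume.restrict Ω)
  hf0 : ∀ᵐ x ∂(volume.restrict Ω), 0 < f x
  hg : MemLp g (ENNReal.ofReal (qStar α β q)) (volume.restrict Ω)
  hg0 : ∀ᵐ x ∂(volume.restrict Ω), 0 < g x
  hb : MemLp b ⊤ (volume.restrict Ω)
  hbpos : ¬ ((fun x => max (b x) 0) =ᵐ[volume.restrict Ω] 0)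
  hlam : 0 < lam
  hmu : 0 < mu
  hS : 0 < sobolevConst s Ω (α + β)

/-- The singular term of the energy. -/
def singF (Ω : Set (E n)) (q : ℝ) (f g : E n → ℝ) (lam mu : ℝ)
    (z : (E n → ℝ) × (E n → ℝ)) : ℝ :=
  ∫ x in Ω, (lam * f x * max (z.1 x) 0 ^ (1 - q) + mu * g x * max (z.2 x) 0 ^ (1 - q))

/-- The superlinear term of the energy. -/
def supB (Ω : Set (E n)) (α β : ℝ) (b : E n → ℝ) (z : (E n → ℝ) × (E n → ℝ)) : ℝ :=
  ∫ x in Ω, b x * (max (z.1 x) 0 ^ α * max (z.2 x) 0 ^ β)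

/-- The quadratic term of the energy. -/
def quadA (s : ℝ) (Ω : Set (E n)) (z : (E n → ℝ) × (E n → ℝ)) : ℝ :=
  form s Ω z.1 z.1 + form s Ω z.2 z.2

theorem quadA_nonneg (hs : 0 < s) (z : (E n → ℝ) × (E n → ℝ)) : 0 ≤ quadA s Ω z :=
  add_nonneg (form_self_nonneg hs _) (form_self_nonneg hs _)

namespace Setting

variable (H : Setting s Ω α β q f g b lam mu)
include H

theorem measurableSet : MeasurableSet Ω := H.hΩ.measurableSet

theorem p_pos : 0 < α + β := by linarith [H.hp]

theorem integrable_rpow (hu : u ∈ X₀ s Ω) : Integrable (fun x => |u x| ^ (α + β)) :=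
  (sobolev H.hs0 H.p_pos H.hS hu).1

omit H in
theorem _root_.FracSystem.aestronglyMeasurable_restrict (hu : u ∈ X₀ s Ω) : AEStronglyMeasurable u (volume.restrict Ω) :=
  hu.1.aestronglyMeasurable.restrict

theorem integral_rpow_le (hu : u ∈ X₀ s Ω) :
    ∫ x in Ω, |u x| ^ (α + β) ≤ (form s Ω u u / sobolevConst s Ω (α + β)) ^ ((α + β) / 2) := by
  have hp := H.p_pos
  obtain ⟨hi, h⟩ := sobolev H.hs0 hp H.hS hu
  have hI0 : 0 ≤ ∫ x, |u x| ^ (α + β) := integral_nonneg fun x => by positivity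
  have h2 : (∫ x, |u x| ^ (α + β)) ^ (2 / (α + β)) ≤ form s Ω u u / sobolevConst s Ω (α + β) := by
    rw [le_div_iff₀ H.hS]; linarith
  have h3 := Real.rpow_le_rpow (by positivity) h2 (show 0 ≤ (α + β) / 2 by linarith)
  rw [← Real.rpow_mul hI0, show 2 / (α + β) * ((α + β) / 2) = 1 by field_simp,
    Real.rpow_one] at h3
  refine le_trans ?_ h3
  exact setIntegral_le_integral hi (ae_of_all _ fun x => by simp only [Pi.zero_apply]; positivity)

theorem holderConj : Real.HolderConjugate (qStar α β q) ((α + β) / (1 - q)) := by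
  have := H.hp; have := H.hq0; have := H.hq1
  have h1 : 0 < α + β - 1 + q := by linarith
  have h2 : 0 < 1 - q := by linarith
  have h3 := H.p_pos
  rw [Real.holderConjugate_iff, qStar]
  refine ⟨by rw [lt_div_iff₀ h1]; linarith, ?_⟩
  field_simp; ring

theorem integrable_weight {F : E n → ℝ}
    (hF : MemLp F (ENNReal.ofReal (qStar α β q)) (volume.restrict Ω)) (hu : u ∈ X₀ s Ω) :
    IntegrableOn (fun x => |F x| * |u x| ^ (1 - q)) Ω :=
  (holder_weight H.p_pos (by linarith [H.hq1]) H.holderConj hF (aestronglyMeasurable_restrict hu)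
    (H.integrable_rpow hu).integrableOn).1

theorem integral_weight_le {F : E n → ℝ}
    (hF : MemLp F (ENNReal.ofReal (qStar α β q)) (volume.restrict Ω)) (hu : u ∈ X₀ s Ω) :
    ∫ x in Ω, |F x| * |u x| ^ (1 - q) ≤ normLp Ω (ENNReal.ofReal (qStar α β q)) F *
      (∫ x in Ω, |u x| ^ (α + β)) ^ ((1 - q) / (α + β)) :=
  (holder_weight H.p_pos (by linarith [H.hq1]) H.holderConj hF (aestronglyMeasurable_restrict hu)
    (H.integrable_rpow hu).integrableOn).2

theorem integrable_sing {F : E n → ℝ} (c : ℝ)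
    (hF : MemLp F (ENNReal.ofReal (qStar α β q)) (volume.restrict Ω)) (hu : u ∈ X₀ s Ω) :
    IntegrableOn (fun x => c * F x * max (u x) 0 ^ (1 - q)) Ω := by
  have hq : 0 < 1 - q := by linarith [H.hq1]
  have hm : AEStronglyMeasurable (fun x => max (u x) 0 ^ (1 - q)) (volume.restrict Ω) :=
    (((hu.1.max aemeasurable_const).pow_const _).aestronglyMeasurable).restrict
  refine ((H.integrable_weight hF hu).const_mul |c|).mono' ((hF.1.const_mul c).mul hm)
    (ae_of_all _ fun x => ?_)
  rw [norm_mul, norm_mul, Real.norm_eq_abs, Real.norm_eq_abs, mul_assoc,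
    Real.norm_of_nonneg (Real.rpow_nonneg (le_max_right _ _) _)]
  gcongr
  exact posPart_le_abs _

theorem integral_sing_le {F : E n → ℝ} {c : ℝ} (hc : 0 ≤ c)
    (hF : MemLp F (ENNReal.ofReal (qStar α β q)) (volume.restrict Ω)) (hu : u ∈ X₀ s Ω) :
    ∫ x in Ω, c * F x * max (u x) 0 ^ (1 - q) ≤
      c * normLp Ω (ENNReal.ofReal (qStar α β q)) F *
        (form s Ω u u / sobolevConst s Ω (α + β)) ^ ((1 - q) / 2) := by
  have hq : 0 < 1 - q := by linarith [H.hq1]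
  have hp := H.p_pos
  have hfs := form_self_nonneg H.hs0 (Ω := Ω) u
  have hS := H.hS
  calc ∫ x in Ω, c * F x * max (u x) 0 ^ (1 - q)
      ≤ ∫ x in Ω, c * (|F x| * |u x| ^ (1 - q)) := by
        refine integral_mono (H.integrable_sing c hF hu)
          ((H.integrable_weight hF hu).const_mul c) fun x => ?_
        simp only [mul_assoc]
        have := Real.rpow_nonneg (le_max_right (u x) 0) (1 - q)
        gcongr
        · exact le_abs_self _
        · exact posPart_le_abs _
    _ = c * ∫ x in Ω, |F x| * |u x| ^ (1 - q) := integral_const_mul _ _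
    _ ≤ c * (normLp Ω (ENNReal.ofReal (qStar α β q)) F *
        (∫ x in Ω, |u x| ^ (α + β)) ^ ((1 - q) / (α + β))) := by
        gcongr; exact H.integral_weight_le hF hu
    _ ≤ c * (normLp Ω (ENNReal.ofReal (qStar α β q)) F *
        ((form s Ω u u / sobolevConst s Ω (α + β)) ^ ((α + β) / 2)) ^ ((1 - q) / (α + β))) := by
        have := H.integral_rpow_le hu
        have h0 : 0 ≤ ∫ x in Ω, |u x| ^ (α + β) := integral_nonneg fun x => by positivity
        have h1 : 0 ≤ normLp Ω (ENNReal.ofReal (qStar α β q)) F := ENNReal.toReal_nonneg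
        gcongr
    _ = _ := by
        rw [← Real.rpow_mul (by positivity), mul_assoc,
          show (α + β) / 2 * ((1 - q) / (α + β)) = (1 - q) / 2 by field_simp]

theorem singF_eq (hz : z ∈ Y s Ω) : singF Ω q f g lam mu z =
    (∫ x in Ω, lam * f x * max (z.1 x) 0 ^ (1 - q)) +
      ∫ x in Ω, mu * g x * max (z.2 x) 0 ^ (1 - q) :=
  integral_add (H.integrable_sing lam H.hf hz.1) (H.integrable_sing mu H.hg hz.2)

theorem singF_nonneg (z : (E n → ℝ) × (E n → ℝ)) : 0 ≤ singF Ω q f g lam mu z := by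
  refine integral_nonneg_of_ae ?_
  filter_upwards [H.hf0, H.hg0] with x h1 h2
  have := H.hlam; have := H.hmu
  have := Real.rpow_nonneg (le_max_right (z.1 x) 0) (1 - q)
  have := Real.rpow_nonneg (le_max_right (z.2 x) 0) (1 - q)
  simp only [Pi.zero_apply]
  positivity

/-- Hölder in each component, the Sobolev inequality, then the two-term Hölder inequality. The
constant here and the one in `supB_le` are those for which `exists_separating_level` provides ρ. -/
theorem singF_le (hz : z ∈ Y s Ω) : singF Ω q f g lam mu z ≤
    sobolevConst s Ω (α + β) ^ (-((1 - q) / 2)) *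
      bigLambda Ω α β q f g lam mu ^ ((1 + q) / 2) * quadA s Ω z ^ ((1 - q) / 2) := by
  have h1 := H.integral_sing_le H.hlam.le H.hf hz.1
  have h2 := H.integral_sing_le H.hmu.le H.hg hz.2
  have hA1 := form_self_nonneg H.hs0 (Ω := Ω) z.1
  have hA2 := form_self_nonneg H.hs0 (Ω := Ω) z.2
  have hS := H.hS
  have hx : 0 ≤ lam * normLp Ω (ENNReal.ofReal (qStar α β q)) f :=
    mul_nonneg H.hlam.le ENNReal.toReal_nonneg
  have hy : 0 ≤ mu * normLp Ω (ENNReal.ofReal (qStar α β q)) g :=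
    mul_nonneg H.hmu.le ENNReal.toReal_nonneg
  have h3 := two_term_holder H.hq0 H.hq1 hx hy hA1 hA2
  rw [H.singF_eq hz, bigLambda, abs_of_pos H.hlam, abs_of_pos H.hmu, quadA]
  rw [Real.div_rpow hA1 hS.le, div_eq_mul_inv, ← Real.rpow_neg hS.le] at h1
  rw [Real.div_rpow hA2 hS.le, div_eq_mul_inv, ← Real.rpow_neg hS.le] at h2
  have hSp : 0 < sobolevConst s Ω (α + β) ^ (-((1 - q) / 2)) := by positivity
  nlinarith [mul_le_mul_of_nonneg_left h3 hSp.le]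

theorem abs_super_le (z : (E n → ℝ) × (E n → ℝ)) : ∀ᵐ x ∂(volume.restrict Ω),
    |b x * (max (z.1 x) 0 ^ α * max (z.2 x) 0 ^ β)| ≤
      normLp Ω ⊤ b * (|z.1 x| ^ α * |z.2 x| ^ β) := by
  have := H.hα; have := H.hβ
  filter_upwards [ae_abs_le_of_memLp_top H.hb] with x hx
  have h1 := Real.rpow_nonneg (le_max_right (z.1 x) 0) α
  have h2 := Real.rpow_nonneg (le_max_right (z.2 x) 0) β
  rw [abs_mul, abs_of_nonneg (mul_nonneg h1 h2)]
  have h3 : max (z.1 x) 0 ^ α ≤ |z.1 x| ^ α := by gcongr; exact posPart_le_abs _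
  have h4 : max (z.2 x) 0 ^ β ≤ |z.2 x| ^ β := by gcongr; exact posPart_le_abs _
  have h5 : 0 ≤ normLp Ω ⊤ b := ENNReal.toReal_nonneg
  exact mul_le_mul hx (mul_le_mul h3 h4 h2 (by positivity)) (mul_nonneg h1 h2) h5

theorem holder_pair (hz : z ∈ Y s Ω) :
    IntegrableOn (fun x => |z.1 x| ^ α * |z.2 x| ^ β) Ω ∧
      ∫ x in Ω, |z.1 x| ^ α * |z.2 x| ^ β ≤
        (∫ x in Ω, |z.1 x| ^ (α + β)) ^ (α / (α + β)) *
          (∫ x in Ω, |z.2 x| ^ (α + β)) ^ (β / (α + β)) :=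
  holder_two (by linarith [H.hα]) (by linarith [H.hβ]) (aestronglyMeasurable_restrict hz.1)
    (H.integrable_rpow hz.1).integrableOn (aestronglyMeasurable_restrict hz.2) (H.integrable_rpow hz.2).integrableOn

theorem integrable_super (hz : z ∈ Y s Ω) :
    IntegrableOn (fun x => b x * (max (z.1 x) 0 ^ α * max (z.2 x) 0 ^ β)) Ω := by
  refine ((H.holder_pair hz).1.const_mul (normLp Ω ⊤ b)).mono' (H.hb.1.mul ?_) (H.abs_super_le z)
  have h1 := (hz.1.1.max aemeasurable_const).pow_const (c := α) (f := fun x => max (z.1 x) 0)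
  have h2 := (hz.2.1.max aemeasurable_const).pow_const (c := β) (f := fun x => max (z.2 x) 0)
  exact (h1.mul h2).aestronglyMeasurable.restrict

/-- Hölder with exponents p/α and p/β, the Sobolev inequality in each factor, and the energy of each
component estimated by the total energy. -/
theorem supB_le (hz : z ∈ Y s Ω) : supB Ω α β b z ≤
    normLp Ω ⊤ b * sobolevConst s Ω (α + β) ^ (-((α + β) / 2)) * quadA s Ω z ^ ((α + β) / 2) := by
  have hp := H.p_pos
  have hα : 0 < α := by linarith [H.hα]
  have hβ : 0 < β := by linarith [H.hβ]
  have hA1 := form_self_nonneg H.hs0 (Ω := Ω) z.1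
  have hA2 := form_self_nonneg H.hs0 (Ω := Ω) z.2
  have hA := quadA_nonneg H.hs0 (Ω := Ω) z
  have hS := H.hS
  have hb0 : 0 ≤ normLp Ω ⊤ b := ENNReal.toReal_nonneg
  set S := sobolevConst s Ω (α + β)
  have hpart : ∀ (v : E n → ℝ) (hv : v ∈ X₀ s Ω) (hvA : form s Ω v v ≤ quadA s Ω z) (r : ℝ),
      0 < r → (∫ x in Ω, |v x| ^ (α + β)) ^ (r / (α + β)) ≤ (quadA s Ω z / S) ^ (r / 2) := by
    intro v hv hvA r hr
    have hI0 : 0 ≤ ∫ x in Ω, |v x| ^ (α + β) := integral_nonneg fun x => by positivity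
    have hv0 := form_self_nonneg H.hs0 (Ω := Ω) v
    calc (∫ x in Ω, |v x| ^ (α + β)) ^ (r / (α + β))
        ≤ ((form s Ω v v / S) ^ ((α + β) / 2)) ^ (r / (α + β)) := by
          gcongr; exact H.integral_rpow_le hv
      _ = (form s Ω v v / S) ^ (r / 2) := by
          rw [← Real.rpow_mul (by positivity)]; congr 1; field_simp
      _ ≤ _ := by gcongr
  have h1 := hpart z.1 hz.1 (by unfold quadA; linarith) α hα
  have h2 := hpart z.2 hz.2 (by unfold quadA; linarith) β hβ
  have h3 : 0 ≤ (∫ x in Ω, |z.2 x| ^ (α + β)) ^ (β / (α + β)) :=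
    Real.rpow_nonneg (integral_nonneg fun x => by positivity) _
  calc supB Ω α β b z ≤ ∫ x in Ω, normLp Ω ⊤ b * (|z.1 x| ^ α * |z.2 x| ^ β) := by
        refine integral_mono_ae (H.integrable_super hz) ((H.holder_pair hz).1.const_mul _) ?_
        filter_upwards [H.abs_super_le z] with x hx
        exact (le_abs_self _).trans hx
    _ = normLp Ω ⊤ b * ∫ x in Ω, (|z.1 x| ^ α * |z.2 x| ^ β) := integral_const_mul _ _
    _ ≤ normLp Ω ⊤ b * ((quadA s Ω z / S) ^ (α / 2) * (quadA s Ω z / S) ^ (β / 2)) := by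
        gcongr
        exact (H.holder_pair hz).2.trans (mul_le_mul h1 h2 h3 (by positivity))
    _ = _ := by
        rw [← Real.rpow_add_of_nonneg (by positivity) (by positivity) (by positivity),
          Real.div_rpow hA hS.le, Real.rpow_neg hS.le]
        rw [show α / 2 + β / 2 = (α + β) / 2 by ring]
        ring

/-! ### Homogeneity of the three terms and the Nehari conditions expressed through them. -/

theorem smul_mem_Y (t : ℝ) (hz : z ∈ Y s Ω) : t • z ∈ Y s Ω :=
  ⟨smul_mem_X₀ H.measurableSet t hz.1, smul_mem_X₀ H.measurableSet t hz.2⟩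

omit H in
theorem _root_.FracSystem.posPart_smul_rpow {t : ℝ} (ht : 0 < t) (a r : ℝ) :
    max (t * a) 0 ^ r = t ^ r * max a 0 ^ r := by
  rw [← Real.mul_rpow ht.le (le_max_right _ _), mul_max_of_nonneg _ _ ht.le, mul_zero]

omit H in
theorem _root_.FracSystem.singF_smul {t : ℝ} (ht : 0 < t) :
    singF Ω q f g lam mu (t • z) = t ^ (1 - q) * singF Ω q f g lam mu z := by
  unfold singF
  rw [← integral_const_mul]
  congr 1; ext x
  simp only [Prod.smul_fst, Prod.smul_snd, Pi.smul_apply, smul_eq_mul, posPart_smul_rpow ht]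
  ring

omit H in
theorem _root_.FracSystem.supB_smul {t : ℝ} (ht : 0 < t) :
    supB Ω α β b (t • z) = t ^ (α + β) * supB Ω α β b z := by
  unfold supB
  rw [← integral_const_mul]
  congr 1; ext x
  simp only [Prod.smul_fst, Prod.smul_snd, Pi.smul_apply, smul_eq_mul, posPart_smul_rpow ht,
    Real.rpow_add ht]
  ring

theorem quadA_smul (t : ℝ) (z : (E n → ℝ) × (E n → ℝ)) :
    quadA s Ω (t • z) = t ^ 2 * quadA s Ω z := by
  simp only [quadA, Prod.smul_fst, Prod.smul_snd, form_smul_left H.hs0, form_smul_right H.hs0]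
  ring

theorem energy_eq (z : (E n → ℝ) × (E n → ℝ)) : energy s Ω α β q f g b lam mu z =
    quadA s Ω z / 2 - singF Ω q f g lam mu z / (1 - q) - supB Ω α β b z / (α + β) := by
  unfold energy singF supB
  rw [normY_sq H.hs0, quadA]
  ring

theorem fiber_eq {t : ℝ} (ht : 0 < t) : fiber s Ω α β q f g b lam mu z t =
    scalarFiber q (α + β) (quadA s Ω z) (singF Ω q f g lam mu z) (supB Ω α β b z) t := by
  rw [fiber, H.energy_eq, H.quadA_smul, singF_smul ht, supB_smul ht]
  rfl

/-- The scaling laws are available only for t > 0, so derivatives are taken through equality near a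
positive point. -/
theorem fiber_eventuallyEq {t : ℝ} (ht : 0 < t) : fiber s Ω α β q f g b lam mu z =ᶠ[𝓝 t]
    scalarFiber q (α + β) (quadA s Ω z) (singF Ω q f g lam mu z) (supB Ω α β b z) := by
  filter_upwards [lt_mem_nhds ht] with t ht
  exact H.fiber_eq ht

theorem deriv_fiber {t : ℝ} (ht : 0 < t) : deriv (fiber s Ω α β q f g b lam mu z) t =
    t * quadA s Ω z - t ^ (-q) * singF Ω q f g lam mu z -
      t ^ (α + β - 1) * supB Ω α β b z := by
  rw [(H.fiber_eventuallyEq ht).deriv_eq, (hasDerivAt_scalarFiber H.hq1 H.hp ht).deriv]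

theorem mem_nehari_iff : z ∈ nehari s Ω α β q f g b lam mu ↔
    z ∈ Y s Ω ∧ quadA s Ω z = singF Ω q f g lam mu z + supB Ω α β b z := by
  unfold nehari
  rw [mem_ofPred_eq, H.deriv_fiber one_pos]
  simp only [one_mul, Real.one_rpow]
  refine and_congr_right fun _ => ⟨fun h => by linarith, fun h => by linarith⟩

theorem deriv_deriv_fiber : deriv (deriv (fiber s Ω α β q f g b lam mu z)) 1 =
    quadA s Ω z + q * singF Ω q f g lam mu z - (α + β - 1) * supB Ω α β b z := by
  have h : deriv (fiber s Ω α β q f g b lam mu z) =ᶠ[𝓝 1] fun t =>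
      t * quadA s Ω z - t ^ (-q) * singF Ω q f g lam mu z -
        t ^ (α + β - 1) * supB Ω α β b z := by
    filter_upwards [lt_mem_nhds (one_pos (α := ℝ))] with t ht
    exact H.deriv_fiber ht
  rw [h.deriv_eq, hasDerivAt_scalarFiber_deriv.deriv]

omit H in
theorem _root_.FracSystem.scalarDefect_smul_iff {q p A F B t : ℝ} :
    scalarDefect q p A F B t = 0 ↔ t ^ 2 * A = t ^ (1 - q) * F + t ^ p * B := by
  unfold scalarDefect
  constructor <;> intro h <;> linarith

end Setting

end Energy

/-! ### Continuity and directional derivatives -/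

section Continuity

open Filter Topology

variable {n : ℕ} {s : ℝ} {Ω : Set (E n)} {α β q : ℝ} {f g b : E n → ℝ} {lam mu : ℝ}
  {u v w φ ψ : E n → ℝ} {z : (E n → ℝ) × (E n → ℝ)}

/-- A mixed product of total degree `α + β` is dominated by a power of a common bound. -/
theorem rpow_mul_rpow_mul_le {a c d m α β : ℝ} (hα : 1 ≤ α) (hβ : 0 ≤ β) (ha : 0 ≤ a) (hc : 0 ≤ c)
    (hd : 0 ≤ d) (ham : a ≤ m) (hcm : c ≤ m) (hdm : d ≤ m) :
    a ^ (α - 1) * c ^ β * d ≤ m ^ (α + β) := by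
  have hm : 0 ≤ m := ha.trans ham
  calc a ^ (α - 1) * c ^ β * d ≤ m ^ (α - 1) * m ^ β * m := by
        have : 0 ≤ α - 1 := by linarith
        gcongr
    _ = m ^ (α + β) := by
      rcases hm.eq_or_lt with rfl | hm
      · rw [mul_zero, Real.zero_rpow (by linarith)]
      · rw [← Real.rpow_add hm, ← Real.rpow_add_one hm.ne']; congr 1; ring

namespace Setting

variable (H : Setting s Ω α β q f g b lam mu)
include H

theorem tendsto_sing {F : E n → ℝ} (c : ℝ)
    (hF : MemLp F (ENNReal.ofReal (qStar α β q)) (volume.restrict Ω)) {U : ℕ → E n → ℝ}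
    (hU : ∀ k, U k ∈ X₀ s Ω) (hu : u ∈ X₀ s Ω)
    (hlim : Tendsto (fun k => ∫ x, |U k x - u x| ^ (α + β)) atTop (𝓝 0)) :
    Tendsto (fun k => ∫ x in Ω, c * F x * max (U k x) 0 ^ (1 - q)) atTop
      (𝓝 (∫ x in Ω, c * F x * max (u x) 0 ^ (1 - q))) := by
  have hq : 0 < 1 - q := by linarith [H.hq1]
  have hp := H.p_pos
  rw [tendsto_iff_dist_tendsto_zero]
  have h1 : Tendsto (fun k => |c| * (normLp Ω (ENNReal.ofReal (qStar α β q)) F *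
      (∫ x, |U k x - u x| ^ (α + β)) ^ ((1 - q) / (α + β)))) atTop (𝓝 0) := by
    have := ((hlim.rpow_const (p := (1 - q) / (α + β))
      (Or.inr (by positivity))).const_mul (normLp Ω (ENNReal.ofReal (qStar α β q)) F)).const_mul |c|
    rwa [Real.zero_rpow (by positivity), mul_zero, mul_zero] at this
  refine squeeze_zero (fun _ => dist_nonneg) (fun k => ?_) h1
  have hd := sub_mem_X₀ H.measurableSet (hU k) hu
  rw [Real.dist_eq, ← integral_sub (H.integrable_sing c hF (hU k)) (H.integrable_sing c hF hu)]
  calc |∫ x in Ω, (c * F x * max (U k x) 0 ^ (1 - q) - c * F x * max (u x) 0 ^ (1 - q))|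
      ≤ ∫ x in Ω, |c * F x * max (U k x) 0 ^ (1 - q) - c * F x * max (u x) 0 ^ (1 - q)| :=
        abs_integral_le_integral_abs
    _ ≤ ∫ x in Ω, |c| * (|F x| * |(U k - u) x| ^ (1 - q)) := by
        refine integral_mono
          ((H.integrable_sing c hF (hU k)).sub (H.integrable_sing c hF hu)).abs
          ((H.integrable_weight hF hd).const_mul |c|) fun x => ?_
        simp only
        rw [← mul_sub, abs_mul, abs_mul, mul_assoc]
        gcongr
        exact abs_posPart_rpow_sub_le hq (by linarith [H.hq0]) _ _
    _ = |c| * ∫ x in Ω, |F x| * |(U k - u) x| ^ (1 - q) := integral_const_mul _ _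
    _ ≤ |c| * (normLp Ω (ENNReal.ofReal (qStar α β q)) F *
        (∫ x in Ω, |(U k - u) x| ^ (α + β)) ^ ((1 - q) / (α + β))) := by
        gcongr; exact H.integral_weight_le hF hd
    _ ≤ _ := by
        have h0 : 0 ≤ ∫ x in Ω, |(U k - u) x| ^ (α + β) := integral_nonneg fun x => by positivity
        have h1 : 0 ≤ normLp Ω (ENNReal.ofReal (qStar α β q)) F := ENNReal.toReal_nonneg
        have h2 : ∫ x in Ω, |(U k - u) x| ^ (α + β) ≤ ∫ x, |U k x - u x| ^ (α + β) :=
          setIntegral_le_integral (H.integrable_rpow hd)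
            (ae_of_all _ fun x => by simp only [Pi.zero_apply]; positivity)
        gcongr

theorem tendsto_singF {Z : ℕ → (E n → ℝ) × (E n → ℝ)} (hZ : ∀ k, Z k ∈ Y s Ω) (hz : z ∈ Y s Ω)
    (h1 : Tendsto (fun k => ∫ x, |(Z k).1 x - z.1 x| ^ (α + β)) atTop (𝓝 0))
    (h2 : Tendsto (fun k => ∫ x, |(Z k).2 x - z.2 x| ^ (α + β)) atTop (𝓝 0)) :
    Tendsto (fun k => singF Ω q f g lam mu (Z k)) atTop (𝓝 (singF Ω q f g lam mu z)) := by
  simp_rw [fun k => H.singF_eq (hZ k), H.singF_eq hz]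
  exact (H.tendsto_sing lam H.hf (fun k => (hZ k).1) hz.1 h1).add
    (H.tendsto_sing mu H.hg (fun k => (hZ k).2) hz.2 h2)

/-- No single function is at hand to dominate the sequence. The inequality |a|^p ≤ 2^p(|a − c|^p +
|c|^p) gives a fixed integrable bound plus a term whose integral tends to 0, which is the setting of
`tendsto_integral_of_le_add`. -/
theorem tendsto_supB {Z : ℕ → (E n → ℝ) × (E n → ℝ)} (hZ : ∀ k, Z k ∈ Y s Ω) (hz : z ∈ Y s Ω)
    (h1 : Tendsto (fun k => ∫ x, |(Z k).1 x - z.1 x| ^ (α + β)) atTop (𝓝 0))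
    (h2 : Tendsto (fun k => ∫ x, |(Z k).2 x - z.2 x| ^ (α + β)) atTop (𝓝 0))
    (h3 : ∀ᵐ x ∂(volume : Measure (E n)), Tendsto (fun k => (Z k).1 x) atTop (𝓝 (z.1 x)))
    (h4 : ∀ᵐ x ∂(volume : Measure (E n)), Tendsto (fun k => (Z k).2 x) atTop (𝓝 (z.2 x))) :
    Tendsto (fun k => supB Ω α β b (Z k)) atTop (𝓝 (supB Ω α β b z)) := by
  have hα : 0 < α := by linarith [H.hα]
  have hβ : 0 < β := by linarith [H.hβ]
  have hp := H.p_pos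
  set N := normLp Ω ⊤ b
  have hN : 0 ≤ N := ENNReal.toReal_nonneg
  have hi1 := (H.integrable_rpow hz.1).integrableOn (s := Ω)
  have hi2 := (H.integrable_rpow hz.2).integrableOn (s := Ω)
  have hd1 := fun k => (H.integrable_rpow (sub_mem_X₀ H.measurableSet (hZ k).1 hz.1))
  have hd2 := fun k => (H.integrable_rpow (sub_mem_X₀ H.measurableSet (hZ k).2 hz.2))
  refine tendsto_integral_of_le_add
    (h := fun x => N * (2 ^ (α + β) + 1) * (|z.1 x| ^ (α + β) + |z.2 x| ^ (α + β)))
    (d := fun k x => N * 2 ^ (α + β) *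
      (|((Z k).1 - z.1) x| ^ (α + β) + |((Z k).2 - z.2) x| ^ (α + β)))
    (fun k => H.integrable_super (hZ k)) (H.integrable_super hz)
    ((hi1.add hi2).const_mul _) (fun x => by positivity)
    (fun k => ((hd1 k).integrableOn.add (hd2 k).integrableOn).const_mul _) ?_ (fun k => ?_)
    (fun k x => by positivity) ?_
  · have h5 := (h1.add h2).const_mul (N * 2 ^ (α + β))
    rw [add_zero, mul_zero] at h5
    refine squeeze_zero (fun k => integral_nonneg fun x => by positivity) (fun k => ?_) h5
    rw [integral_const_mul]
    refine mul_le_mul_of_nonneg_left ?_ (by positivity)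
    exact (setIntegral_le_integral ((hd1 k).add (hd2 k))
      (ae_of_all _ fun x => by simp only [Pi.zero_apply, Pi.add_apply]; positivity)).trans
      (integral_add (hd1 k) (hd2 k)).le
  · filter_upwards [H.abs_super_le (Z k), H.abs_super_le z] with x hx1 hx2
    have e : ∀ a c : ℝ, |a| ^ (α + β) ≤ 2 ^ (α + β) * (|a - c| ^ (α + β) + |c| ^ (α + β)) :=
      fun a c => by
      refine le_trans ?_ (add_rpow_le (abs_nonneg (a - c)) (abs_nonneg c) hp.le)
      gcongr
      have := abs_add_le (a - c) c
      simpa using this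
    have e1 := e ((Z k).1 x) (z.1 x)
    have e2 := e ((Z k).2 x) (z.2 x)
    have e3 := rpow_mul_rpow_le_add (abs_nonneg ((Z k).1 x)) (abs_nonneg ((Z k).2 x)) hα hβ
    have e4 := rpow_mul_rpow_le_add (abs_nonneg (z.1 x)) (abs_nonneg (z.2 x)) hα hβ
    simp only [Pi.sub_apply]
    refine (abs_sub _ _).trans ?_
    have e5 := mul_le_mul_of_nonneg_left (e3.trans (add_le_add e1 e2)) hN
    have e6 := mul_le_mul_of_nonneg_left e4 hN
    linarith
  · filter_upwards [ae_restrict_of_ae h3, ae_restrict_of_ae h4] with x hx1 hx2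
    have e1 := ((hx1.max (tendsto_const_nhds (x := (0 : ℝ)))).rpow_const (p := α) (Or.inr hα.le))
    have e2 := ((hx2.max (tendsto_const_nhds (x := (0 : ℝ)))).rpow_const (p := β) (Or.inr hβ.le))
    exact (e1.mul e2).const_mul _

/-- Integrability of the superlinear terms against test functions. -/
theorem integrable_super_test (hz : z ∈ Y s Ω) (hz1 : ∀ x, 0 ≤ z.1 x) (hz2 : ∀ x, 0 ≤ z.2 x)
    (hφ : φ ∈ X₀ s Ω) :
    IntegrableOn (fun x => b x * (z.1 x ^ (α - 1) * z.2 x ^ β * φ x)) Ω ∧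
      IntegrableOn (fun x => b x * (z.1 x ^ α * z.2 x ^ (β - 1) * φ x)) Ω := by
  have hα := H.hα
  have hβ := H.hβ
  have hm : (z.1 + z.2) + (fun x => |φ x|) ∈ X₀ s Ω :=
    add_mem_X₀ H.measurableSet (add_mem_X₀ H.measurableSet hz.1 hz.2) (abs_mem_X₀ H.measurableSet hφ)
  have hi := (H.integrable_rpow hm).integrableOn (s := Ω) |>.const_mul (normLp Ω ⊤ b)
  have hN : 0 ≤ normLp Ω ⊤ b := ENNReal.toReal_nonneg
  have hz1m : AEMeasurable z.1 volume := hz.1.1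
  have hz2m : AEMeasurable z.2 volume := hz.2.1
  constructor
  · refine hi.mono' (H.hb.1.mul (((hz1m.pow_const _).mul (hz2m.pow_const _)).mul
      hφ.1).aestronglyMeasurable.restrict) ?_
    filter_upwards [ae_abs_le_of_memLp_top H.hb] with x hx
    have h1 := Real.rpow_nonneg (hz1 x) (α - 1)
    have h2 := Real.rpow_nonneg (hz2 x) β
    rw [Real.norm_eq_abs, abs_mul, abs_mul, abs_of_nonneg (mul_nonneg h1 h2)]
    refine mul_le_mul hx ?_ (by positivity) hN
    simp only [Pi.add_apply]
    rw [abs_of_nonneg (a := z.1 x + z.2 x + |φ x|)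
      (by linarith [hz1 x, hz2 x, abs_nonneg (φ x)])]
    exact rpow_mul_rpow_mul_le hα.le (by linarith) (hz1 x) (hz2 x) (abs_nonneg _)
      (by linarith [hz2 x, abs_nonneg (φ x)]) (by linarith [hz1 x, abs_nonneg (φ x)])
      (by linarith [hz1 x, hz2 x])
  · refine hi.mono' (H.hb.1.mul (((hz1m.pow_const _).mul (hz2m.pow_const _)).mul
      hφ.1).aestronglyMeasurable.restrict) ?_
    filter_upwards [ae_abs_le_of_memLp_top H.hb] with x hx
    have h1 := Real.rpow_nonneg (hz1 x) α
    have h2 := Real.rpow_nonneg (hz2 x) (β - 1)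
    rw [Real.norm_eq_abs, abs_mul, abs_mul, abs_of_nonneg (mul_nonneg h1 h2)]
    refine mul_le_mul hx ?_ (by positivity) hN
    simp only [Pi.add_apply]
    rw [abs_of_nonneg (a := z.1 x + z.2 x + |φ x|)
      (by linarith [hz1 x, hz2 x, abs_nonneg (φ x)]), mul_comm (z.1 x ^ α), add_comm α β]
    exact rpow_mul_rpow_mul_le hβ.le (by linarith) (hz2 x) (hz1 x) (abs_nonneg _)
      (by linarith [hz1 x, abs_nonneg (φ x)]) (by linarith [hz2 x, abs_nonneg (φ x)])
      (by linarith [hz1 x, hz2 x])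

/-! ### One-sided derivative of the superlinear term. -/

omit H in
theorem _root_.FracSystem.hasDerivAt_product {α β a c d e : ℝ} (hα : 1 ≤ α) (hβ : 1 ≤ β) (t : ℝ) :
    HasDerivAt (fun t : ℝ => (a + t * d) ^ α * (c + t * e) ^ β)
      (α * ((a + t * d) ^ (α - 1) * (c + t * e) ^ β * d) +
        β * ((a + t * d) ^ α * (c + t * e) ^ (β - 1) * e)) t := by
  have h1 : HasDerivAt (fun t : ℝ => a + t * d) d t := by
    simpa using ((hasDerivAt_id t).mul_const d).const_add a
  have h2 : HasDerivAt (fun t : ℝ => c + t * e) e t := by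
    simpa using ((hasDerivAt_id t).mul_const e).const_add c
  refine ((h1.rpow_const (p := α) (Or.inr hα)).mul
    (h2.rpow_const (p := β) (Or.inr hβ))).congr_deriv ?_
  ring

-- Mean value inequality on [0, 1], each term of the derivative being at most a multiple of the p-th
-- power of a + c + d + e. After division by ε this is the dominating function for the difference
-- quotients.
omit H in
theorem _root_.FracSystem.product_increment_le {α β a c d e ε : ℝ} (hα : 1 ≤ α) (hβ : 1 ≤ β)
    (ha : 0 ≤ a) (hc : 0 ≤ c) (hd : 0 ≤ d) (he : 0 ≤ e) (hε0 : 0 ≤ ε) (hε1 : ε ≤ 1) :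
    |(a + ε * d) ^ α * (c + ε * e) ^ β - a ^ α * c ^ β| ≤
      (α + β) * (a + c + d + e) ^ (α + β) * ε := by
  have := Convex.norm_image_sub_le_of_norm_hasDerivWithin_le
    (f := fun t : ℝ => (a + t * d) ^ α * (c + t * e) ^ β) (s := Icc 0 1)
    (C := (α + β) * (a + c + d + e) ^ (α + β))
    (fun t _ => (hasDerivAt_product (a := a) (c := c) (d := d) (e := e) hα hβ t).hasDerivWithinAt)
    (fun t ht => ?_) (convex_Icc 0 1) (x := 0) (by simp) (y := ε) ⟨hε0, hε1⟩
  · simp only [Real.norm_eq_abs, zero_mul, add_zero, sub_zero] at this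
    rwa [abs_of_nonneg hε0] at this
  · have htd : t * d ≤ d := mul_le_of_le_one_left hd ht.2
    have hte : t * e ≤ e := mul_le_of_le_one_left he ht.2
    have htd0 : 0 ≤ t * d := mul_nonneg ht.1 hd
    have hte0 : 0 ≤ t * e := mul_nonneg ht.1 he
    have h1 := rpow_mul_rpow_mul_le (α := α) (β := β) (a := a + t * d) (c := c + t * e) (d := d)
      (m := a + c + d + e) hα (by linarith) (by linarith) (by linarith) hd (by linarith)
      (by linarith) (by linarith)
    have h2 := rpow_mul_rpow_mul_le (α := β) (β := α) (a := c + t * e) (c := a + t * d) (d := e)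
      (m := a + c + d + e) hβ (by linarith) (by linarith) (by linarith) he (by linarith)
      (by linarith) (by linarith)
    rw [add_comm β α, mul_comm ((c + t * e) ^ (β - 1))] at h2
    rw [Real.norm_of_nonneg (by positivity)]
    have h3 := mul_le_mul_of_nonneg_left h1 (show 0 ≤ α by linarith)
    have h4 := mul_le_mul_of_nonneg_left h2 (show 0 ≤ β by linarith)
    linarith

/-- The one-sided derivative of the superlinear term. -/
theorem tendsto_supB_quotient (hz : z ∈ Y s Ω) (hz1 : ∀ x, 0 ≤ z.1 x) (hz2 : ∀ x, 0 ≤ z.2 x)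
    (hφ : φ ∈ X₀ s Ω) (hψ : ψ ∈ X₀ s Ω) (hφ0 : ∀ x, 0 ≤ φ x) (hψ0 : ∀ x, 0 ≤ ψ x)
    {ε : ℕ → ℝ} (hε : ∀ k, 0 < ε k) (hlim : Tendsto ε atTop (𝓝 0)) :
    Tendsto (fun k => (supB Ω α β b (z + ε k • (φ, ψ)) - supB Ω α β b z) / ε k) atTop
      (𝓝 (α * (∫ x in Ω, b x * (z.1 x ^ (α - 1) * z.2 x ^ β * φ x)) +
        β * ∫ x in Ω, b x * (z.1 x ^ α * z.2 x ^ (β - 1) * ψ x))) := by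
  have hα := H.hα
  have hβ := H.hβ
  have hYε : ∀ k, z + ε k • (φ, ψ) ∈ Y s Ω := fun k =>
    ⟨add_mem_X₀ H.measurableSet hz.1 (smul_mem_X₀ H.measurableSet _ hφ),
      add_mem_X₀ H.measurableSet hz.2 (smul_mem_X₀ H.measurableSet _ hψ)⟩
  have hm : ((z.1 + z.2) + φ) + ψ ∈ X₀ s Ω :=
    add_mem_X₀ H.measurableSet (add_mem_X₀ H.measurableSet (add_mem_X₀ H.measurableSet hz.1 hz.2) hφ) hψ
  have hi := (H.integrable_rpow hm).integrableOn (s := Ω) |>.const_mul (normLp Ω ⊤ b * (α + β))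
  have hN : 0 ≤ normLp Ω ⊤ b := ENNReal.toReal_nonneg
  have hsub : ∀ k, (supB Ω α β b (z + ε k • (φ, ψ)) - supB Ω α β b z) / ε k =
      ∫ x in Ω, b x * (((z.1 x + ε k * φ x) ^ α * (z.2 x + ε k * ψ x) ^ β -
        z.1 x ^ α * z.2 x ^ β) / ε k) := fun k => by
    unfold supB
    rw [← integral_sub (H.integrable_super (hYε k)) (H.integrable_super hz),
      ← integral_div]
    congr 1; ext x
    have h1 : 0 ≤ z.1 x + ε k * φ x := add_nonneg (hz1 x) (mul_nonneg (hε k).le (hφ0 x))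
    have h2 : 0 ≤ z.2 x + ε k * ψ x := add_nonneg (hz2 x) (mul_nonneg (hε k).le (hψ0 x))
    simp only [Prod.fst_add, Prod.snd_add, Prod.smul_fst, Prod.smul_snd, Pi.add_apply,
      Pi.smul_apply, smul_eq_mul]
    rw [max_eq_left h1, max_eq_left h2, max_eq_left (hz1 x), max_eq_left (hz2 x)]
    ring
  simp_rw [hsub]
  have hlimint : α * (∫ x in Ω, b x * (z.1 x ^ (α - 1) * z.2 x ^ β * φ x)) +
      β * (∫ x in Ω, b x * (z.1 x ^ α * z.2 x ^ (β - 1) * ψ x)) =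
      ∫ x in Ω, b x * (α * (z.1 x ^ (α - 1) * z.2 x ^ β * φ x) +
        β * (z.1 x ^ α * z.2 x ^ (β - 1) * ψ x)) := by
    rw [← integral_const_mul, ← integral_const_mul, ← integral_add
      ((H.integrable_super_test hz hz1 hz2 hφ).1.const_mul α)
      ((H.integrable_super_test hz hz1 hz2 hψ).2.const_mul β)]
    congr 1; ext x; ring
  rw [hlimint]
  have hz1m : AEMeasurable z.1 volume := hz.1.1
  have hz2m : AEMeasurable z.2 volume := hz.2.1
  have hφm : AEMeasurable φ volume := hφ.1
  have hψm : AEMeasurable ψ volume := hψ.1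
  refine tendsto_integral_filter_of_dominated_convergence _ (Eventually.of_forall fun k => ?_) ?_ hi
    (ae_of_all _ fun x => ?_)
  · refine H.hb.1.mul (AEMeasurable.aestronglyMeasurable ?_).restrict
    exact (((((hz1m.add (hφm.const_mul _)).pow_const _).mul
      ((hz2m.add (hψm.const_mul _)).pow_const _)).sub
        ((hz1m.pow_const _).mul (hz2m.pow_const _))).div_const _)
  · filter_upwards [hlim.eventually (ge_mem_nhds (zero_lt_one' ℝ))] with k hk
    filter_upwards [ae_abs_le_of_memLp_top H.hb] with x hx
    have h1 := product_increment_le hα.le hβ.le (hz1 x) (hz2 x) (hφ0 x) (hψ0 x) (hε k).le hk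
    have h2 : |((z.1 x + ε k * φ x) ^ α * (z.2 x + ε k * ψ x) ^ β - z.1 x ^ α * z.2 x ^ β) / ε k|
        ≤ (α + β) * (z.1 x + z.2 x + φ x + ψ x) ^ (α + β) := by
      rwa [abs_div, abs_of_pos (hε k), div_le_iff₀ (hε k)]
    rw [Real.norm_eq_abs, abs_mul, mul_assoc]
    simp only [Pi.add_apply]
    rw [abs_of_nonneg (a := z.1 x + z.2 x + φ x + ψ x)
      (by linarith [hz1 x, hz2 x, hφ0 x, hψ0 x])]
    exact mul_le_mul hx h2 (abs_nonneg _) hN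
  · refine Tendsto.const_mul _ ?_
    have h1 := (hasDerivAt_product (a := z.1 x) (c := z.2 x) (d := φ x) (e := ψ x)
      hα.le hβ.le 0).tendsto_slope_zero
    have h2 : Tendsto ε atTop (𝓝[≠] 0) :=
      tendsto_nhdsWithin_iff.2 ⟨hlim, Eventually.of_forall fun k => (hε k).ne'⟩
    have h3 := h1.comp h2
    simp only [zero_add, zero_mul, add_zero, smul_eq_mul] at h3
    refine h3.congr fun k => ?_
    simp only [Function.comp]
    ring

end Setting

end Continuity

/-! ### From minimality to positive weak solutions -/

section Solution

open Filter Topology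

variable {n : ℕ} {s : ℝ} {Ω : Set (E n)} {α β q : ℝ} {f g b : E n → ℝ} {lam mu : ℝ}
  {u v w φ ψ : E n → ℝ} {z : (E n → ℝ) × (E n → ℝ)}

/-- The energy does not decrease, to first order, in nonnegative directions; a rescaling tending to
`1` is allowed. -/
def MinimizesAlong (s : ℝ) (Ω : Set (E n)) (α β q : ℝ) (f g b : E n → ℝ) (lam mu : ℝ)
    (z : (E n → ℝ) × (E n → ℝ)) : Prop :=
  ∀ φ ∈ X₀ s Ω, ∀ ψ ∈ X₀ s Ω, (∀ x, 0 ≤ φ x) → (∀ x, 0 ≤ ψ x) →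
    ∃ ε t : ℕ → ℝ, (∀ k, 0 < ε k) ∧ Tendsto ε atTop (𝓝 0) ∧ (∀ k, 0 < t k) ∧
      Tendsto t atTop (𝓝 1) ∧ ∀ k, energy s Ω α β q f g b lam mu (t k • z) ≤
        energy s Ω α β q f g b lam mu (t k • (z + ε k • (φ, ψ)))

/-- A nonnegative linear functional of the form `⟨u, ·⟩ - ∫ m₁ · - ∫ m₂ ·` with `m₁ ≥ 0` that
vanishes at the positive function `u` vanishes identically. -/
theorem functional_eq_zero (hs : 0 < s) (hΩ : MeasurableSet Ω) (hu : u ∈ X₀ s Ω)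
    (hpos : ∀ᵐ x ∂(volume.restrict Ω), 0 < u x) {m₁ m₂ : E n → ℝ}
    (hm₁ : ∀ᵐ x ∂(volume.restrict Ω), 0 ≤ m₁ x)
    (h₁ : ∀ φ ∈ X₀ s Ω, IntegrableOn (fun x => m₁ x * φ x) Ω)
    (h₂ : ∀ φ ∈ X₀ s Ω, IntegrableOn (fun x => m₂ x * φ x) Ω)
    (hL : ∀ φ ∈ X₀ s Ω, (∀ x, 0 ≤ φ x) →
      (∫ x in Ω, m₁ x * φ x) + (∫ x in Ω, m₂ x * φ x) ≤ form s Ω u φ)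
    (hLu : (∫ x in Ω, m₁ x * u x) + (∫ x in Ω, m₂ x * u x) = form s Ω u u)
    (hφ : φ ∈ X₀ s Ω) :
    form s Ω u φ = (∫ x in Ω, m₁ x * φ x) + ∫ x in Ω, m₂ x * φ x := by
  let L : (E n → ℝ) → ℝ := fun φ =>
    form s Ω u φ - ((∫ x in Ω, m₁ x * φ x) + ∫ x in Ω, m₂ x * φ x)
  have hLsub : ∀ φ ∈ X₀ s Ω, ∀ ψ ∈ X₀ s Ω, L (φ - ψ) = L φ - L ψ := fun φ hφ ψ hψ => by
    simp only [L, Pi.sub_apply, mul_sub]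
    rw [form_sub_right hs hΩ hφ hψ hu, integral_sub (h₁ φ hφ) (h₁ ψ hψ),
      integral_sub (h₂ φ hφ) (h₂ ψ hψ)]
    ring
  have hLsmul : ∀ c : ℝ, L (c • u) = 0 := fun c => by
    have e : ∀ m : E n → ℝ, ∫ x in Ω, m x * (c • u) x = c * ∫ x in Ω, m x * u x := fun m => by
      rw [← integral_const_mul]; congr 1; ext x; simp only [Pi.smul_apply, smul_eq_mul]; ring
    simp only [L, e, form_smul_right hs, ← hLu]
    ring
  have hLnn : ∀ φ ∈ X₀ s Ω, (∀ x, 0 ≤ φ x) → 0 ≤ L φ := fun φ hφ h0 => by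
    have := hL φ hφ h0
    simp only [L]; linarith
  have hzero : ∀ φ ∈ X₀ s Ω, (∀ x, 0 ≤ φ x) → L φ = 0 := by
    intro φ hφ h0
    refine le_antisymm ?_ (hLnn φ hφ h0)
    -- φ − e_k is the minimum of φ and (k+1)u, so (k+1)u − (φ − e_k) ≥ 0. As L vanishes on multiples
    -- of u, this gives L(φ) ≤ L(e_k). There the form is O(1/k) by `form_excess_le`, the m₁ term is
    -- dropped by its sign, and the m₂ term tends to 0 because u > 0.
    let e : ℕ → E n → ℝ := fun k x => max (φ x - (k + 1 : ℝ) * u x) 0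
    have heX : ∀ k, e k ∈ X₀ s Ω := fun k =>
      posPart_mem_X₀ hΩ (sub_mem_X₀ hΩ hφ (smul_mem_X₀ hΩ (k + 1 : ℝ) hu))
    have hle : ∀ k : ℕ, L φ ≤ form s Ω φ φ / (4 * (k + 1)) - ∫ x in Ω, m₂ x * e k x := fun k => by
      have hku := smul_mem_X₀ hΩ (k + 1 : ℝ) hu
      have h1 : 0 ≤ L (((k + 1 : ℝ) • u) - (φ - e k)) := by
        refine hLnn _ (sub_mem_X₀ hΩ hku (sub_mem_X₀ hΩ hφ (heX k))) fun x => ?_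
        have := le_max_left (φ x - (k + 1 : ℝ) * u x) 0
        simp only [Pi.sub_apply, Pi.smul_apply, smul_eq_mul, e]
        linarith
      rw [hLsub _ hku _ (sub_mem_X₀ hΩ hφ (heX k)), hLsub _ hφ _ (heX k), hLsmul] at h1
      have h2 := form_excess_le hs hΩ hu hφ (k := (k + 1 : ℝ)) (by positivity)
      have h3 : 0 ≤ ∫ x in Ω, m₁ x * e k x := integral_nonneg_of_ae (by
        filter_upwards [hm₁] with x hx using mul_nonneg hx (le_max_right _ _))
      have h4 : L (e k) = form s Ω u (e k) -
        ((∫ x in Ω, m₁ x * e k x) + ∫ x in Ω, m₂ x * e k x) := rfl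
      have h5 : form s Ω u (e k) ≤ form s Ω φ φ / (4 * (k + 1)) := h2
      linarith
    have hlim1 : Tendsto (fun k : ℕ => form s Ω φ φ / (4 * (k + 1 : ℝ))) atTop (𝓝 0) := by
      refine tendsto_const_nhds.div_atTop ?_
      exact (tendsto_natCast_atTop_atTop.atTop_add tendsto_const_nhds).const_mul_atTop (by norm_num)
    have hlim2 : Tendsto (fun k : ℕ => ∫ x in Ω, m₂ x * e k x) atTop (𝓝 0) := by
      have := tendsto_integral_of_dominated_convergence (μ := volume.restrict Ω)
        (F := fun k x => m₂ x * e k x) (f := fun _ => (0 : ℝ)) (fun x => |m₂ x * φ x|)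
        (fun k => (h₂ _ (heX k)).1) (h₂ φ hφ).abs ?_ ?_
      · simpa using this
      · intro k
        filter_upwards [hpos] with x hx
        rw [norm_mul, Real.norm_eq_abs, abs_mul, abs_of_nonneg (h0 x),
          Real.norm_of_nonneg (le_max_right _ _)]
        refine mul_le_mul_of_nonneg_left (max_le ?_ (h0 x)) (abs_nonneg _)
        have : 0 ≤ (k + 1 : ℝ) * u x := by positivity
        linarith
      · filter_upwards [hpos] with x hx
        refine tendsto_const_nhds.congr' ?_
        filter_upwards [eventually_ge_atTop ⌈φ x / u x⌉₊] with k hk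
        have hk : φ x / u x ≤ k := Nat.ceil_le.1 hk
        rw [div_le_iff₀ hx] at hk
        simp only [e]
        rw [max_eq_right (by nlinarith), mul_zero]
    have := hlim1.sub hlim2
    rw [sub_zero] at this
    exact ge_of_tendsto' this hle
  -- A general φ is the difference of the nonnegative functions |φ| and |φ| − φ.
  have habs := abs_mem_X₀ hΩ hφ
  have h1 := hLsub _ habs _ (sub_mem_X₀ hΩ habs hφ)
  rw [hzero _ habs fun x => abs_nonneg _, hzero _ (sub_mem_X₀ hΩ habs hφ) fun x => by
    simp only [Pi.sub_apply]; linarith [le_abs_self (φ x)], sub_sub_cancel] at h1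
  simp only [L] at h1
  linarith

/-- Used with a = t², τ = t^(1−q), c = t^p: the energy inequality is divided by ε and solved for the
difference quotient of the singular term. -/
theorem scalar_increment {r τ a c ε A D F F' B B' p : ℝ} (hr : 0 < r) (hτ : 0 < τ) (hε : 0 < ε)
    (h : a * A / 2 - τ * F / r - c * B / p ≤ a * (A + ε * D) / 2 - τ * F' / r - c * B' / p) :
    (F' - F) / ε ≤ r * (τ⁻¹ * (a * D / 2 - c * ((B' - B) / ε) / p)) := by
  obtain ⟨X, rfl⟩ : ∃ X, F' = F + ε * X := ⟨(F' - F) / ε, by field_simp; ring⟩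
  obtain ⟨Y, rfl⟩ : ∃ Y, B' = B + ε * Y := ⟨(B' - B) / ε, by field_simp; ring⟩
  have e1 : (F + ε * X - F) / ε = X := by field_simp; ring
  have e2 : (B + ε * Y - B) / ε = Y := by field_simp; ring
  rw [e1, e2]
  have h1 : ε * (τ * X / r) ≤ ε * (a * D / 2 - c * Y / p) := by
    have e3 : τ * (F + ε * X) / r = τ * F / r + ε * (τ * X / r) := by ring
    have e4 : c * (B + ε * Y) / p = c * B / p + ε * (c * Y / p) := by ring
    rw [e3, e4] at h
    linarith
  have h2 := le_of_mul_le_mul_left h1 hε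
  calc X = r * (τ⁻¹ * (τ * X / r)) := by field_simp
    _ ≤ _ := by gcongr

namespace Setting

variable (H : Setting s Ω α β q f g b lam mu)
include H

/-- The integrated difference quotients of the singular term are, in the limit, bounded by the
derivative of the smooth part of the energy. -/
theorem fatou_increment (hz : z ∈ Y s Ω) (hz1 : ∀ x, 0 ≤ z.1 x) (hz2 : ∀ x, 0 ≤ z.2 x)
    (hmin : MinimizesAlong s Ω α β q f g b lam mu z)
    (hφ : φ ∈ X₀ s Ω) (hψ : ψ ∈ X₀ s Ω) (hφ0 : ∀ x, 0 ≤ φ x) (hψ0 : ∀ x, 0 ≤ ψ x)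
    {R : ℝ} (hR : R = form s Ω z.1 φ + form s Ω z.2 ψ -
      (α * (∫ x in Ω, b x * (z.1 x ^ (α - 1) * z.2 x ^ β * φ x)) +
        β * ∫ x in Ω, b x * (z.1 x ^ α * z.2 x ^ (β - 1) * ψ x)) / (α + β)) :
    0 ≤ R ∧ ∃ ε : ℕ → ℝ, (∀ k, 0 < ε k) ∧ Tendsto ε atTop (𝓝 0) ∧
      ∫⁻ x in Ω, liminf (fun k => ENNReal.ofReal
        (lam * f x * (((z.1 x + ε k * φ x) ^ (1 - q) - z.1 x ^ (1 - q)) / ε k) +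
          mu * g x * (((z.2 x + ε k * ψ x) ^ (1 - q) - z.2 x ^ (1 - q)) / ε k))) atTop ≤
        ENNReal.ofReal ((1 - q) * R) := by
  have hq : 0 < 1 - q := by linarith [H.hq1]
  obtain ⟨ε, t, hε, hε0, ht, ht1, hen⟩ := hmin φ hφ ψ hψ hφ0 hψ0
  have hYε : ∀ k, z + ε k • (φ, ψ) ∈ Y s Ω := fun k =>
    ⟨add_mem_X₀ H.measurableSet hz.1 (smul_mem_X₀ H.measurableSet _ hφ),
      add_mem_X₀ H.measurableSet hz.2 (smul_mem_X₀ H.measurableSet _ hψ)⟩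
  let T : ℕ → E n → ℝ := fun k x =>
    lam * f x * (((z.1 x + ε k * φ x) ^ (1 - q) - z.1 x ^ (1 - q)) / ε k) +
      mu * g x * (((z.2 x + ε k * ψ x) ^ (1 - q) - z.2 x ^ (1 - q)) / ε k)
  have hF1 : ∀ y ∈ Y s Ω, IntegrableOn (fun x => lam * f x * max (y.1 x) 0 ^ (1 - q) +
      mu * g x * max (y.2 x) 0 ^ (1 - q)) Ω := fun y hy =>
    (H.integrable_sing lam H.hf hy.1).add (H.integrable_sing mu H.hg hy.2)
  have hTe : ∀ k, T k = fun x => ((lam * f x * max ((z + ε k • (φ, ψ)).1 x) 0 ^ (1 - q) +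
      mu * g x * max ((z + ε k • (φ, ψ)).2 x) 0 ^ (1 - q)) -
      (lam * f x * max (z.1 x) 0 ^ (1 - q) + mu * g x * max (z.2 x) 0 ^ (1 - q))) / ε k := by
    intro k; ext x
    have h1 : 0 ≤ z.1 x + ε k * φ x := add_nonneg (hz1 x) (mul_nonneg (hε k).le (hφ0 x))
    have h2 : 0 ≤ z.2 x + ε k * ψ x := add_nonneg (hz2 x) (mul_nonneg (hε k).le (hψ0 x))
    simp only [T, Prod.fst_add, Prod.snd_add, Prod.smul_fst, Prod.smul_snd, Pi.add_apply,
      Pi.smul_apply, smul_eq_mul]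
    rw [max_eq_left h1, max_eq_left h2, max_eq_left (hz1 x), max_eq_left (hz2 x)]
    ring
  have hTi : ∀ k, IntegrableOn (T k) Ω := fun k => by
    rw [hTe k]; exact ((hF1 _ (hYε k)).sub (hF1 _ hz)).div_const _
  have hTint : ∀ k, ∫ x in Ω, T k x =
      (singF Ω q f g lam mu (z + ε k • (φ, ψ)) - singF Ω q f g lam mu z) / ε k := fun k => by
    rw [hTe k, integral_div]
    congr 1
    exact integral_sub (hF1 _ (hYε k)) (hF1 _ hz)
  have hT0 : ∀ k, ∀ᵐ x ∂(volume.restrict Ω), 0 ≤ T k x := fun k => by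
    have hlam := H.hlam; have hmu := H.hmu
    filter_upwards [H.hf0, H.hg0] with x hf hg
    have h1 : z.1 x ^ (1 - q) ≤ (z.1 x + ε k * φ x) ^ (1 - q) :=
      Real.rpow_le_rpow (hz1 x) (le_add_of_nonneg_right (mul_nonneg (hε k).le (hφ0 x))) hq.le
    have h2 : z.2 x ^ (1 - q) ≤ (z.2 x + ε k * ψ x) ^ (1 - q) :=
      Real.rpow_le_rpow (hz2 x) (le_add_of_nonneg_right (mul_nonneg (hε k).le (hψ0 x))) hq.le
    have h3 := div_nonneg (sub_nonneg.2 h1) (hε k).le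
    have h4 := div_nonneg (sub_nonneg.2 h2) (hε k).le
    simp only [T]
    positivity
  let Bq : ℕ → ℝ := fun k => (supB Ω α β b (z + ε k • (φ, ψ)) - supB Ω α β b z) / ε k
  -- The upper bound for the singular quotient supplied by `scalar_increment`; as ε → 0 and t → 1 it
  -- tends to (1 − q)R.
  let Ek : ℕ → ℝ := fun k => (1 - q) * ((t k ^ (1 - q))⁻¹ * (t k ^ 2 *
    (2 * (form s Ω z.1 φ + form s Ω z.2 ψ) + ε k * (form s Ω φ φ + form s Ω ψ ψ)) / 2 -
      t k ^ (α + β) * Bq k / (α + β)))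
  have hBq := H.tendsto_supB_quotient hz hz1 hz2 hφ hψ hφ0 hψ0 hε hε0
  have hTE : ∀ k, ∫ x in Ω, T k x ≤ Ek k := fun k => by
    have h1 := hen k
    have htk := ht k
    have hεk := hε k
    have hA : quadA s Ω (z + ε k • (φ, ψ)) = quadA s Ω z + ε k *
        (2 * (form s Ω z.1 φ + form s Ω z.2 ψ) + ε k * (form s Ω φ φ + form s Ω ψ ψ)) := by
      have e1 := form_add_smul_self H.hs0 H.measurableSet hz.1 hφ (ε k)
      have e2 := form_add_smul_self H.hs0 H.measurableSet hz.2 hψ (ε k)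
      simp only [quadA, Prod.fst_add, Prod.snd_add, Prod.smul_fst, Prod.smul_snd]
      rw [e1, e2]; ring
    rw [H.energy_eq, H.energy_eq, H.quadA_smul, H.quadA_smul, singF_smul htk, singF_smul htk,
      supB_smul htk, supB_smul htk, hA] at h1
    rw [hTint]
    exact scalar_increment hq (Real.rpow_pos_of_pos htk _) hεk h1
  have hElim : Tendsto Ek atTop (𝓝 ((1 - q) * R)) := by
    have e1 := (ht1.rpow_const (p := 1 - q) (Or.inr hq.le)).inv₀ (by simp)
    have e2 := ht1.pow 2
    have e3 := ht1.rpow_const (p := α + β) (Or.inr H.p_pos.le)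
    have e4 := (hε0.mul_const (form s Ω φ φ + form s Ω ψ ψ)).const_add
      (2 * (form s Ω z.1 φ + form s Ω z.2 ψ))
    have e5 := (e1.mul (((e2.mul e4).div_const 2).sub
      ((e3.mul hBq).div_const (α + β)))).const_mul (1 - q)
    simp only [Real.one_rpow, inv_one, one_mul, one_pow, zero_mul, add_zero] at e5
    rw [hR]
    convert e5 using 2
    ring
  have hTnn : ∀ k, 0 ≤ ∫ x in Ω, T k x := fun k => integral_nonneg_of_ae (hT0 k)
  refine ⟨?_, ε, hε, hε0, ?_⟩
  · have := ge_of_tendsto' hElim fun k => (hTnn k).trans (hTE k)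
    exact (mul_nonneg_iff_of_pos_left hq).1 this
  · refine (lintegral_liminf_le' fun k => (hTi k).1.aemeasurable.ennreal_ofReal).trans ?_
    have h1 : Tendsto (fun k => ENNReal.ofReal (Ek k)) atTop
      (𝓝 (ENNReal.ofReal ((1 - q) * R))) := (ENNReal.continuous_ofReal.tendsto _).comp hElim
    rw [← h1.liminf_eq]
    refine liminf_le_liminf (Eventually.of_forall fun k => ?_)
    change ∫⁻ x in Ω, ENNReal.ofReal (T k x) ≤ _
    rw [← ofReal_integral_eq_lintegral_ofReal (hTi k) (hT0 k)]
    exact ENNReal.ofReal_le_ofReal (hTE k)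

-- From a = 0 the quotient equals d^(1−q) ε^(−q), which blows up.
omit H in
theorem _root_.FracSystem.tendsto_singular_quotient {a d q : ℝ} (hq0 : 0 < q) (hq1 : q < 1)
    (hd : 0 < d) {ε : ℕ → ℝ} (hε : ∀ k, 0 < ε k) (hε0 : Tendsto ε atTop (𝓝 0)) (ha : a = 0) :
    Tendsto (fun k => ((a + ε k * d) ^ (1 - q) - a ^ (1 - q)) / ε k) atTop atTop := by
  subst ha
  have h1 : Tendsto ε atTop (𝓝[>] 0) := tendsto_nhdsWithin_iff.2 ⟨hε0, Eventually.of_forall hε⟩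
  have h2 := ((tendsto_rpow_neg_nhdsGT_zero (y := -q) (by linarith)).comp h1).const_mul_atTop
    (Real.rpow_pos_of_pos hd (1 - q))
  refine h2.congr fun k => ?_
  have := hε k
  simp only [Function.comp]
  rw [zero_add, Real.zero_rpow (by linarith), sub_zero, Real.mul_rpow this.le hd.le,
    show 1 - q = -q + 1 by ring, Real.rpow_add_one this.ne']
  field_simp

/-- Where a component vanishes, the singular quotient in a strictly positive direction tends to
infinity. The Fatou bound makes the limit inferior finite almost everywhere, so this occurs only on
a null set. -/
theorem pos_of_minimizesAlong (hz : z ∈ Y s Ω) (hz1 : ∀ x, 0 ≤ z.1 x) (hz2 : ∀ x, 0 ≤ z.2 x)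
    (hmin : MinimizesAlong s Ω α β q f g b lam mu z) :
    ∀ᵐ x ∂(volume.restrict Ω), 0 < z.1 x ∧ 0 < z.2 x := by
  have hq : 0 < 1 - q := by linarith [H.hq1]
  obtain ⟨φ, hφ, hφ0, hφpos⟩ := exists_pos_mem_X₀ H.hn H.hs0 H.hs1 H.hΩ H.hΩb
  obtain ⟨-, ε, hε, hε0, hle⟩ := H.fatou_increment hz hz1 hz2 hmin hφ hφ hφ0 hφ0 rfl
  have hlam := H.hlam
  have hmu := H.hmu
  have hmeas : ∀ k, AEMeasurable (fun x => ENNReal.ofReal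
        (lam * f x * (((z.1 x + ε k * φ x) ^ (1 - q) - z.1 x ^ (1 - q)) / ε k) +
          mu * g x * (((z.2 x + ε k * φ x) ^ (1 - q) - z.2 x ^ (1 - q)) / ε k)))
        (volume.restrict Ω) := fun k => by
    have h1 := (hz.1.1 : AEMeasurable z.1 volume).restrict (s := Ω)
    have h2 := (hz.2.1 : AEMeasurable z.2 volume).restrict (s := Ω)
    have h3 := hφ.1.restrict (s := Ω)
    have h4 := H.hf.1.aemeasurable
    have h5 := H.hg.1.aemeasurable
    exact (((h4.const_mul lam).mul ((((h1.add (h3.const_mul _)).pow_const _).sub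
      (h1.pow_const _)).div_const _)).add ((h5.const_mul mu).mul
      ((((h2.add (h3.const_mul _)).pow_const _).sub (h2.pow_const _)).div_const _))).ennreal_ofReal
  have hfin := ae_lt_top' (by
      simp_rw [liminf_eq_iSup_iInf_of_nat]
      exact AEMeasurable.iSup fun m => AEMeasurable.biInf _ (to_countable _) fun k _ => hmeas k)
    (hle.trans_lt ENNReal.ofReal_lt_top).ne
  filter_upwards [hfin, H.hf0, H.hg0, ae_restrict_mem H.measurableSet] with x hx hf hg hxΩ
  have hnn : ∀ a : ℝ, 0 ≤ a → ∀ k, 0 ≤ ((a + ε k * φ x) ^ (1 - q) - a ^ (1 - q)) / ε k :=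
    fun a ha k => div_nonneg (sub_nonneg.2 (Real.rpow_le_rpow ha
      (le_add_of_nonneg_right (mul_nonneg (hε k).le (hφ0 x))) hq.le)) (hε k).le
  constructor
  · refine (hz1 x).lt_of_ne fun h => hx.ne ?_
    have h1 := (tendsto_singular_quotient H.hq0 H.hq1 (hφpos x hxΩ) hε hε0 h.symm).const_mul_atTop
      (mul_pos hlam hf)
    refine Tendsto.liminf_eq (ENNReal.tendsto_ofReal_atTop.comp (tendsto_atTop_mono (fun k => ?_) h1))
    have := hnn _ (hz2 x) k
    exact le_add_of_nonneg_right (by positivity)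
  · refine (hz2 x).lt_of_ne fun h => hx.ne ?_
    have h1 := (tendsto_singular_quotient H.hq0 H.hq1 (hφpos x hxΩ) hε hε0 h.symm).const_mul_atTop
      (mul_pos hmu hg)
    refine Tendsto.liminf_eq (ENNReal.tendsto_ofReal_atTop.comp (tendsto_atTop_mono (fun k => ?_) h1))
    have := hnn _ (hz1 x) k
    exact le_add_of_nonneg_left (by positivity)

/-- The variational inequality in nonnegative directions. -/
theorem variational_inequality (hz : z ∈ Y s Ω) (hz1 : ∀ x, 0 ≤ z.1 x) (hz2 : ∀ x, 0 ≤ z.2 x)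
    (hmin : MinimizesAlong s Ω α β q f g b lam mu z)
    (hφ : φ ∈ X₀ s Ω) (hψ : ψ ∈ X₀ s Ω) (hφ0 : ∀ x, 0 ≤ φ x) (hψ0 : ∀ x, 0 ≤ ψ x) :
    IntegrableOn (fun x => f x * (z.1 x ^ (-q) * φ x)) Ω ∧
    IntegrableOn (fun x => g x * (z.2 x ^ (-q) * ψ x)) Ω ∧
    lam * (∫ x in Ω, f x * (z.1 x ^ (-q) * φ x)) + mu * (∫ x in Ω, g x * (z.2 x ^ (-q) * ψ x)) ≤
      form s Ω z.1 φ + form s Ω z.2 ψ -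
      (α * (∫ x in Ω, b x * (z.1 x ^ (α - 1) * z.2 x ^ β * φ x)) +
        β * ∫ x in Ω, b x * (z.1 x ^ α * z.2 x ^ (β - 1) * ψ x)) / (α + β) := by
  have hq : 0 < 1 - q := by linarith [H.hq1]
  have hlam := H.hlam
  have hmu := H.hmu
  set R := form s Ω z.1 φ + form s Ω z.2 ψ -
      (α * (∫ x in Ω, b x * (z.1 x ^ (α - 1) * z.2 x ^ β * φ x)) +
        β * ∫ x in Ω, b x * (z.1 x ^ α * z.2 x ^ (β - 1) * ψ x)) / (α + β) with hR
  obtain ⟨hR0, ε, hε, hε0, hle⟩ := H.fatou_increment hz hz1 hz2 hmin hφ hψ hφ0 hψ0 hR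
  have hpos := H.pos_of_minimizesAlong hz hz1 hz2 hmin
  have h2 : Tendsto ε atTop (𝓝[≠] 0) :=
    tendsto_nhdsWithin_iff.2 ⟨hε0, Eventually.of_forall fun k => (hε k).ne'⟩
  have hder : ∀ a d : ℝ, 0 < a →
      Tendsto (fun k => ((a + ε k * d) ^ (1 - q) - a ^ (1 - q)) / ε k) atTop
        (𝓝 ((1 - q) * (a ^ (-q) * d))) := fun a d ha => by
    have h1 : HasDerivAt (fun t : ℝ => a + t * d) d 0 := by
      simpa using ((hasDerivAt_id (0 : ℝ)).mul_const d).const_add a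
    have h3 := ((h1.rpow_const (p := 1 - q) (Or.inl (by simpa using ha.ne'))).tendsto_slope_zero).comp
      h2
    simp only [zero_add, zero_mul, add_zero, smul_eq_mul] at h3
    rw [show 1 - q - 1 = -q by ring, show d * (1 - q) * a ^ (-q) = (1 - q) * (a ^ (-q) * d) by ring]
      at h3
    refine h3.congr fun k => ?_
    simp only [Function.comp]
    ring
  let W : E n → ℝ := fun x => lam * (f x * (z.1 x ^ (-q) * φ x)) + mu * (g x * (z.2 x ^ (-q) * ψ x))
  have hW0 : ∀ᵐ x ∂(volume.restrict Ω), 0 ≤ W x := by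
    filter_upwards [H.hf0, H.hg0] with x hf hg
    have := hφ0 x; have := hψ0 x; have := hz1 x; have := hz2 x
    simp only [W]
    positivity
  -- With positivity known, the limit inferior is the pointwise derivative. Working with the lower
  -- integral gives integrability of the singular terms and the inequality at once.
  have hlint : ∫⁻ x in Ω, ENNReal.ofReal ((1 - q) * W x) ≤ ENNReal.ofReal ((1 - q) * R) := by
    refine le_trans (le_of_eq (lintegral_congr_ae ?_)) hle
    filter_upwards [hpos] with x hx
    have h3 := ((hder _ (φ x) hx.1).const_mul (lam * f x)).add
      ((hder _ (ψ x) hx.2).const_mul (mu * g x))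
    refine Eq.trans ?_ ((ENNReal.continuous_ofReal.tendsto _).comp h3).liminf_eq.symm
    simp only [W]
    congr 1
    ring
  have hmz1 := (hz.1.1 : AEMeasurable z.1 volume).restrict (s := Ω)
  have hmz2 := (hz.2.1 : AEMeasurable z.2 volume).restrict (s := Ω)
  have hm1 : AEStronglyMeasurable (fun x => f x * (z.1 x ^ (-q) * φ x)) (volume.restrict Ω) :=
    H.hf.1.mul ((hmz1.pow_const _).mul hφ.1.restrict).aestronglyMeasurable
  have hm2 : AEStronglyMeasurable (fun x => g x * (z.2 x ^ (-q) * ψ x)) (volume.restrict Ω) :=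
    H.hg.1.mul ((hmz2.pow_const _).mul hψ.1.restrict).aestronglyMeasurable
  have hWm : AEStronglyMeasurable W (volume.restrict Ω) := (hm1.const_mul lam).add (hm2.const_mul mu)
  have hW0' : ∀ᵐ x ∂(volume.restrict Ω), 0 ≤ (1 - q) * W x := by
    filter_upwards [hW0] with x hx using mul_nonneg hq.le hx
  have hWi' : IntegrableOn (fun x => (1 - q) * W x) Ω := by
    refine ⟨hWm.const_mul _, ?_⟩
    rw [hasFiniteIntegral_iff_ofReal hW0']
    exact hlint.trans_lt ENNReal.ofReal_lt_top
  have hWi : IntegrableOn W Ω := by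
    refine (hWi'.const_mul (1 - q)⁻¹).congr (ae_of_all _ fun x => ?_)
    simp only
    field_simp
  have hWle : ∫ x in Ω, W x ≤ R := by
    have h3 : ∫ x in Ω, (1 - q) * W x ≤ (1 - q) * R := by
      rw [integral_eq_lintegral_of_nonneg_ae hW0' hWi'.1]
      exact ENNReal.toReal_le_of_le_ofReal (by positivity) hlint
    rw [integral_const_mul] at h3
    exact le_of_mul_le_mul_left h3 hq
  have hi1 : IntegrableOn (fun x => f x * (z.1 x ^ (-q) * φ x)) Ω := by
    refine (hWi.const_mul lam⁻¹).mono' hm1 ?_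
    filter_upwards [H.hf0, H.hg0] with x hf hg
    have := hφ0 x; have := hψ0 x; have := hz1 x; have := hz2 x
    rw [Real.norm_of_nonneg (by positivity)]
    simp only [W]
    rw [mul_add, inv_mul_cancel_left₀ hlam.ne']
    exact le_add_of_nonneg_right (by positivity)
  have hi2 : IntegrableOn (fun x => g x * (z.2 x ^ (-q) * ψ x)) Ω := by
    refine (hWi.const_mul mu⁻¹).mono' hm2 ?_
    filter_upwards [H.hf0, H.hg0] with x hf hg
    have := hφ0 x; have := hψ0 x; have := hz1 x; have := hz2 x
    rw [Real.norm_of_nonneg (by positivity)]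
    simp only [W]
    rw [mul_add, inv_mul_cancel_left₀ hmu.ne']
    exact le_add_of_nonneg_left (by positivity)
  refine ⟨hi1, hi2, ?_⟩
  rw [← integral_const_mul, ← integral_const_mul,
    ← integral_add (hi1.const_mul lam) (hi2.const_mul mu)]
  exact hWle

/-- A nonnegative point of the Nehari manifold that minimizes the energy in nonnegative directions
is a positive weak solution. -/
theorem isPositiveWeakSolution (hz : z ∈ Y s Ω) (hz1 : ∀ x, 0 ≤ z.1 x) (hz2 : ∀ x, 0 ≤ z.2 x)
    (hN : quadA s Ω z = singF Ω q f g lam mu z + supB Ω α β b z)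
    (hmin : MinimizesAlong s Ω α β q f g b lam mu z) :
    IsPositiveWeakSolution s Ω α β q f g b lam mu z := by
  have hp := H.p_pos
  have hlam := H.hlam
  have hmu := H.hmu
  have hpos := H.pos_of_minimizesAlong hz hz1 hz2 hmin
  have hpos1 : ∀ᵐ x ∂(volume.restrict Ω), 0 < z.1 x := hpos.mono fun x hx => hx.1
  have hpos2 : ∀ᵐ x ∂(volume.restrict Ω), 0 < z.2 x := hpos.mono fun x hx => hx.2
  have hmz1 := (hz.1.1 : AEMeasurable z.1 volume).restrict (s := Ω)
  have hmz2 := (hz.2.1 : AEMeasurable z.2 volume).restrict (s := Ω)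
  have hI1 : ∀ φ ∈ X₀ s Ω, IntegrableOn (fun x => f x * (z.1 x ^ (-q) * φ x)) Ω := fun φ hφ => by
    have h := (H.variational_inequality hz hz1 hz2 hmin (abs_mem_X₀ H.measurableSet hφ) zero_mem_X₀
      (fun x => abs_nonneg _) (fun _ => le_rfl)).1
    refine Integrable.mono h (H.hf.1.mul ((hmz1.pow_const _).mul hφ.1.restrict).aestronglyMeasurable)
      (ae_of_all _ fun x => ?_)
    simp
  have hI2 : ∀ φ ∈ X₀ s Ω, IntegrableOn (fun x => g x * (z.2 x ^ (-q) * φ x)) Ω := fun φ hφ => by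
    have h := (H.variational_inequality hz hz1 hz2 hmin zero_mem_X₀ (abs_mem_X₀ H.measurableSet hφ)
      (fun _ => le_rfl) (fun x => abs_nonneg _)).2.1
    refine Integrable.mono h (H.hg.1.mul ((hmz2.pow_const _).mul hφ.1.restrict).aestronglyMeasurable)
      (ae_of_all _ fun x => ?_)
    simp
  have hI3 := fun φ hφ => (H.integrable_super_test hz hz1 hz2 (φ := φ) hφ).1
  have hI4 := fun φ hφ => (H.integrable_super_test hz hz1 hz2 (φ := φ) hφ).2
  have c1 : ∀ φ : E n → ℝ, ∫ x in Ω, lam * f x * z.1 x ^ (-q) * φ x =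
      lam * ∫ x in Ω, f x * (z.1 x ^ (-q) * φ x) := fun φ => by
    rw [← integral_const_mul]; congr 1; ext x; ring
  have c2 : ∀ φ : E n → ℝ, ∫ x in Ω, mu * g x * z.2 x ^ (-q) * φ x =
      mu * ∫ x in Ω, g x * (z.2 x ^ (-q) * φ x) := fun φ => by
    rw [← integral_const_mul]; congr 1; ext x; ring
  have c3 : ∀ φ : E n → ℝ, ∫ x in Ω, α / (α + β) * b x * (z.1 x ^ (α - 1) * z.2 x ^ β) * φ x =
      α / (α + β) * ∫ x in Ω, b x * (z.1 x ^ (α - 1) * z.2 x ^ β * φ x) := fun φ => by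
    rw [← integral_const_mul]; congr 1; ext x; ring
  have c4 : ∀ φ : E n → ℝ, ∫ x in Ω, β / (α + β) * b x * (z.1 x ^ α * z.2 x ^ (β - 1)) * φ x =
      β / (α + β) * ∫ x in Ω, b x * (z.1 x ^ α * z.2 x ^ (β - 1) * φ x) := fun φ => by
    rw [← integral_const_mul]; congr 1; ext x; ring
  have hf0 : form s Ω z.1 (0 : E n → ℝ) = 0 := by simp [form]
  have hg0 : form s Ω z.2 (0 : E n → ℝ) = 0 := by simp [form]
  -- Setting the other test component to 0 decouples the variational inequality into one for each
  -- equation.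
  have hL1 : ∀ φ ∈ X₀ s Ω, (∀ x, 0 ≤ φ x) → (∫ x in Ω, lam * f x * z.1 x ^ (-q) * φ x) +
      (∫ x in Ω, α / (α + β) * b x * (z.1 x ^ (α - 1) * z.2 x ^ β) * φ x) ≤ form s Ω z.1 φ := by
    intro φ hφ h0
    have h := (H.variational_inequality hz hz1 hz2 hmin hφ zero_mem_X₀ h0 (fun _ => le_rfl)).2.2
    simp only [Pi.zero_apply, mul_zero, integral_zero, add_zero, hg0] at h
    rw [c1, c3]
    linarith [mul_div_right_comm α (∫ x in Ω, b x * (z.1 x ^ (α - 1) * z.2 x ^ β * φ x)) (α + β)]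
  have hL2 : ∀ φ ∈ X₀ s Ω, (∀ x, 0 ≤ φ x) → (∫ x in Ω, mu * g x * z.2 x ^ (-q) * φ x) +
      (∫ x in Ω, β / (α + β) * b x * (z.1 x ^ α * z.2 x ^ (β - 1)) * φ x) ≤ form s Ω z.2 φ := by
    intro φ hφ h0
    have h := (H.variational_inequality hz hz1 hz2 hmin zero_mem_X₀ hφ (fun _ => le_rfl) h0).2.2
    simp only [Pi.zero_apply, mul_zero, integral_zero, zero_add, hf0] at h
    rw [c2, c4]
    linarith [mul_div_right_comm β (∫ x in Ω, b x * (z.1 x ^ α * z.2 x ^ (β - 1) * φ x)) (α + β)]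
  have hself : (∫ x in Ω, lam * f x * z.1 x ^ (-q) * z.1 x) +
      (∫ x in Ω, α / (α + β) * b x * (z.1 x ^ (α - 1) * z.2 x ^ β) * z.1 x) +
      ((∫ x in Ω, mu * g x * z.2 x ^ (-q) * z.2 x) +
      (∫ x in Ω, β / (α + β) * b x * (z.1 x ^ α * z.2 x ^ (β - 1)) * z.2 x)) =
      form s Ω z.1 z.1 + form s Ω z.2 z.2 := by
    have e1 : ∫ x in Ω, lam * f x * z.1 x ^ (-q) * z.1 x =
        ∫ x in Ω, lam * f x * max (z.1 x) 0 ^ (1 - q) := by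
      refine integral_congr_ae ?_
      filter_upwards [hpos1] with x hx
      rw [max_eq_left hx.le, show 1 - q = -q + 1 by ring, Real.rpow_add_one hx.ne']; ring
    have e2 : ∫ x in Ω, mu * g x * z.2 x ^ (-q) * z.2 x =
        ∫ x in Ω, mu * g x * max (z.2 x) 0 ^ (1 - q) := by
      refine integral_congr_ae ?_
      filter_upwards [hpos2] with x hx
      rw [max_eq_left hx.le, show 1 - q = -q + 1 by ring, Real.rpow_add_one hx.ne']; ring
    have e3 : ∫ x in Ω, α / (α + β) * b x * (z.1 x ^ (α - 1) * z.2 x ^ β) * z.1 x =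
        α / (α + β) * supB Ω α β b z := by
      rw [supB, ← integral_const_mul]
      refine integral_congr_ae ?_
      filter_upwards [hpos1] with x hx
      rw [max_eq_left hx.le, max_eq_left (hz2 x), Real.rpow_sub_one hx.ne']
      field_simp
    have e4 : ∫ x in Ω, β / (α + β) * b x * (z.1 x ^ α * z.2 x ^ (β - 1)) * z.2 x =
        β / (α + β) * supB Ω α β b z := by
      rw [supB, ← integral_const_mul]
      refine integral_congr_ae ?_
      filter_upwards [hpos2] with x hx
      rw [max_eq_left hx.le, max_eq_left (hz1 x), Real.rpow_sub_one hx.ne']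
      field_simp
    have e5 : α / (α + β) * supB Ω α β b z + β / (α + β) * supB Ω α β b z = supB Ω α β b z := by
      field_simp
    rw [e1, e2, e3, e4]
    have := H.singF_eq hz
    unfold quadA at hN
    linarith
  -- Each inequality tested with its own component has a definite sign, while by the Nehari identity
  -- their sum is an equality; hence both are equalities.
  have hs1 := hL1 z.1 hz.1 hz1
  have hs2 := hL2 z.2 hz.2 hz2
  have hJ1 : ∀ φ ∈ X₀ s Ω, IntegrableOn (fun x => lam * f x * z.1 x ^ (-q) * φ x) Ω :=
    fun φ hφ => ((hI1 φ hφ).const_mul lam).congr (ae_of_all _ fun x => by simp only; ring)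
  have hJ2 : ∀ φ ∈ X₀ s Ω, IntegrableOn (fun x => mu * g x * z.2 x ^ (-q) * φ x) Ω :=
    fun φ hφ => ((hI2 φ hφ).const_mul mu).congr (ae_of_all _ fun x => by simp only; ring)
  have hJ3 : ∀ φ ∈ X₀ s Ω,
      IntegrableOn (fun x => α / (α + β) * b x * (z.1 x ^ (α - 1) * z.2 x ^ β) * φ x) Ω :=
    fun φ hφ => ((hI3 φ hφ).const_mul (α / (α + β))).congr
      (ae_of_all _ fun x => by simp only; ring)
  have hJ4 : ∀ φ ∈ X₀ s Ω,
      IntegrableOn (fun x => β / (α + β) * b x * (z.1 x ^ α * z.2 x ^ (β - 1)) * φ x) Ω :=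
    fun φ hφ => ((hI4 φ hφ).const_mul (β / (α + β))).congr
      (ae_of_all _ fun x => by simp only; ring)
  have hm1 : ∀ᵐ x ∂(volume.restrict Ω), 0 ≤ lam * f x * z.1 x ^ (-q) := by
    filter_upwards [H.hf0] with x hf
    have := Real.rpow_nonneg (hz1 x) (-q)
    positivity
  have hm2 : ∀ᵐ x ∂(volume.restrict Ω), 0 ≤ mu * g x * z.2 x ^ (-q) := by
    filter_upwards [H.hg0] with x hg
    have := Real.rpow_nonneg (hz2 x) (-q)
    positivity
  refine ⟨hz, hpos1, hpos2, fun t ht => ⟨hI1 _ ht.1, hI2 _ ht.2, hI3 _ ht.1, hI4 _ ht.2⟩,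
    fun t ht => ?_⟩
  have h1 := functional_eq_zero H.hs0 H.measurableSet hz.1 hpos1 hm1 hJ1 hJ3 hL1 (by linarith) ht.1
  have h2 := functional_eq_zero H.hs0 H.measurableSet hz.2 hpos2 hm2 hJ2 hJ4 hL2 (by linarith) ht.2
  rw [c1, c3] at h1
  rw [c2, c4] at h2
  linarith

end Setting

end Solution

/-! ### Existence of minimizers -/

section Existence

open Filter Topology

variable {n : ℕ} {s : ℝ} {Ω : Set (E n)} {α β q : ℝ} {f g b : E n → ℝ} {lam mu : ℝ}
  {u v w φ ψ : E n → ℝ} {z : (E n → ℝ) × (E n → ℝ)}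

/-- `ρ` separates the two parts of the Nehari manifold. -/
structure IsSeparating {n : ℕ} (s : ℝ) (Ω : Set (E n)) (α β q : ℝ) (f g b : E n → ℝ)
    (lam mu ρ : ℝ) : Prop where
  pos : 0 < ρ
  sep : ∀ z ∈ Y s Ω, RaySeparated q (α + β) ρ (quadA s Ω z) (singF Ω q f g lam mu z)
    (supB Ω α β b z)

/-- The part of the Nehari manifold above the level `ρ`. -/
def upperNehari {n : ℕ} (s : ℝ) (Ω : Set (E n)) (α β q : ℝ) (f g b : E n → ℝ)
    (lam mu ρ : ℝ) : Set ((E n → ℝ) × (E n → ℝ)) :=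
  {z | z ∈ Y s Ω ∧ quadA s Ω z = singF Ω q f g lam mu z + supB Ω α β b z ∧ ρ ≤ quadA s Ω z}

theorem minimizesAlong_of_small
    (h : ∀ φ ∈ X₀ s Ω, ∀ ψ ∈ X₀ s Ω, (∀ x, 0 ≤ φ x) → (∀ x, 0 ≤ ψ x) → ∀ η : ℝ, 0 < η →
      ∃ ε t : ℝ, 0 < ε ∧ ε < η ∧ 0 < t ∧ |t - 1| < η ∧
        energy s Ω α β q f g b lam mu (t • z) ≤
          energy s Ω α β q f g b lam mu (t • (z + ε • (φ, ψ)))) :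
    MinimizesAlong s Ω α β q f g b lam mu z := by
  intro φ hφ ψ hψ hφ0 hψ0
  choose ε t h1 h2 h3 h4 h5 using fun k : ℕ =>
    h φ hφ ψ hψ hφ0 hψ0 (1 / ((k : ℝ) + 1)) (by positivity)
  refine ⟨ε, t, h1, ?_, h3, ?_, h5⟩
  · exact squeeze_zero (fun k => (h1 k).le) (fun k => (h2 k).le)
      tendsto_one_div_add_atTop_nhds_zero_nat
  · rw [tendsto_iff_dist_tendsto_zero]
    exact squeeze_zero (fun k => dist_nonneg) (fun k => by rw [Real.dist_eq]; exact (h4 k).le)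
      tendsto_one_div_add_atTop_nhds_zero_nat

namespace Setting

variable (H : Setting s Ω α β q f g b lam mu)
include H

theorem energy_eq_scalarFiber (z : (E n → ℝ) × (E n → ℝ)) : energy s Ω α β q f g b lam mu z =
    scalarFiber q (α + β) (quadA s Ω z) (singF Ω q f g lam mu z) (supB Ω α β b z) 1 := by
  rw [← H.fiber_eq one_pos, fiber, one_smul]

theorem energy_smul {t : ℝ} (ht : 0 < t) : energy s Ω α β q f g b lam mu (t • z) =
    scalarFiber q (α + β) (quadA s Ω z) (singF Ω q f g lam mu z) (supB Ω α β b z) t :=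
  H.fiber_eq ht

/-- Bounded sequences have subsequences along which the singular and superlinear terms converge to
their values at a nonnegative pair of no larger quadratic energy. -/
theorem exists_subseq_pair {Z : ℕ → (E n → ℝ) × (E n → ℝ)} (hZ : ∀ k, Z k ∈ Y s Ω) {M : ℝ}
    (hM : ∀ k, quadA s Ω (Z k) ≤ M) :
    ∃ ns : ℕ → ℕ, StrictMono ns ∧ ∃ z ∈ Y s Ω, (∀ x, 0 ≤ z.1 x) ∧ (∀ x, 0 ≤ z.2 x) ∧ ∃ a : ℝ,
      Tendsto (fun k => quadA s Ω (Z (ns k))) atTop (𝓝 a) ∧ quadA s Ω z ≤ a ∧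
      Tendsto (fun k => singF Ω q f g lam mu (Z (ns k))) atTop (𝓝 (singF Ω q f g lam mu z)) ∧
      Tendsto (fun k => supB Ω α β b (Z (ns k))) atTop (𝓝 (supB Ω α β b z)) := by
  have hF1 : ∀ k, form s Ω (Z k).1 (Z k).1 ≤ M := fun k => by
    have := hM k
    have := form_self_nonneg H.hs0 (Ω := Ω) (Z k).2
    unfold quadA at *; linarith
  have hF2 : ∀ k, form s Ω (Z k).2 (Z k).2 ≤ M := fun k => by
    have := hM k
    have := form_self_nonneg H.hs0 (Ω := Ω) (Z k).1
    unfold quadA at *; linarith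
  obtain ⟨n₁, hn₁, u, hu, a₁, ha₁, hua, hLp₁, hae₁⟩ := exists_subseq_tendsto H.hn H.hs0 H.measurableSet H.hΩb
    H.hp H.hσ H.hS (fun k => (hZ k).1) hF1
  obtain ⟨n₂, hn₂, w, hw, a₂, ha₂, hwa, hLp₂, hae₂⟩ := exists_subseq_tendsto H.hn H.hs0 H.measurableSet H.hΩb
    H.hp H.hσ H.hS (fun k => (hZ (n₁ k)).2) (fun k => hF2 (n₁ k))
  have hn₂' := hn₂.tendsto_atTop
  have hz : (u, w) ∈ Y s Ω := ⟨hu, hw⟩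
  have hZ' : ∀ k, Z (n₁ (n₂ k)) ∈ Y s Ω := fun k => hZ _
  have hp₁ := hLp₁.comp hn₂'
  have hae₁' : ∀ᵐ x ∂(volume : Measure (E n)),
      Tendsto (fun k => (Z (n₁ (n₂ k))).1 x) atTop (𝓝 (u x)) :=
    hae₁.mono fun x hx => hx.comp hn₂'
  have hsing := H.tendsto_singF hZ' hz hp₁ hLp₂
  have hsup := H.tendsto_supB hZ' hz hp₁ hLp₂ hae₁' hae₂
  -- Positive parts leave the singular and superlinear terms unchanged and do not increase the
  -- quadratic one, so the limit may be taken nonnegative.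
  have e1 : singF Ω q f g lam mu (fun x => max (u x) 0, fun x => max (w x) 0) =
      singF Ω q f g lam mu (u, w) := by
    simp only [singF, max_assoc, max_self]
  have e2 : supB Ω α β b (fun x => max (u x) 0, fun x => max (w x) 0) = supB Ω α β b (u, w) := by
    simp only [supB, max_assoc, max_self]
  refine ⟨n₁ ∘ n₂, hn₁.comp hn₂, (fun x => max (u x) 0, fun x => max (w x) 0),
    ⟨posPart_mem_X₀ H.measurableSet hu, posPart_mem_X₀ H.measurableSet hw⟩, fun x => le_max_right _ _,
    fun x => le_max_right _ _, a₁ + a₂, (ha₁.comp hn₂').add ha₂, ?_, ?_, ?_⟩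
  · have h1 := form_posPart_le H.hs0 H.measurableSet hu
    have h2 := form_posPart_le H.hs0 H.measurableSet hw
    simp only [quadA]
    linarith
  · rw [e1]; exact hsing
  · rw [e2]; exact hsup

theorem quadA_add_smul (hz : z ∈ Y s Ω) (hφ : φ ∈ X₀ s Ω) (hψ : ψ ∈ X₀ s Ω) (ε : ℝ) :
    quadA s Ω (z + ε • (φ, ψ)) = quadA s Ω z + (2 * ε * (form s Ω z.1 φ + form s Ω z.2 ψ) +
      ε ^ 2 * (form s Ω φ φ + form s Ω ψ ψ)) := by
  have e1 := form_add_smul_self H.hs0 H.measurableSet hz.1 hφ ε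
  have e2 := form_add_smul_self H.hs0 H.measurableSet hz.2 hψ ε
  simp only [quadA, Prod.fst_add, Prod.snd_add, Prod.smul_fst, Prod.smul_snd]
  rw [e1, e2]; ring

theorem add_smul_mem_Y (hz : z ∈ Y s Ω) (hφ : φ ∈ X₀ s Ω) (hψ : ψ ∈ X₀ s Ω) (ε : ℝ) :
    z + ε • (φ, ψ) ∈ Y s Ω :=
  ⟨add_mem_X₀ H.measurableSet hz.1 (smul_mem_X₀ H.measurableSet _ hφ), add_mem_X₀ H.measurableSet hz.2 (smul_mem_X₀ H.measurableSet _ hψ)⟩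

theorem tendsto_quadA (hz : z ∈ Y s Ω) (hφ : φ ∈ X₀ s Ω) (hψ : ψ ∈ X₀ s Ω) {ε : ℕ → ℝ}
    (hε : Tendsto ε atTop (𝓝 0)) :
    Tendsto (fun k => quadA s Ω (z + ε k • (φ, ψ))) atTop (𝓝 (quadA s Ω z)) := by
  simp_rw [H.quadA_add_smul hz hφ hψ]
  have := ((((hε.const_mul 2).mul_const (form s Ω z.1 φ + form s Ω z.2 ψ)).add
    ((hε.pow 2).mul_const (form s Ω φ φ + form s Ω ψ ψ)))).const_add (quadA s Ω z)
  simpa using this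

theorem tendsto_perturbation {ε : ℕ → ℝ} (hε : Tendsto ε atTop (𝓝 0)) (u φ : E n → ℝ) :
    Tendsto (fun k => ∫ x, |(u + ε k • φ) x - u x| ^ (α + β)) atTop (𝓝 0) ∧
      ∀ x, Tendsto (fun k => (u + ε k • φ) x) atTop (𝓝 (u x)) := by
  have hp := H.p_pos
  constructor
  · have e : ∀ k, ∫ x, |(u + ε k • φ) x - u x| ^ (α + β) =
        |ε k| ^ (α + β) * ∫ x, |φ x| ^ (α + β) := fun k => by
      rw [← integral_const_mul]
      congr 1; ext x
      simp only [Pi.add_apply, Pi.smul_apply, smul_eq_mul, add_sub_cancel_left]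
      rw [abs_mul, Real.mul_rpow (abs_nonneg _) (abs_nonneg _)]
    simp_rw [e]
    have := (hε.abs.rpow_const (p := α + β) (Or.inr hp.le)).mul_const (∫ x, |φ x| ^ (α + β))
    rwa [abs_zero, Real.zero_rpow hp.ne', zero_mul] at this
  · intro x
    simpa using (hε.mul_const (φ x)).const_add (u x)

theorem tendsto_terms (hz : z ∈ Y s Ω) (hφ : φ ∈ X₀ s Ω) (hψ : ψ ∈ X₀ s Ω) {ε : ℕ → ℝ}
    (hε : Tendsto ε atTop (𝓝 0)) :
    Tendsto (fun k => singF Ω q f g lam mu (z + ε k • (φ, ψ))) atTop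
        (𝓝 (singF Ω q f g lam mu z)) ∧
      Tendsto (fun k => supB Ω α β b (z + ε k • (φ, ψ))) atTop (𝓝 (supB Ω α β b z)) := by
  obtain ⟨h1, h2⟩ := H.tendsto_perturbation hε z.1 φ
  obtain ⟨h3, h4⟩ := H.tendsto_perturbation hε z.2 ψ
  have hY := fun k => H.add_smul_mem_Y hz hφ hψ (ε k)
  exact ⟨H.tendsto_singF hY hz h1 h3, H.tendsto_supB hY hz h1 h3 (ae_of_all _ h2) (ae_of_all _ h4)⟩

omit H in
theorem _root_.FracSystem.tendsto_scalar {A F B : ℕ → ℝ} {A₀ F₀ B₀ t : ℝ} (hA : Tendsto A atTop (𝓝 A₀))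
    (hF : Tendsto F atTop (𝓝 F₀)) (hB : Tendsto B atTop (𝓝 B₀)) :
    Tendsto (fun k => scalarFiber q (α + β) (A k) (F k) (B k) t) atTop
        (𝓝 (scalarFiber q (α + β) A₀ F₀ B₀ t)) ∧
      Tendsto (fun k => scalarDefect q (α + β) (A k) (F k) (B k) t) atTop
        (𝓝 (scalarDefect q (α + β) A₀ F₀ B₀ t)) :=
  ⟨((hA.const_mul _).div_const _ |>.sub ((hF.const_mul _).div_const _)).sub
    ((hB.const_mul _).div_const _), ((hA.const_mul _).sub (hF.const_mul _)).sub (hB.const_mul _)⟩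

theorem supB_nonpos_of_quadA (hz : z ∈ Y s Ω) (hA : quadA s Ω z = 0) : supB Ω α β b z ≤ 0 := by
  have := H.supB_le hz
  have hp := H.p_pos
  rwa [hA, Real.zero_rpow (by positivity), mul_zero] at this

/-- Zero energy would give a zero L^p norm, contradicting positivity on Ω, which is not a null set
because b⁺ does not vanish almost everywhere there. -/
theorem quadA_pos_of_pos (hz : z ∈ Y s Ω) (hpos : ∀ᵐ x ∂(volume.restrict Ω), 0 < z.1 x) :
    0 < quadA s Ω z := by
  have hp := H.p_pos
  have h0 := form_self_nonneg H.hs0 (Ω := Ω) z.1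
  have h0' := form_self_nonneg H.hs0 (Ω := Ω) z.2
  suffices h : form s Ω z.1 z.1 ≠ 0 by
    unfold quadA
    have := lt_of_le_of_ne h0 h.symm
    linarith
  intro h
  have h1 := H.integral_rpow_le hz.1
  rw [h, zero_div, Real.zero_rpow (by positivity)] at h1
  have h2 : ∫ x in Ω, |z.1 x| ^ (α + β) = 0 :=
    le_antisymm h1 (integral_nonneg fun x => by positivity)
  rw [integral_eq_zero_iff_of_nonneg (fun x => by simp only [Pi.zero_apply]; positivity)
    (H.integrable_rpow hz.1).integrableOn] at h2
  have h3 : ∀ᵐ x ∂(volume.restrict Ω), False := by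
    filter_upwards [hpos, h2] with x hx hx2
    simp only [Pi.zero_apply] at hx2
    have : 0 < |z.1 x| ^ (α + β) := Real.rpow_pos_of_pos (abs_pos.2 hx.ne') _
    linarith
  exact H.hbpos (h3.mono fun x hx => hx.elim)

/-- The solution below the level `ρ`: a minimizer of the energy on a ball. -/
theorem exists_lower_solution {ρ : ℝ} (hρ : IsSeparating s Ω α β q f g b lam mu ρ) :
    ∃ z, IsPositiveWeakSolution s Ω α β q f g b lam mu z ∧
      z ∈ nehariPlus s Ω α β q f g b lam mu ∧ quadA s Ω z < ρ := by
  have hq : 0 < 1 - q := by linarith [H.hq1]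
  have hp := H.p_pos
  have hρ0 := hρ.pos
  let J := energy s Ω α β q f g b lam mu
  let V : Set ℝ := J '' {z | z ∈ Y s Ω ∧ quadA s Ω z ≤ ρ}
  have hVne : V.Nonempty := by
    refine ⟨J 0, 0, ⟨⟨zero_mem_X₀, zero_mem_X₀⟩, ?_⟩, rfl⟩
    simp [quadA, form, hρ0.le]
  have hVb : BddBelow V := by
    refine ⟨-((sobolevConst s Ω (α + β) ^ (-((1 - q) / 2)) *
      bigLambda Ω α β q f g lam mu ^ ((1 + q) / 2) * ρ ^ ((1 - q) / 2)) / (1 - q)) -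
      (normLp Ω ⊤ b * sobolevConst s Ω (α + β) ^ (-((α + β) / 2)) * ρ ^ ((α + β) / 2)) / (α + β), ?_⟩
    rintro _ ⟨z, ⟨hz, hzρ⟩, rfl⟩
    have hA := quadA_nonneg H.hs0 (Ω := Ω) z
    have hS := H.hS
    have hΛ : 0 ≤ bigLambda Ω α β q f g lam mu := by
      unfold bigLambda
      exact add_nonneg
        (Real.rpow_nonneg (mul_nonneg (abs_nonneg _) ENNReal.toReal_nonneg) _)
        (Real.rpow_nonneg (mul_nonneg (abs_nonneg _) ENNReal.toReal_nonneg) _)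
    have hb0 : 0 ≤ normLp Ω ⊤ b := ENNReal.toReal_nonneg
    have h1 : singF Ω q f g lam mu z ≤ sobolevConst s Ω (α + β) ^ (-((1 - q) / 2)) *
        bigLambda Ω α β q f g lam mu ^ ((1 + q) / 2) * ρ ^ ((1 - q) / 2) :=
      (H.singF_le hz).trans (by gcongr)
    have h2 : supB Ω α β b z ≤ normLp Ω ⊤ b * sobolevConst s Ω (α + β) ^ (-((α + β) / 2)) *
        ρ ^ ((α + β) / 2) := (H.supB_le hz).trans (by gcongr)
    have h3 := div_le_div_of_nonneg_right h1 hq.le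
    have h4 := div_le_div_of_nonneg_right h2 hp.le
    simp only [J, H.energy_eq]
    linarith
  obtain ⟨e, -, he, heV⟩ := exists_seq_tendsto_sInf hVne hVb
  choose Z hZ hZe using heV
  obtain ⟨ns, hns, z, hz, hz1, hz2, a, ha, hza, hF, hB⟩ := H.exists_subseq_pair
    (fun k => (hZ k).1) (fun k => (hZ k).2)
  have haρ : a ≤ ρ := le_of_tendsto' ha fun k => (hZ _).2
  have hmin : ∀ y ∈ Y s Ω, quadA s Ω y ≤ ρ → J z ≤ J y := by
    intro y hy hyρ
    have h1 : J z ≤ sInf V := by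
      have h2 := (tendsto_scalar (α := α) (β := β) (q := q) (t := 1) ha hF hB).1
      have h3 : Tendsto (fun k => J (Z (ns k))) atTop (𝓝 (sInf V)) := by
        exact (he.comp hns.tendsto_atTop).congr fun k => (hZe (ns k)).symm
      have h4 := tendsto_nhds_unique (h3.congr fun k => H.energy_eq_scalarFiber _) h2
      rw [h4]
      simp only [J, H.energy_eq_scalarFiber, scalarFiber]
      linarith
    exact h1.trans (csInf_le hVb ⟨y, ⟨hy, hyρ⟩, rfl⟩)
  have hsep := hρ.sep z hz
  have hder := hasDerivAt_scalarFiber (A := quadA s Ω z) (F := singF Ω q f g lam mu z)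
    (B := supB Ω α β b z) H.hq1 H.hp one_pos
  simp only [one_mul, Real.one_rpow] at hder
  -- On the sphere the radial derivative is positive. Shrinking keeps the point in the ball, so
  -- minimality makes the left slopes nonpositive: a contradiction.
  have hlt : quadA s Ω z < ρ := by
    refine lt_of_le_of_ne (hza.trans haρ) fun h => ?_
    have h1 := scalarDefect_pos_of_level H.hp H.hq0 hsep hρ0 one_pos (by rw [h]; ring)
    simp only [scalarDefect, one_pow, one_mul, Real.one_rpow] at h1
    have hle : 𝓝[<] (1 : ℝ) ≤ 𝓝[≠] 1 := nhdsWithin_mono 1 fun t ht => ne_of_lt ht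
    have h2 := (hasDerivAt_iff_tendsto_slope.1 hder).mono_left hle
    refine h1.not_ge (le_of_tendsto h2 ?_)
    filter_upwards [self_mem_nhdsWithin,
      mem_nhdsWithin_of_mem_nhds (lt_mem_nhds (zero_lt_one' ℝ))] with t ht1 ht0
    have ht1 : t < 1 := ht1
    have h3 : J z ≤ J (t • z) := by
      refine hmin _ (H.smul_mem_Y t hz) ?_
      rw [H.quadA_smul, h]
      have : t ^ 2 ≤ 1 := pow_le_one₀ ht0.le ht1.le
      nlinarith
    simp only [J] at h3
    rw [H.energy_eq_scalarFiber, H.energy_smul ht0] at h3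
    rw [slope_def_field]
    exact div_nonpos_of_nonneg_of_nonpos (by linarith) (by linarith)
  -- An interior minimizer is a local minimum along its ray, so the radial derivative vanishes. The
  -- case z = 0 is not yet excluded; it is ruled out by the positivity in `isPositiveWeakSolution`.
  have hN : quadA s Ω z = singF Ω q f g lam mu z + supB Ω α β b z := by
    have hloc : IsLocalMin (scalarFiber q (α + β) (quadA s Ω z) (singF Ω q f g lam mu z)
        (supB Ω α β b z)) 1 := by
      have h1 : Tendsto (fun t : ℝ => t ^ 2 * quadA s Ω z) (𝓝 1) (𝓝 (1 ^ 2 * quadA s Ω z)) :=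
        ((continuous_id.pow 2).mul continuous_const).tendsto 1
      rw [one_pow, one_mul] at h1
      filter_upwards [h1.eventually (gt_mem_nhds hlt), lt_mem_nhds (zero_lt_one' ℝ)] with t ht ht0
      have h3 : J z ≤ J (t • z) := hmin _ (H.smul_mem_Y t hz) (by rw [H.quadA_smul]; exact ht.le)
      simp only [J] at h3
      rwa [H.energy_eq_scalarFiber, H.energy_smul ht0] at h3
    have := hloc.hasDerivAt_eq_zero hder
    linarith
  have hMA : MinimizesAlong s Ω α β q f g b lam mu z := by
    refine minimizesAlong_of_small fun φ hφ ψ hψ hφ0 hψ0 η hη => ?_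
    have hε : Tendsto (fun k : ℕ => 1 / ((k : ℝ) + 1)) atTop (𝓝 0) :=
      tendsto_one_div_add_atTop_nhds_zero_nat
    obtain ⟨k, h1, h2⟩ := (((H.tendsto_quadA hz hφ hψ hε).eventually (gt_mem_nhds hlt)).and
      (hε.eventually (gt_mem_nhds hη))).exists
    refine ⟨1 / ((k : ℝ) + 1), 1, by positivity, h2, one_pos, by simpa using hη, ?_⟩
    rw [one_smul, one_smul]
    exact hmin _ (H.add_smul_mem_Y hz hφ hψ _) h1.le
  have hsol := H.isPositiveWeakSolution hz hz1 hz2 hN hMA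
  refine ⟨z, hsol, ⟨H.mem_nehari_iff.2 ⟨hz, hN⟩, ?_⟩, hlt⟩
  have hA := H.quadA_pos_of_pos hz hsol.pos_fst
  -- On the Nehari manifold the second fibering derivative equals (1+q)A − (p−1+q)B, positive below
  -- the level.
  have h1 := (hsep 1 one_pos).2 hA (by simpa using hlt.le)
  simp only [Real.one_rpow, one_pow, one_mul] at h1
  rw [H.deriv_deriv_fiber]
  nlinarith

/-! ### The part of the Nehari manifold above the level. -/

theorem smul_mem_upperNehari {ρ t : ℝ} (hz : z ∈ Y s Ω) (ht : 0 < t)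
    (htρ : ρ ≤ t ^ 2 * quadA s Ω z)
    (h0 : scalarDefect q (α + β) (quadA s Ω z) (singF Ω q f g lam mu z) (supB Ω α β b z) t = 0) :
    t • z ∈ upperNehari s Ω α β q f g b lam mu ρ := by
  refine ⟨H.smul_mem_Y t hz, ?_, by rwa [H.quadA_smul]⟩
  rw [H.quadA_smul, singF_smul ht, supB_smul ht]
  exact scalarDefect_smul_iff.1 h0

/-- On a diagonal pair (v, v) the superlinear term is ∫ b v^p, which is positive for a suitable v
concentrated where b is positive; the ray of such a pair meets the set. -/
theorem upperNehari_nonempty {ρ : ℝ} (hρ : IsSeparating s Ω α β q f g b lam mu ρ) :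
    (upperNehari s Ω α β q f g b lam mu ρ).Nonempty := by
  obtain ⟨v, hv, hv0, hvB⟩ := exists_mem_X₀_integral_pos H.hn H.hs0 H.hs1 H.hΩ H.hΩb H.hb H.hbpos
    H.p_pos
  have hα : 0 < α := by linarith [H.hα]
  have hβ : 0 < β := by linarith [H.hβ]
  have hz : (v, v) ∈ Y s Ω := ⟨hv, hv⟩
  have hB : 0 < supB Ω α β b (v, v) := by
    unfold supB
    simp_rw [max_eq_left (hv0 _), ← Real.rpow_add_of_nonneg (hv0 _) hα.le hβ.le]
    exact hvB
  have hA : 0 < quadA s Ω (v, v) := (quadA_nonneg H.hs0 _).lt_of_ne fun h =>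
    (H.supB_nonpos_of_quadA hz h.symm).not_gt hB
  obtain ⟨t, ht, htρ, h0⟩ := exists_scalarDefect_eq_zero H.hp H.hq0 (hρ.sep _ hz) hρ.pos hA
    (H.singF_nonneg _) hB
  exact ⟨_, H.smul_mem_upperNehari hz ht htρ.le h0⟩

/-- The energy is coercive on the Nehari manifold. -/
theorem exists_coercive : ∃ C : ℝ, ∀ z ∈ Y s Ω,
    quadA s Ω z = singF Ω q f g lam mu z + supB Ω α β b z →
      (1 / 2 - 1 / (α + β)) / 2 * quadA s Ω z ≤ energy s Ω α β q f g b lam mu z + C := by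
  have hq : 0 < 1 - q := by linarith [H.hq1]
  have hq0 := H.hq0
  have hp := H.p_pos
  have hp2 := H.hp
  have hS := H.hS
  -- Eliminating B by the Nehari identity, the energy becomes cA − dF, with F of order A^((1−q)/2) ≤
  -- 1 + √A. Completing the square absorbs dF into half of cA.
  set c := 1 / 2 - 1 / (α + β) with hc
  have hc0 : 0 < c := by
    rw [hc, sub_pos]; exact one_div_lt_one_div_of_lt two_pos hp2
  set d := 1 / (1 - q) - 1 / (α + β) with hd
  have hd0 : 0 < d := by
    rw [hd, sub_pos]; exact one_div_lt_one_div_of_lt hq (by linarith)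
  have hΛ : 0 ≤ bigLambda Ω α β q f g lam mu := by
    unfold bigLambda
    exact add_nonneg
      (Real.rpow_nonneg (mul_nonneg (abs_nonneg _) ENNReal.toReal_nonneg) _)
      (Real.rpow_nonneg (mul_nonneg (abs_nonneg _) ENNReal.toReal_nonneg) _)
  set cF := sobolevConst s Ω (α + β) ^ (-((1 - q) / 2)) *
    bigLambda Ω α β q f g lam mu ^ ((1 + q) / 2) with hcF
  have hcF0 : 0 ≤ cF := by positivity
  refine ⟨d * cF + (d * cF) ^ 2 / (2 * c), fun z hz hN => ?_⟩
  have hA := quadA_nonneg H.hs0 (Ω := Ω) z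
  have hF := H.singF_le hz
  rw [← hcF] at hF
  set A := quadA s Ω z
  have h1 : A ^ ((1 - q) / 2) ≤ 1 + √A := by
    rcases le_total A 1 with h | h
    · have := Real.rpow_le_one hA h (show 0 ≤ (1 - q) / 2 by linarith)
      linarith [Real.sqrt_nonneg A]
    · have := Real.rpow_le_rpow_of_exponent_le h (show (1 - q) / 2 ≤ 1 / 2 by linarith)
      rw [← Real.sqrt_eq_rpow] at this
      linarith
  have hen : energy s Ω α β q f g b lam mu z = c * A - d * singF Ω q f g lam mu z := by
    have hB : supB Ω α β b z = A - singF Ω q f g lam mu z := by linarith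
    rw [H.energy_eq, hB, hc, hd]
    change A / 2 - _ - _ = _
    ring
  have h2 : d * singF Ω q f g lam mu z ≤ d * (cF * (1 + √A)) := by
    gcongr
    exact hF.trans (by gcongr)
  have h3 : d * cF * √A ≤ c / 2 * A + (d * cF) ^ 2 / (2 * c) := by
    have e : c / 2 * A + (d * cF) ^ 2 / (2 * c) - d * cF * √A =
        (c * √A - d * cF) ^ 2 / (2 * c) := by
      have := Real.sq_sqrt hA
      field_simp
      linear_combination (-c ^ 2) * this
    have : 0 ≤ (c * √A - d * cF) ^ 2 / (2 * c) := by positivity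
    linarith
  rw [hen]
  nlinarith

/-- The solution above the level `ρ`: a minimizer of the energy on the upper part of the Nehari
manifold. -/
theorem exists_upper_solution {ρ : ℝ} (hρ : IsSeparating s Ω α β q f g b lam mu ρ) :
    ∃ z, IsPositiveWeakSolution s Ω α β q f g b lam mu z ∧
      z ∈ nehariMinus s Ω α β q f g b lam mu ∧ ρ ≤ quadA s Ω z := by
  have hq : 0 < 1 - q := by linarith [H.hq1]
  have hp := H.p_pos
  have hp2 := H.hp
  have hρ0 := hρ.pos
  set 𝓜 := upperNehari s Ω α β q f g b lam mu ρ with h𝓜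
  let J := energy s Ω α β q f g b lam mu
  obtain ⟨C, hC⟩ := H.exists_coercive
  have hc0 : 0 < (1 / 2 - 1 / (α + β)) / 2 := by
    refine half_pos (sub_pos.2 (one_div_lt_one_div_of_lt two_pos hp2))
  have hVne : (J '' 𝓜).Nonempty := (H.upperNehari_nonempty hρ).image J
  have hVb : BddBelow (J '' 𝓜) := by
    refine ⟨-C, ?_⟩
    rintro _ ⟨z, ⟨hz, hN, -⟩, rfl⟩
    have := hC z hz hN
    have := mul_nonneg hc0.le (quadA_nonneg H.hs0 (Ω := Ω) z)
    simp only [J]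
    linarith
  obtain ⟨e, -, he, heV⟩ := exists_seq_tendsto_sInf hVne hVb
  choose Z hZ hZe using heV
  obtain ⟨M, hM⟩ := he.bddAbove_range
  have hbdd : ∀ k, quadA s Ω (Z k) ≤ (M + C) / ((1 / 2 - 1 / (α + β)) / 2) := fun k => by
    rw [le_div_iff₀ hc0, mul_comm]
    have h1 := hC _ (hZ k).1 (hZ k).2.1
    have h2 : J (Z k) ≤ M := by rw [hZe]; exact hM ⟨k, rfl⟩
    simp only [J] at h2
    linarith
  obtain ⟨ns, hns, z, hz, hz1, hz2, a, ha, hza, hF, hB⟩ := H.exists_subseq_pair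
    (fun k => (hZ k).1) hbdd
  -- Above the level, Nehari points have B bounded below by a fixed positive number. This survives
  -- in the limit, so the limit is nonzero and its ray meets the upper set.
  have hBpos : 0 < supB Ω α β b z := by
    have h1 : ∀ k, (1 + q) * ρ ≤ (α + β - 1 + q) * supB Ω α β b (Z (ns k)) := fun k => by
      have h2 := superlinear_pos_of_nehari (hρ.sep _ (hZ (ns k)).1) (hZ (ns k)).2.1 (hZ (ns k)).2.2
      have h3 : (1 + q) * ρ ≤ (1 + q) * quadA s Ω (Z (ns k)) :=
        mul_le_mul_of_nonneg_left (hZ (ns k)).2.2 (by linarith [H.hq0])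
      linarith
    have h2 := ge_of_tendsto' (hB.const_mul (α + β - 1 + q)) h1
    have h3 : 0 < (1 + q) * ρ := mul_pos (by linarith [H.hq0]) hρ0
    exact pos_of_mul_pos_right (h3.trans_le h2) (by linarith [H.hq0])
  have hApos : 0 < quadA s Ω z := (quadA_nonneg H.hs0 _).lt_of_ne fun h =>
    (H.supB_nonpos_of_quadA hz h.symm).not_gt hBpos
  -- The limit z may have lost quadratic energy and need not lie on the Nehari manifold; it is moved
  -- back along its ray.
  obtain ⟨t₀, ht₀, ht₀ρ, hd₀⟩ := exists_scalarDefect_eq_zero H.hp H.hq0 (hρ.sep _ hz) hρ0 hApos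
    (H.singF_nonneg _) hBpos
  set y := t₀ • z with hy
  have hyM : y ∈ 𝓜 := H.smul_mem_upperNehari hz ht₀ ht₀ρ.le hd₀
  have hyY : y ∈ Y s Ω := hyM.1
  have hyρ : ρ < quadA s Ω y := by rw [hy, H.quadA_smul]; exact ht₀ρ
  have hmin : ∀ x ∈ 𝓜, J y ≤ J x := by
    intro x hx
    have h1 : J y ≤ sInf (J '' 𝓜) := by
      have h2 := (tendsto_scalar (α := α) (β := β) (q := q) (t := t₀) ha hF hB).1
      have h3 : Tendsto (fun k => J (Z (ns k))) atTop (𝓝 (sInf (J '' 𝓜))) := by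
        exact (he.comp hns.tendsto_atTop).congr fun k => (hZe (ns k)).symm
      -- The comparison uses the same factor t₀ on the minimizing sequence: t₀ Z_k is eventually
      -- above the level, where Z_k maximizes the energy of its ray, so J(t₀ Z_k) ≤ J(Z_k).
      have h4 : scalarFiber q (α + β) a (singF Ω q f g lam mu z) (supB Ω α β b z) t₀ ≤
          sInf (J '' 𝓜) := by
        refine le_of_tendsto_of_tendsto h2 h3 ?_
        have h5 : ρ < t₀ ^ 2 * a := ht₀ρ.trans_le (by gcongr)
        filter_upwards [(ha.const_mul (t₀ ^ 2)).eventually (lt_mem_nhds h5)] with k hk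
        have h6 := hZ (ns k)
        simp only [J]
        rw [H.energy_eq_scalarFiber]
        exact scalarFiber_le H.hp H.hq0 H.hq1 (hρ.sep _ h6.1) hρ0 h6.2.1 h6.2.2 ht₀ hk.le
      refine le_trans ?_ h4
      simp only [J, hy]
      rw [H.energy_smul ht₀]
      simp only [scalarFiber]
      have : t₀ ^ 2 * quadA s Ω z ≤ t₀ ^ 2 * a := by gcongr
      linarith
    exact h1.trans (csInf_le hVb ⟨x, hx, rfl⟩)
  have hsep := hρ.sep y hyY
  have hN := hyM.2.1
  have hMA : MinimizesAlong s Ω α β q f g b lam mu y := by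
    refine minimizesAlong_of_small fun φ hφ ψ hψ hφ0 hψ0 η hη => ?_
    -- The defect of y is positive at 1 − δ and negative at 1 + δ, both strictly, and so remains for
    -- small perturbations. The intermediate value theorem then gives t in between that puts the
    -- perturbed pair back on the Nehari manifold; the last condition keeps it above the level.
    obtain ⟨δ, hδ0, hδη, hδ1, hδρ⟩ : ∃ δ : ℝ, 0 < δ ∧ δ < η ∧ δ < 1 ∧
        ρ < (1 - δ) ^ 2 * quadA s Ω y := by
      have h1 : Tendsto (fun δ : ℝ => (1 - δ) ^ 2 * quadA s Ω y) (𝓝[>] 0) (𝓝 (quadA s Ω y)) := by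
        have : Continuous fun δ : ℝ => (1 - δ) ^ 2 * quadA s Ω y := by fun_prop
        have := this.tendsto 0
        simp only [sub_zero, one_pow, one_mul] at this
        exact this.mono_left nhdsWithin_le_nhds
      have h2 : ∀ᶠ δ in 𝓝[>] (0 : ℝ), δ < η := mem_nhdsWithin_of_mem_nhds (gt_mem_nhds hη)
      have h3 : ∀ᶠ δ in 𝓝[>] (0 : ℝ), δ < 1 :=
        mem_nhdsWithin_of_mem_nhds (gt_mem_nhds (zero_lt_one' ℝ))
      have h4 : ∀ᶠ δ in 𝓝[>] (0 : ℝ), 0 < δ := self_mem_nhdsWithin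
      obtain ⟨δ, ⟨h2, h3, h4⟩, h5⟩ := (((h1.eventually (lt_mem_nhds hyρ)).and
        (h2.and h3)).and h4).exists
      exact ⟨δ, h5, h3, h4, h2⟩
    have hδ' : 0 < 1 - δ := by linarith
    have hd1 := (scalarDefect_sign H.hp H.hq0 hsep hρ0 hN hyρ.le hδ' hδρ.le).1 (by linarith)
    have hd2 := (scalarDefect_sign (t := 1 + δ) H.hp H.hq0 hsep hρ0 hN hyρ.le (by linarith)
      (by nlinarith)).2 (by linarith)
    have hε : Tendsto (fun k : ℕ => 1 / ((k : ℝ) + 1)) atTop (𝓝 0) :=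
      tendsto_one_div_add_atTop_nhds_zero_nat
    have hA' := H.tendsto_quadA hyY hφ hψ hε
    obtain ⟨hF', hB'⟩ := H.tendsto_terms hyY hφ hψ hε
    have hs1 := (tendsto_scalar (α := α) (β := β) (q := q) (t := 1 - δ) hA' hF' hB').2
    have hs2 := (tendsto_scalar (α := α) (β := β) (q := q) (t := 1 + δ) hA' hF' hB').2
    obtain ⟨k, ⟨⟨h1, h2⟩, h3⟩, h4⟩ := ((((hs1.eventually (lt_mem_nhds hd1)).and
      (hs2.eventually (gt_mem_nhds hd2))).and
        ((hA'.const_mul ((1 - δ) ^ 2)).eventually (lt_mem_nhds hδρ))).and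
          (hε.eventually (gt_mem_nhds hη))).exists
    obtain ⟨t, ht, ht0⟩ := intermediate_value_Icc' (show 1 - δ ≤ 1 + δ by linarith)
      (continuousOn_scalarDefect.mono (s := Ioi 0) (fun x hx => hδ'.trans_le hx.1) :
        ContinuousOn (scalarDefect q (α + β) _ _ _) (Icc (1 - δ) (1 + δ))) ⟨h2.le, h1.le⟩
    have htpos : 0 < t := hδ'.trans_le ht.1
    have hmono : ∀ x : ℝ, 0 ≤ x → (1 - δ) ^ 2 * x ≤ t ^ 2 * x := fun x hx => by
      have := ht.1
      gcongr
    refine ⟨1 / ((k : ℝ) + 1), t, by positivity, h4, htpos,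
      lt_of_le_of_lt (abs_le.2 ⟨by linarith [ht.1], by linarith [ht.2]⟩) hδη, ?_⟩
    -- The chain is J(ty) ≤ J(y) ≤ J(t(y + ε(φ, ψ))): y maximizes its ray above the level, and it
    -- minimizes over the upper set.
    have h5 := hmin _ (H.smul_mem_upperNehari (H.add_smul_mem_Y hyY hφ hψ (1 / ((k : ℝ) + 1))) htpos
      (h3.le.trans (hmono _ (quadA_nonneg H.hs0 _))) ht0)
    refine le_trans ?_ h5
    simp only [J]
    rw [H.energy_smul htpos, H.energy_eq_scalarFiber]
    exact scalarFiber_le H.hp H.hq0 H.hq1 hsep hρ0 hN hyρ.le htpos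
      (hδρ.le.trans (hmono _ (quadA_nonneg H.hs0 _)))
  have hy1 : ∀ x, 0 ≤ y.1 x := fun x => mul_nonneg ht₀.le (hz1 x)
  have hy2 : ∀ x, 0 ≤ y.2 x := fun x => mul_nonneg ht₀.le (hz2 x)
  refine ⟨y, H.isPositiveWeakSolution hyY hy1 hy2 hN hMA,
    ⟨H.mem_nehari_iff.2 ⟨hyY, hN⟩, ?_⟩, hyρ.le⟩
  have h1 := superlinear_pos_of_nehari hsep hN hyρ.le
  rw [H.deriv_deriv_fiber]
  nlinarith

theorem exists_isSeparating (hΓ : (lam, mu) ∈ regionΓ s Ω α β q f g b) :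
    ∃ ρ, IsSeparating s Ω α β q f g b lam mu ρ := by
  obtain ⟨-, hΛ, hΛC⟩ := hΓ
  have hb : 0 < normLp Ω ⊤ b := by
    refine ENNReal.toReal_nonneg.lt_of_ne fun h => H.hbpos ?_
    filter_upwards [ae_abs_le_of_memLp_top H.hb] with x hx
    have hx' : |b x| ≤ normLp Ω ⊤ b := hx
    rw [normLp, ← h] at hx'
    have : b x = 0 := abs_nonpos_iff.1 hx'
    simp [this]
  obtain ⟨ρ, hρ, h1, h2⟩ := exists_separating_level H.hq0 H.hp H.hS hb hΛ hΛC
  have hS := H.hS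
  refine ⟨ρ, hρ, fun z hz => raySeparated_of_bounds H.hq0 H.hp hρ h1 (by positivity) h2
    (quadA_nonneg H.hs0 z) (H.singF_le hz) (H.supB_le hz)⟩

end Setting

/-- The threshold C carries a positive power of S, so 0 < Λ < C excludes S = 0. No independent proof
of the Sobolev embedding is needed. -/
theorem sobolevConst_pos_of_region (hq0 : 0 < q) (hp : 2 < α + β)
    (hΓ : (lam, mu) ∈ regionΓ s Ω α β q f g b) : 0 < sobolevConst s Ω (α + β) := by
  obtain ⟨-, h1, h2⟩ := hΓ
  have h0 : 0 ≤ sobolevConst s Ω (α + β) := by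
    refine Real.sInf_nonneg ?_
    rintro r ⟨v, -, -, rfl⟩
    exact div_nonneg (integral_nonneg fun z => by positivity)
      (Real.rpow_nonneg (integral_nonneg fun x => by positivity) _)
  refine h0.lt_of_ne fun h => ?_
  have h3 : 0 < 2 * (α + β - 1 + q) / ((1 + q) * (α + β - 2)) :=
    div_pos (by linarith) (mul_pos (by linarith) (by linarith))
  rw [thresholdC, ← h, Real.zero_rpow h3.ne', mul_zero] at h2
  linarith

end Existence

end FracSystem

end

theorem theorem2p1 (n : ℕ) (s q α β : ℝ) (Ω : Set (FracSystem.E n))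
    (f g b : FracSystem.E n → ℝ) (lam mu : ℝ)
    (hs0 : 0 < s) (hs1 : s < 1) (hn : 2 * s < n)
    (hΩ : FracSystem.IsSmoothBoundedDomain Ω)
    (hq0 : 0 < q) (hq1 : q < 1) (hα : 1 < α) (hβ : 1 < β)
    (hαβ : 2 < α + β) (hcrit : α + β < FracSystem.critExp n s - 1)
    (hf : MemLp f (ENNReal.ofReal (FracSystem.qStar α β q)) (volume.restrict Ω))
    (hf0 : ∀ᵐ x ∂(volume.restrict Ω), 0 < f x)
    (hg : MemLp g (ENNReal.ofReal (FracSystem.qStar α β q)) (volume.restrict Ω))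
    (hg0 : ∀ᵐ x ∂(volume.restrict Ω), 0 < g x)
    (hb : MemLp b ∞ (volume.restrict Ω))
    (hbpos : ¬ ((fun x => max (b x) 0) =ᵐ[volume.restrict Ω] 0))
    (hlam : 0 < lam) (hmu : 0 < mu)
    (hΓ : (lam, mu) ∈ FracSystem.regionΓ s Ω α β q f g b) :
    ∃ z Z : (FracSystem.E n → ℝ) × (FracSystem.E n → ℝ),
      FracSystem.IsPositiveWeakSolution s Ω α β q f g b lam mu z ∧
      FracSystem.IsPositiveWeakSolution s Ω α β q f g b lam mu Z ∧
      z ∈ FracSystem.nehariPlus s Ω α β q f g b lam mu ∧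
      Z ∈ FracSystem.nehariMinus s Ω α β q f g b lam mu ∧
      FracSystem.normY s Ω z < FracSystem.normY s Ω Z := by
  have hn0 : 0 < n := by
    have : (0 : ℝ) < n := by linarith
    exact_mod_cast this
  -- A rearrangement of p < 2n/(n − 2s), in the form which says that the exponent gained in
  -- `higher_integrability` exceeds p.
  have hσ : α + β < 2 + 2 * s * (α + β) / n := by
    have hn' : (0 : ℝ) < n := by exact_mod_cast hn0
    have h1 : α + β < 2 * n / (n - 2 * s) := by
      rw [FracSystem.critExp] at hcrit
      linarith
    rw [lt_div_iff₀ (by linarith)] at h1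
    have h2 : (α + β - 2) * n < 2 * s * (α + β) := by linarith
    have h3 : α + β - 2 < 2 * s * (α + β) / n := by rwa [lt_div_iff₀ hn']
    linarith
  have H : FracSystem.Setting s Ω α β q f g b lam mu :=
    ⟨hn0, hs0, hs1, hΩ.isOpen, hΩ.isBounded, hq0, hq1, hα, hβ, hαβ, hσ, hf, hf0, hg, hg0, hb, hbpos,
      hlam, hmu, FracSystem.sobolevConst_pos_of_region hq0 hαβ hΓ⟩
  obtain ⟨ρ, hρ⟩ := H.exists_isSeparating hΓ
  obtain ⟨z, hz, hzN, hzρ⟩ := H.exists_lower_solution hρ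
  obtain ⟨Z, hZ, hZN, hZρ⟩ := H.exists_upper_solution hρ
  refine ⟨z, Z, hz, hZ, hzN, hZN, lt_of_pow_lt_pow_left₀ 2 (Real.sqrt_nonneg _) ?_⟩
  rw [FracSystem.normY_sq hs0, FracSystem.normY_sq hs0]
  exact hzρ.trans_le hZρ
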